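/- Fix an integer $m\ge 1$. For every $d$ let a $d$-dimensional population be given with mean $\mu\in\mathbb R^d$ and covariance matrix $\Sigma=\sum_{s=1}^d\lambda_s h_sh_s^T$, where $\lambda_1\ge\dots\ge\lambda_d\ge 0$ and $h_1,\dots,h_d$ is an orthonormal basis of $\mathbb R^d$ (all depending on $d$). The data $x_1,\dots,x_n$ are $x_i=\mu+\sum_{s=1}^d\lambda_s^{1/2}z_{is}h_s$, where the vectors $z_i=(z_{i1},\dots,z_{id})^T$, $i=1,\dots,n$, are i.i.d. from a distribution depending on $d$ only, with mean zero and identity covariance matrix. Put $\Sigma_2=\sum_{s=m+1}^d\lambda_sh_sh_s^T$ and $\delta=\sum_{s=m+1}^d\lambda_s/(n-1)$. Assume: (A-i) the $z_{ij}$ have finite fourth moments; $E(z_{ij_1}^2z_{ij_2}^2)=1$ for $j_1\ne j_2$; $E(z_{ij_1}z_{ij_2}z_{ij_3})=0$ whenever $j_1\notin\{j_2,j_3\}$; $E(z_{ij_1}z_{ij_2}z_{ij_3}z_{ij_4})=0$ whenever $j_1\notin\{j_2,j_3,j_4\}$; and $\limsup_{d\to\infty}\max_{1\le j\le d}\mathrm{Var}(z_{ij}^2)<\infty$.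 (C-i) $\liminf_{d\to\infty}(\lambda_j/\lambda_{j'}-1)>0$ for $1\le j<j'\le m$, $\liminf_{d\to\infty}\lambda_m^2/\mathrm{tr}(\Sigma_2^2)>0$, and $\lambda_{m+1}^2/\mathrm{tr}(\Sigma_2^2)\to 0$ as $d\to\infty$ (in particular $\mathrm{tr}(\Sigma_2^2)>0$ for all large $d$). Let $S=(n-1)^{-1}\sum_{i=1}^n(x_i-\bar x)(x_i-\bar x)^T$ with $\bar x=n^{-1}\sum_{i=1}^n x_i$, let $\hat\lambda_1\ge\dots\ge\hat\lambda_d\ge 0$ be its eigenvalues and $\hat h_1,\dots,\hat h_d$ any corresponding orthonormal eigenvectors, with signs chosen such that $h_j^T\hat h_j\ge 0$ for all $j$. Put $\beta_j=\lambda_j^{1/2}h_j$ and $\hat\beta_j=\hat\lambda_j^{1/2}\hat h_j$. Then, for each $j=1,\dots,m$, $$\frac{\|\hat\beta_j-\beta_j\|^2}{\lambda_j}=\frac{\delta}{\lambda_j}+O_P(n^{-1})$$ as $d\to\infty$ and $n\to\infty$ (in any joint regime). Consequently, in any such regime, $\hat\beta_j$ is consistent, in the sense that $\|\hat\beta_j-\beta_j\|^2/\lambda_j=o_P(1)$,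 if and only if $\delta/\lambda_j=o(1)$. -/

import Mathlib

open MeasureTheory ProbabilityTheory Filter Topology

noncomputable section

namespace HDPCA

/-- Euclidean space of column vectors of length `d`. -/
abbrev Vec (d : ℕ) : Type := EuclideanSpace ℝ (Fin d)

/-- The entry with (zero-based) index `j` of a finite family, set to `0` when there is none. -/
def entry {α : Type*} [Zero α] {d : ℕ} (f : Fin d → α) (j : ℕ) : α :=
  if hj : j < d then f ⟨j, hj⟩ else 0

/-- A `d`-dimensional population: mean `mu`, ordered eigenvalues `lam` and orthonormal
eigenvectors `h` of the covariance matrix, and the law `zlaw` of one column of the sphered data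
matrix `Z`, which has mean zero and identity covariance matrix (including the coordinates that
belong to a zero eigenvalue). -/
structure Population (d : ℕ) where
  mu : Vec d
  lam : Fin d → ℝ
  lam_antitone : Antitone lam
  lam_nonneg : ∀ j, 0 ≤ lam j
  h : OrthonormalBasis (Fin d) ℝ (Vec d)
  zlaw : Measure (Vec d)
  isProbabilityMeasure : IsProbabilityMeasure zlaw
  memLp_two : ∀ j, MemLp (fun w : Vec d => w j) 2 zlaw
  mean_zero : ∀ j, ∫ w, w j ∂zlaw = 0
  cov_eq_one : ∀ j k, ∫ w, w j * w k ∂zlaw = if j = k then 1 else 0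

namespace Population

variable {d : ℕ} (p : Population d)

/-- The observation `x = μ + H Λ^{1/2} z` with sphered coordinates `z`. -/
def datum (z : Vec d) : Vec d := p.mu + ∑ s, (√(p.lam s) * z s) • p.h s

/-- The covariance matrix `Σ = ∑ λ_s h_s h_sᵀ`. -/
def Sigma : Matrix (Fin d) (Fin d) ℝ :=
  ∑ s, p.lam s • Matrix.vecMulVec (p.h s).ofLp (p.h s).ofLp

/-- The noise part `Σ₂ = ∑_{s > m} λ_s h_s h_sᵀ` (zero-based: the indices `s` with `m ≤ s`). -/
def Sigma2 (m : ℕ) : Matrix (Fin d) (Fin d) ℝ :=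
  ∑ s with m ≤ s.val, p.lam s • Matrix.vecMulVec (p.h s).ofLp (p.h s).ofLp

/-- `δ = ∑_{s > m} λ_s / (n - 1)`. -/
def delta (m n : ℕ) : ℝ := (∑ s with m ≤ s.val, p.lam s) / ((n : ℝ) - 1)

/-- The eigenvalue with zero-based index `j`. -/
def eig (j : ℕ) : ℝ := entry p.lam j

/-- The scaled PC direction `β_j = λ_j^{1/2} h_j`, with zero-based index `j`. -/
def beta (j : ℕ) : Vec d := √(p.eig j) • entry p.h j

/-- `M_j = Var(z_j²)`. -/
def M (j : Fin d) : ℝ := variance (fun w : Vec d => w j ^ 2) p.zlaw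

lemma datum_apply (z : Vec d) (a : Fin d) :
    p.datum z a = p.mu a + ∑ s, (√(p.lam s) * z s) * p.h s a := by
  simp [datum]

/-- `Sigma` is indeed the covariance matrix of an observation, and `mu` its mean. -/
theorem mean_cov_datum :
    (∀ a, ∫ w, p.datum w a ∂p.zlaw = p.mu a) ∧
    ∀ a b, ∫ w, (p.datum w a - p.mu a) * (p.datum w b - p.mu b) ∂p.zlaw = p.Sigma a b := by
  have := p.isProbabilityMeasure
  have hI : ∀ s, Integrable (fun w : Vec d => w s) p.zlaw :=
    fun s => (p.memLp_two s).integrable (by norm_num)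
  have hI2 : ∀ s t, Integrable (fun w : Vec d => w s * w t) p.zlaw :=
    fun s t => (p.memLp_two s).integrable_mul (p.memLp_two t)
  refine ⟨fun a => ?_, fun a b => ?_⟩
  · have hs : ∀ s, Integrable (fun w : Vec d => √(p.lam s) * w s * p.h s a) p.zlaw :=
      fun s => ((hI s).const_mul _).mul_const _
    simp_rw [datum_apply]
    rw [integral_add (integrable_const _) (integrable_finsetSum _ fun s _ => hs s),
      integral_finsetSum _ fun s _ => hs s]
    simp [integral_mul_const, integral_const_mul, p.mean_zero]
  · have key : ∀ w : Vec d, (p.datum w a - p.mu a) * (p.datum w b - p.mu b) =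
        ∑ s, ∑ t, (√(p.lam s) * √(p.lam t) * p.h s a * p.h t b) * (w s * w t) := by
      intro w
      rw [datum_apply, datum_apply, add_sub_cancel_left, add_sub_cancel_left,
        Finset.sum_mul_sum]
      exact Finset.sum_congr rfl fun s _ => Finset.sum_congr rfl fun t _ => by ring
    simp_rw [key]
    rw [integral_finsetSum _ fun s _ => integrable_finsetSum _ fun t _ => (hI2 s t).const_mul _]
    simp_rw [integral_finsetSum _ fun t _ => (hI2 _ t).const_mul _, integral_const_mul,
      p.cov_eq_one]
    simp only [mul_ite, mul_one, mul_zero, Finset.sum_ite_eq, Finset.mem_univ, if_true,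
      Sigma, Matrix.sum_apply, Matrix.smul_apply, Matrix.vecMulVec_apply, smul_eq_mul]
    exact Finset.sum_congr rfl fun s _ => by
      rw [Real.mul_self_sqrt (p.lam_nonneg s)]; ring

end Population

/-- Moment condition: finite fourth moments; `E(z_{j₁}² z_{j₂}²) = 1`, `E(z_{j₁} z_{j₂} z_{j₃}) = 0`
and `E(z_{j₁} z_{j₂} z_{j₃} z_{j₄}) = 0` whenever `j₁` differs from each of the other indices
(which may coincide with one another); and `M_j` is bounded, uniformly in `j ≤ d`, as `d → ∞`. -/
structure MomentCondition (pop : ∀ d, Population d) : Prop where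
  memLp_four : ∀ d j, MemLp (fun w : Vec d => w j) 4 (pop d).zlaw
  moment_two_two : ∀ d (j₁ j₂ : Fin d), j₁ ≠ j₂ →
    ∫ w, w j₁ ^ 2 * w j₂ ^ 2 ∂(pop d).zlaw = 1
  moment_three : ∀ d (j₁ j₂ j₃ : Fin d), j₁ ≠ j₂ → j₁ ≠ j₃ →
    ∫ w, w j₁ * w j₂ * w j₃ ∂(pop d).zlaw = 0
  moment_four : ∀ d (j₁ j₂ j₃ j₄ : Fin d), j₁ ≠ j₂ → j₁ ≠ j₃ → j₁ ≠ j₄ →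
    ∫ w, w j₁ * w j₂ * w j₃ * w j₄ ∂(pop d).zlaw = 0
  bounded_M : ∃ C : ℝ, ∀ᶠ d in atTop, ∀ j, (pop d).M j ≤ C

/-- Strongly spiked eigenvalue condition, with zero-based indices. `liminf a_d > 0` is written as `∃ c > 0` with
`c ≤ a_d` for all large `d`. -/
structure SpikeCondition (m : ℕ) (pop : ∀ d, Population d) : Prop where
  distinct : ∀ j j' : ℕ, j < j' → j' < m →
    ∃ c > 0, ∀ᶠ d in atTop, c ≤ (pop d).eig j / (pop d).eig j' - 1
  spike : ∃ c > 0, ∀ᶠ d in atTop,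
    c ≤ (pop d).eig (m - 1) ^ 2 / Matrix.trace ((pop d).Sigma2 m ^ 2)
  noise : Tendsto (fun d => (pop d).eig m ^ 2 / Matrix.trace ((pop d).Sigma2 m ^ 2)) atTop (𝓝 0)

/-- The sample mean of `n` observations. -/
def sampleMean {d n : ℕ} (x : Fin n → Vec d) : Vec d := (n : ℝ)⁻¹ • ∑ i, x i

/-- The sample covariance matrix `S = (n - 1)⁻¹ ∑ (x_i - x̄)(x_i - x̄)ᵀ`. -/
def sampleCov {d n : ℕ} (x : Fin n → Vec d) : Matrix (Fin d) (Fin d) ℝ :=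
  ((n : ℝ) - 1)⁻¹ •
    ∑ i, Matrix.vecMulVec (x i - sampleMean x).ofLp (x i - sampleMean x).ofLp

/-- `l` lists the eigenvalues of `A` in decreasing order, with orthonormal eigenvectors `v`. -/
def IsEigenDecomp {d : ℕ} (A : Matrix (Fin d) (Fin d) ℝ) (l : Fin d → ℝ)
    (v : OrthonormalBasis (Fin d) ℝ (Vec d)) : Prop :=
  Antitone l ∧ ∀ j, A.mulVec (v j).ofLp = l j • (v j).ofLp

/-- The sample scaled PC direction `β̂_j = λ̂_j^{1/2} ĥ_j`, with zero-based index `j`. -/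
def betaHat {d : ℕ} (l : Fin d → ℝ) (v : OrthonormalBasis (Fin d) ℝ (Vec d)) (j : ℕ) : Vec d :=
  √(entry l j) • entry v j

/-- `Y = O_P(r)` along the filter `F`; each `Y i` lives on its own probability space. For a set
that is not measurable `P i` is the outer measure, so `Y i` need not be measurable. -/
def IsBigOP {ι : Type*} {Ω : ι → Type*} [∀ i, MeasurableSpace (Ω i)] (P : ∀ i, Measure (Ω i))
    (F : Filter ι) (Y : ∀ i, Ω i → ℝ) (r : ι → ℝ) : Prop :=
  ∀ ε : ℝ, 0 < ε → ∃ K : ℝ, ∀ᶠ i in F, P i {ω | K * |r i| < |Y i ω|} ≤ ENNReal.ofReal ε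

/-- `Y = o_P(1)` along the filter `F`. -/
def IsLittleOPOne {ι : Type*} {Ω : ι → Type*} [∀ i, MeasurableSpace (Ω i)]
    (P : ∀ i, Measure (Ω i)) (F : Filter ι) (Y : ∀ i, Ω i → ℝ) : Prop :=
  ∀ ε : ℝ, 0 < ε → Tendsto (fun i => P i {ω | ε < |Y i ω|}) F (𝓝 0)

end HDPCA

end

/-! The proof passes to the dual side. The sample covariance is `B*B`, where `B = dataMap x` maps
into `Vec n` and sends `h_s` to `√λ_s v_s`; here `v_s = dualVec ζ s` is the centred and normalized
`s`-th row of the sphered data. Hence `BB* = ∑ λ_s v_s v_sᵀ`. Its range lies in the space `U =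
meanZero n`. The noise terms make up `δ + R` with `R = noiseDev`, so that `BB*` is `δ` plus a spiked
operator of rank at most `m` plus a perturbation.

Put `u = B ĥ_j / √λ̂_j` and `b_s = ⟪v_s, u⟫`. Then `⟪β̂_j, β_j⟫ = λ_j b_j` and `λ̂_j = ∑_{s<m} λ_s
b_s² + δ + ⟪u, R u⟫`, which gives the exact identity `‖β̂_j - β_j‖²/λ_j - δ/λ_j = (1 - b_j)² +
∑_{s≠j, s<m} (λ_s/λ_j) b_s² + ⟪u, R u⟫/λ_j`. The right side is of second order: if the Gram matrix
of the leading `v_s` is the identity up to `ε`, `‖R v_s‖ ≤ ε λ_j`, `|⟪v_j, R v_j⟫| ≤ ε² λ_j`, and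
`R` is at most a small constant times `λ_j` on `U`, then it is `O(ε²)`. This is `spiked_pca_bound`;
it rests on a min-max localization of `λ̂_j` (`spiked_eig_bound`) and on a perturbation argument for
`u` (`spiked_eigvec_bound`).

It remains to take `ε` of order `n^(-1/2)` with high probability. Let `τ² = tr(Σ₂²)`, which is
`O(λ_j²)` by the spike condition. On `U`, `(n - 1) R` has the quadratic form of an off-diagonal
kernel matrix `A` plus a diagonal of centred terms. Second moments control the diagonal, `A z_s`, `A
1` and `z_sᵀ A z_s` (all collected in `spikeStat`) and give the rate in the spiked directions. On
all of `U` only smallness without a rate is needed, and it comes from `E ‖A²‖_F² ≤ n⁴ ∑ λ_r⁴ + O(n³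
τ⁴)` with sums over noise indices: divided by `(nτ)⁴`, this tends to zero because `λ_{m+1}²/τ²`
does. Markov's inequality for these two statistics finishes the `O_P` bound, and the consistency
criterion follows since `O_P(1/n)` is `o_P(1)`. -/

noncomputable section

namespace HDPCA

/-! ### Eigenvectors of a spiked operator under perturbation. -/

section Perturbation

variable {E ι : Type*} [NormedAddCommGroup E] [InnerProductSpace ℝ E] [DecidableEq ι]

/-- The constant in the bound of an approximate eigenvector by its leading direction. -/
def eigvecConst (k : ℕ) (g : ℝ) : ℝ := 24 * k / g + 28

/-- The constant in the perturbation bound for a spiked eigenproblem. -/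
def spikeConst (k : ℕ) (g : ℝ) : ℝ :=
  (eigvecConst k g + 2) ^ 2 + k * (6 / g) ^ 2 +
    (4 + 4 * eigvecConst k g + eigvecConst k g ^ 2)

/-- Coefficients of an eigenvector of `∑ λ_s v_s v_sᵀ + R` along nearly orthonormal `v_s`. -/
theorem spiked_coeff_bound (I : Finset ι) (j : ι) (hj : j ∈ I) (lam : ι → ℝ) (v : ι → E)
    (hlam : ∀ s ∈ I, 0 < lam s) (R : E →ₗ[ℝ] E)
    (hsymm : ∀ x y, inner ℝ (R x) y = inner ℝ x (R y)) (u : E) (hu : ‖u‖ = 1)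
    {κ g ε : ℝ} (hg : 0 < g) (hε : 0 ≤ ε) (hε1 : ε ≤ 1) (hεg : I.card / g * ε ≤ 1 / 2)
    (heig : κ • u - R u = ∑ s ∈ I, (lam s * inner ℝ (v s) u) • v s)
    (hgram : ∀ s ∈ I, ∀ t ∈ I, |inner ℝ (v s) (v t) - (if s = t then 1 else 0)| ≤ ε)
    (hgap : ∀ t ∈ I, t ≠ j → g * max (lam j) (lam t) ≤ |κ - lam t|)
    (hRv : ∀ s ∈ I, ‖R (v s)‖ ≤ ε * lam j) :
    (∀ t ∈ I, t ≠ j → max (lam j) (lam t) * |inner ℝ (v t) u| ≤ 6 / g * ε * lam j) ∧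
      |inner ℝ (v j) u| * |κ - lam j| ≤ 6 * ε * lam j ∧ |inner ℝ (v j) u| ≤ 2 := by
  set b : ι → ℝ := fun s => inner ℝ (v s) u with hb
  have hlj := hlam j hj
  set S : ℝ := ∑ s ∈ I, lam s * |b s| with hS
  -- Pairing the eigenvector equation with `v t` gives `b t * (κ - lam t)` as `⟪R (v t), u⟫` plus
  -- Gram errors weighted by `lam s * b s`. The weighted sum `S` is kept because the ratios of the
  -- `lam s` may be unbounded.
  have key : ∀ t ∈ I, |b t| * |κ - lam t| ≤ ε * (lam j + S) := by
    intro t ht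
    have h1 : κ * b t - inner ℝ (R (v t)) u = ∑ s ∈ I, lam s * b s * inner ℝ (v t) (v s) := by
      have := congrArg (fun x => inner ℝ (v t) x) heig
      simp only [inner_sub_right, inner_smul_right, inner_sum] at this
      rw [hsymm]; exact this
    have h2 : b t * (κ - lam t) = inner ℝ (R (v t)) u +
        ∑ s ∈ I, lam s * b s * (inner ℝ (v t) (v s) - (if t = s then 1 else 0)) := by
      simp only [mul_sub, Finset.sum_sub_distrib, ← h1, mul_ite, mul_one, mul_zero,
        Finset.sum_ite_eq, ht, if_true]
      ring
    rw [← abs_mul, h2, mul_add]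
    refine (abs_add_le _ _).trans (add_le_add ?_ ?_)
    · calc _ ≤ ‖R (v t)‖ * ‖u‖ := abs_real_inner_le_norm _ _
        _ ≤ _ := by rw [hu, mul_one]; exact hRv t ht
    · refine (Finset.abs_sum_le_sum_abs _ _).trans ?_
      rw [hS, Finset.mul_sum]
      refine Finset.sum_le_sum fun s hs => ?_
      rw [abs_mul, abs_mul, abs_of_pos (hlam s hs), mul_comm]
      exact mul_le_mul_of_nonneg_right (hgram t ht s hs)
        (mul_nonneg (hlam s hs).le (abs_nonneg _))
  have hbj : |b j| ≤ 2 := by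
    have h1 : |b j| ≤ ‖v j‖ := by
      simpa [hu] using abs_real_inner_le_norm (v j) u
    have h2 := hgram j hj j hj
    rw [if_pos rfl, real_inner_self_eq_norm_sq] at h2
    nlinarith [(abs_le.1 h2).2, norm_nonneg (v j)]
  have hoff : ∀ t ∈ I, t ≠ j →
      max (lam j) (lam t) * |b t| ≤ ε / g * (lam j + S) := by
    intro t ht htj
    have h1 := key t ht
    have h2 := mul_le_mul_of_nonneg_left (hgap t ht htj) (abs_nonneg (b t))
    rw [div_mul_eq_mul_div, le_div_iff₀ hg]
    nlinarith
  have hS0 : 0 ≤ S := Finset.sum_nonneg fun s hs => mul_nonneg (hlam s hs).le (abs_nonneg _)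
  -- The inequality closes on itself: the `j` term is at most `2 * lam j` and the others add up to
  -- at most `(lam j + S) / 2`.
  have hS5 : S ≤ 5 * lam j := by
    have h1 : S = lam j * |b j| + ∑ s ∈ I.erase j, lam s * |b s| :=
      (Finset.add_sum_erase I (fun s => lam s * |b s|) hj).symm
    have h2 : ∑ s ∈ I.erase j, lam s * |b s| ≤ I.card * (ε / g * (lam j + S)) := by
      calc _ ≤ ∑ s ∈ I.erase j, ε / g * (lam j + S) := by
            refine Finset.sum_le_sum fun s hs => ?_
            obtain ⟨hsj, hs⟩ := Finset.mem_erase.1 hs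
            exact (mul_le_mul_of_nonneg_right (le_max_right _ _) (abs_nonneg _)).trans
              (hoff s hs hsj)
        _ ≤ _ := by
            rw [Finset.sum_const, nsmul_eq_mul]
            refine mul_le_mul_of_nonneg_right ?_ (by positivity)
            exact_mod_cast Finset.card_erase_le
    have h3 : (I.card : ℝ) * (ε / g * (lam j + S)) ≤ 1 / 2 * (lam j + S) := by
      have : (I.card : ℝ) * (ε / g * (lam j + S)) = I.card / g * ε * (lam j + S) := by ring
      rw [this]
      exact mul_le_mul_of_nonneg_right hεg (by positivity)
    nlinarith
  refine ⟨fun t ht htj => (hoff t ht htj).trans ?_, (key j hj).trans ?_, hbj⟩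
  · have : 6 / g * ε * lam j = ε / g * (6 * lam j) := by ring
    rw [this]
    exact mul_le_mul_of_nonneg_left (by linarith) (by positivity)
  · nlinarith

/-- The residual `w = u - b_j v_j` satisfies `(κ - R) w = O(ε λ_j)`, and `κ - R` is bounded below by
`λ_j / 2` on `U`, so `w = O(ε)`. Every term of the conclusion is quadratic in quantities of size
`ε`, apart from `⟪v_j, R v_j⟫`, whose bound is therefore assumed at order `ε²`. -/
theorem spiked_eigvec_bound (I : Finset ι) (j : ι) (hj : j ∈ I) (lam : ι → ℝ) (v : ι → E)
    (hlam : ∀ s ∈ I, 0 < lam s) (R : E →ₗ[ℝ] E)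
    (hsymm : ∀ x y, inner ℝ (R x) y = inner ℝ x (R y)) (u : E) (hu : ‖u‖ = 1)
    (U : Submodule ℝ E) (huU : u ∈ U) (hvU : v j ∈ U)
    {κ g ε : ℝ} (hg : 0 < g) (hε : 0 ≤ ε) (hε1 : ε ≤ 1) (hεg : I.card / g * ε ≤ 1 / 2)
    (heig : κ • u - R u = ∑ s ∈ I, (lam s * inner ℝ (v s) u) • v s)
    (hgram : ∀ s ∈ I, ∀ t ∈ I, |inner ℝ (v s) (v t) - (if s = t then 1 else 0)| ≤ ε)
    (hgap : ∀ t ∈ I, t ≠ j → g * max (lam j) (lam t) ≤ |κ - lam t|)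
    (hκ : 3 / 4 * lam j ≤ κ)
    (hRv : ∀ s ∈ I, ‖R (v s)‖ ≤ ε * lam j)
    (hRU : ∀ w ∈ U, ‖R w‖ ≤ 1 / 4 * lam j * ‖w‖)
    (hvRv : |inner ℝ (v j) (R (v j))| ≤ ε ^ 2 * lam j)
    (hpos : 0 ≤ inner ℝ (v j) u) :
    (1 - inner ℝ (v j) u) ^ 2 + ∑ s ∈ I.erase j, lam s / lam j * inner ℝ (v s) u ^ 2 +
      |inner ℝ u (R u)| / lam j ≤ spikeConst I.card g * ε ^ 2 := by
  obtain ⟨hoff, hdiag, hbj⟩ := spiked_coeff_bound I j hj lam v hlam R hsymm u hu hg hε hε1 hεg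
    heig hgram hgap hRv
  set b : ι → ℝ := fun s => inner ℝ (v s) u with hb
  have hlj := hlam j hj
  set K := eigvecConst I.card g with hK
  have hK0 : 0 ≤ K := by rw [hK, eigvecConst]; positivity
  have hv2 : ∀ s ∈ I, ‖v s‖ ≤ 2 ∧ |‖v s‖ - 1| ≤ ε := by
    intro s hs
    have h2 := hgram s hs s hs
    rw [if_pos rfl, real_inner_self_eq_norm_sq] at h2
    have h3 : ‖v s‖ ^ 2 - 1 = (‖v s‖ - 1) * (‖v s‖ + 1) := by ring
    have h4 : |‖v s‖ - 1| ≤ |‖v s‖ ^ 2 - 1| := by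
      rw [h3, abs_mul, abs_of_pos (by positivity : 0 < ‖v s‖ + 1)]
      nlinarith [abs_nonneg (‖v s‖ - 1), norm_nonneg (v s)]
    have h5 := h4.trans h2
    exact ⟨by linarith [(abs_le.1 h5).2], h5⟩
  set w := u - b j • v j with hw
  have hwU : w ∈ U := U.sub_mem huU (U.smul_mem _ hvU)
  have hwnorm : ‖w‖ ≤ K * ε := by
    have h1 : κ • w - R w = ∑ s ∈ I.erase j, (lam s * b s) • v s +
        ((lam j - κ) * b j) • v j + b j • R (v j) := by
      have h2 : ∑ s ∈ I, (lam s * b s) • v s = (lam j * b j) • v j +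
          ∑ s ∈ I.erase j, (lam s * b s) • v s :=
        (Finset.add_sum_erase I (fun s => (lam s * b s) • v s) hj).symm
      rw [h2] at heig
      have h3 : ∑ s ∈ I.erase j, (lam s * b s) • v s = κ • u - R u - (lam j * b j) • v j := by
        rw [heig]; abel
      rw [h3, hw, map_sub, map_smul]
      module
    have h2 : ‖κ • w - R w‖ ≤ I.card * (6 / g * ε * lam j * 2) + 6 * ε * lam j * 2
        + 2 * (ε * lam j) := by
      rw [h1]
      refine (norm_add_le _ _).trans (add_le_add ((norm_add_le _ _).trans (add_le_add ?_ ?_)) ?_)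
      · refine (norm_sum_le _ _).trans ?_
        calc _ ≤ ∑ s ∈ I.erase j, 6 / g * ε * lam j * 2 := by
              refine Finset.sum_le_sum fun s hs => ?_
              obtain ⟨hsj, hs⟩ := Finset.mem_erase.1 hs
              rw [norm_smul, Real.norm_eq_abs, abs_mul, abs_of_pos (hlam s hs)]
              refine mul_le_mul ?_ (hv2 s hs).1 (norm_nonneg _) (by positivity)
              exact (mul_le_mul_of_nonneg_right (le_max_right _ _) (abs_nonneg _)).trans
                (hoff s hs hsj)
          _ ≤ _ := by
              rw [Finset.sum_const, nsmul_eq_mul]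
              refine mul_le_mul_of_nonneg_right ?_ (by positivity)
              exact_mod_cast Finset.card_erase_le
      · rw [norm_smul, Real.norm_eq_abs, abs_mul, abs_sub_comm, mul_comm |κ - lam j|]
        exact mul_le_mul hdiag (hv2 j hj).1 (norm_nonneg _) (by positivity)
      · rw [norm_smul, Real.norm_eq_abs]
        exact mul_le_mul hbj (hRv j hj) (norm_nonneg _) (by norm_num)
    have h3 : 1 / 2 * lam j * ‖w‖ ≤ ‖κ • w - R w‖ := by
      have h4 := norm_sub_norm_le (κ • w) (R w)
      rw [norm_smul, Real.norm_eq_abs, abs_of_pos (by linarith)] at h4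
      nlinarith [hRU w hwU, norm_nonneg w]
    have h4 : lam j * ‖w‖ ≤ lam j * (K * ε) := by
      have : lam j * (K * ε) = 2 * (I.card * (6 / g * ε * lam j * 2) + 6 * ε * lam j * 2
        + 2 * (ε * lam j)) := by rw [hK, eigvecConst]; ring
      rw [this]; linarith
    exact le_of_mul_le_mul_left h4 hlj
  have hbj0 : |b j| = b j := abs_of_nonneg hpos
  -- Since `u` is a unit vector and `‖v j‖ = 1 + O(ε)`, the size of `w` fixes `|b j|` up to `O(ε)`;
  -- the sign assumption rules out `b j` near `-1`.
  have hone : |1 - b j| ≤ (K + 2) * ε := by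
    have h1 : |1 - b j * ‖v j‖| ≤ ‖w‖ := by
      have := abs_norm_sub_norm_le u (b j • v j)
      rwa [hu, norm_smul, Real.norm_eq_abs, hbj0] at this
    have h2 : |b j * (‖v j‖ - 1)| ≤ 2 * ε := by
      rw [abs_mul]
      exact mul_le_mul hbj (hv2 j hj).2 (abs_nonneg _) (by norm_num)
    calc |1 - b j| = |(1 - b j * ‖v j‖) + b j * (‖v j‖ - 1)| := by ring_nf
      _ ≤ _ := (abs_add_le _ _).trans (by linarith)
  have t1 : (1 - b j) ^ 2 ≤ (K + 2) ^ 2 * ε ^ 2 := by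
    rw [← mul_pow, ← sq_abs (1 - b j)]
    exact pow_le_pow_left₀ (abs_nonneg _) hone 2
  have t2 : ∑ s ∈ I.erase j, lam s / lam j * b s ^ 2 ≤ I.card * (6 / g) ^ 2 * ε ^ 2 := by
    calc _ ≤ ∑ s ∈ I.erase j, (6 / g) ^ 2 * ε ^ 2 := by
          refine Finset.sum_le_sum fun s hs => ?_
          obtain ⟨hsj, hs⟩ := Finset.mem_erase.1 hs
          have h1 := hoff s hs hsj
          have h2 : (max (lam j) (lam s) * |b s|) ^ 2 ≤ (6 / g * ε * lam j) ^ 2 :=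
            pow_le_pow_left₀ (by positivity) h1 2
          rw [mul_pow, sq_abs, mul_pow, mul_pow] at h2
          -- The maximum in the off-diagonal bound absorbs the ratio `lam s / lam j`, which may be
          -- large.
          have h3 : lam s * lam j ≤ max (lam j) (lam s) ^ 2 := by
            rw [sq]
            exact mul_le_mul (le_max_right _ _) (le_max_left _ _) hlj.le (by positivity)
          have h4 : lam s * lam j * b s ^ 2 ≤ (6 / g) ^ 2 * ε ^ 2 * lam j ^ 2 :=
            (mul_le_mul_of_nonneg_right h3 (sq_nonneg _)).trans h2
          rw [div_mul_eq_mul_div, div_le_iff₀ hlj]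
          refine le_of_mul_le_mul_right ?_ hlj
          linarith
      _ ≤ _ := by
          rw [Finset.sum_const, nsmul_eq_mul, ← mul_assoc]
          refine mul_le_mul_of_nonneg_right (mul_le_mul_of_nonneg_right ?_ (by positivity))
            (by positivity)
          exact_mod_cast Finset.card_erase_le
  have t3 : |inner ℝ u (R u)| / lam j ≤ (4 + 4 * K + K ^ 2) * ε ^ 2 := by
    have hu' : u = b j • v j + w := by rw [hw]; abel
    -- Expansion along `u = b j • v j + w`: the mixed term is `O(ε) * O(ε λ_j)`, and the last one
    -- uses `‖w‖² = O(ε²)` with the crude bound of `R` on `U`.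
    have h1 : inner ℝ u (R u) = b j ^ 2 * inner ℝ (v j) (R (v j)) +
        2 * b j * inner ℝ w (R (v j)) + inner ℝ w (R w) := by
      have h2 : inner ℝ (v j) (R w) = inner ℝ w (R (v j)) := by
        rw [← hsymm, real_inner_comm]
      conv_lhs => rw [hu']
      simp only [map_add, map_smul, inner_add_left, inner_add_right, inner_smul_left,
        inner_smul_right, h2, conj_trivial]
      ring
    have hw0 := norm_nonneg w
    have h3 : |b j ^ 2 * inner ℝ (v j) (R (v j))| ≤ 2 ^ 2 * (ε ^ 2 * lam j) := by
      rw [abs_mul, abs_pow]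
      exact mul_le_mul (pow_le_pow_left₀ (abs_nonneg _) hbj 2) hvRv (abs_nonneg _) (by norm_num)
    have h4 : |2 * b j * inner ℝ w (R (v j))| ≤ (2 * 2) * ((K * ε) * (ε * lam j)) := by
      rw [abs_mul, abs_mul, abs_two]
      refine mul_le_mul (by linarith) ((abs_real_inner_le_norm _ _).trans ?_) (abs_nonneg _)
        (by norm_num)
      exact mul_le_mul hwnorm (hRv j hj) (norm_nonneg _) (by positivity)
    have h5 : |inner ℝ w (R w)| ≤ (K * ε) * (lam j * (K * ε)) := by
      refine (abs_real_inner_le_norm _ _).trans ?_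
      refine mul_le_mul hwnorm ((hRU w hwU).trans ?_) (norm_nonneg _) (by positivity)
      nlinarith
    rw [div_le_iff₀ hlj, h1]
    refine (abs_add_le _ _).trans ((add_le_add (abs_add_le _ _) le_rfl).trans ?_)
    nlinarith
  rw [spikeConst]
  nlinarith

end Perturbation

/-! ### Nearly orthonormal families. -/

section GramBounds

variable {E ι : Type*} [NormedAddCommGroup E] [InnerProductSpace ℝ E] [DecidableEq ι]

theorem abs_norm_sq_sum_smul_sub_le (I : Finset ι) (v : ι → E) {ε : ℝ}
    (hgram : ∀ s ∈ I, ∀ t ∈ I, |inner ℝ (v s) (v t) - (if s = t then 1 else 0)| ≤ ε)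
    (a : ι → ℝ) :
    |‖∑ s ∈ I, a s • v s‖ ^ 2 - ∑ s ∈ I, a s ^ 2| ≤ I.card * ε * ∑ s ∈ I, a s ^ 2 := by
  have h1 : ‖∑ s ∈ I, a s • v s‖ ^ 2 - ∑ s ∈ I, a s ^ 2 =
      ∑ s ∈ I, ∑ t ∈ I, a s * a t * (inner ℝ (v s) (v t) - (if s = t then 1 else 0)) := by
    rw [← real_inner_self_eq_norm_sq, sum_inner, ← Finset.sum_sub_distrib]
    refine Finset.sum_congr rfl fun s hs => ?_
    simp only [inner_sum, inner_smul_left, inner_smul_right, conj_trivial, mul_sub,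
      Finset.sum_sub_distrib, mul_ite, mul_one, mul_zero, Finset.sum_ite_eq, hs, if_true]
    congr 1
    · exact Finset.sum_congr rfl fun t _ => by ring
    · ring
  rw [h1]
  have h2 : ∀ s ∈ I, ∀ t ∈ I,
      |a s * a t * (inner ℝ (v s) (v t) - (if s = t then 1 else 0))| ≤
        ε / 2 * (a s ^ 2 + a t ^ 2) := by
    intro s hs t ht
    have h3 := hgram s hs t ht
    have h4 : |a s * a t| ≤ (a s ^ 2 + a t ^ 2) / 2 := by
      rw [abs_le]; constructor <;> nlinarith [sq_nonneg (a s - a t), sq_nonneg (a s + a t)]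
    rw [abs_mul]
    calc _ ≤ (a s ^ 2 + a t ^ 2) / 2 * ε := mul_le_mul h4 h3 (abs_nonneg _) (by positivity)
      _ = _ := by ring
  calc _ ≤ ∑ s ∈ I, ∑ t ∈ I, ε / 2 * (a s ^ 2 + a t ^ 2) :=
        (Finset.abs_sum_le_sum_abs _ _).trans (Finset.sum_le_sum fun s hs =>
          (Finset.abs_sum_le_sum_abs _ _).trans (Finset.sum_le_sum fun t ht => h2 s hs t ht))
    _ = _ := by
        simp only [← Finset.mul_sum, Finset.sum_add_distrib, Finset.sum_const, nsmul_eq_mul]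
        ring

/-- Bessel's inequality up to `ε`, by duality: with `y = ∑ ⟪v_s, w⟫ v_s` the sum equals `⟪y, w⟫`,
and `‖y‖²` is at most `1 + |I| ε` times the same sum. -/
theorem sum_sq_inner_le (I : Finset ι) (v : ι → E) {ε : ℝ} (hε : 0 ≤ ε)
    (hgram : ∀ s ∈ I, ∀ t ∈ I, |inner ℝ (v s) (v t) - (if s = t then 1 else 0)| ≤ ε)
    (w : E) : ∑ s ∈ I, inner ℝ (v s) w ^ 2 ≤ (1 + I.card * ε) * ‖w‖ ^ 2 := by
  set S := ∑ s ∈ I, inner ℝ (v s) w ^ 2 with hS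
  have h1 := (abs_le.1 (abs_norm_sq_sum_smul_sub_le I v hgram fun s => inner ℝ (v s) w)).2
  set y := ∑ s ∈ I, (inner ℝ (v s) w : ℝ) • v s with hy
  have h2 : S ≤ ‖y‖ * ‖w‖ := by
    have : S = inner ℝ y w := by
      rw [hS, hy, sum_inner]
      exact Finset.sum_congr rfl fun s _ => by rw [inner_smul_left, conj_trivial]; ring
    rw [this]; exact real_inner_le_norm _ _
  have hS0 : 0 ≤ S := Finset.sum_nonneg fun s _ => sq_nonneg _
  have h3 : S ^ 2 ≤ (1 + I.card * ε) * ‖w‖ ^ 2 * S := by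
    calc S ^ 2 ≤ (‖y‖ * ‖w‖) ^ 2 := pow_le_pow_left₀ hS0 h2 2
      _ = ‖y‖ ^ 2 * ‖w‖ ^ 2 := mul_pow _ _ _
      _ ≤ ((1 + I.card * ε) * S) * ‖w‖ ^ 2 :=
          mul_le_mul_of_nonneg_right (by linarith) (sq_nonneg _)
      _ = _ := by ring
  rcases hS0.eq_or_lt with h | h
  · rw [← h]; positivity
  · rw [sq] at h3; exact le_of_mul_le_mul_right h3 h

/-- The reverse inequality holds only on the span; it comes from Cauchy–Schwarz for `‖w‖² = ∑ a_s
⟪v_s, w⟫`. -/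
theorem le_sum_sq_inner (I : Finset ι) (v : ι → E) {ε : ℝ}
    (hgram : ∀ s ∈ I, ∀ t ∈ I, |inner ℝ (v s) (v t) - (if s = t then 1 else 0)| ≤ ε)
    (hε : I.card * ε ≤ 1) (a : ι → ℝ) :
    (1 - I.card * ε) * ‖∑ s ∈ I, a s • v s‖ ^ 2 ≤
      ∑ s ∈ I, inner ℝ (v s) (∑ t ∈ I, a t • v t) ^ 2 := by
  have h1 := (abs_le.1 (abs_norm_sq_sum_smul_sub_le I v hgram a)).1
  set w := ∑ s ∈ I, a s • v s with hw
  set S := ∑ s ∈ I, inner ℝ (v s) w ^ 2 with hS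
  have hS0 : 0 ≤ S := Finset.sum_nonneg fun s _ => sq_nonneg _
  have h2 : ‖w‖ ^ 2 = ∑ s ∈ I, a s * inner ℝ (v s) w := by
    rw [← real_inner_self_eq_norm_sq]
    nth_rw 1 [hw]
    rw [sum_inner]
    exact Finset.sum_congr rfl fun s _ => by rw [inner_smul_left, conj_trivial]
  have h3 : (‖w‖ ^ 2) ^ 2 ≤ (∑ s ∈ I, a s ^ 2) * S := by
    rw [h2]; exact Finset.sum_mul_sq_le_sq_mul_sq _ _ _
  have h4 : (1 - I.card * ε) * (‖w‖ ^ 2) ^ 2 ≤ ‖w‖ ^ 2 * S := by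
    calc _ ≤ (1 - I.card * ε) * ((∑ s ∈ I, a s ^ 2) * S) :=
          mul_le_mul_of_nonneg_left h3 (by linarith)
      _ = ((1 - I.card * ε) * ∑ s ∈ I, a s ^ 2) * S := by ring
      _ ≤ _ := mul_le_mul_of_nonneg_right (by linarith) hS0
  rcases (sq_nonneg ‖w‖).eq_or_lt with h | h
  · rw [← h, mul_zero]; exact hS0
  · rw [sq (‖w‖ ^ 2)] at h4
    refine le_of_mul_le_mul_left ?_ h
    linarith

end GramBounds

/-! ### Min-max bounds on the dual side. -/

section MinMax

variable {V E : Type*} [NormedAddCommGroup V] [InnerProductSpace ℝ V] [FiniteDimensional ℝ V]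
  [NormedAddCommGroup E] [InnerProductSpace ℝ E] [FiniteDimensional ℝ E]

theorem exists_ne_zero_of_homogeneous {k l : ℕ} (hkl : l < k)
    (f : (Fin k → ℝ) →ₗ[ℝ] (Fin l → ℝ)) : ∃ a, a ≠ 0 ∧ f a = 0 := by
  have h := LinearMap.ker_ne_bot_of_finrank_lt (f := f) (by simpa using hkl)
  obtain ⟨a, ha, ha0⟩ := Submodule.exists_mem_ne_zero_of_ne_bot h
  exact ⟨a, ha0, ha⟩

variable {d : ℕ} (B : V →ₗ[ℝ] E) (e : OrthonormalBasis (Fin d) ℝ V) (l : Fin d → ℝ)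

theorem norm_sq_adjoint_apply (w : E) :
    ‖LinearMap.adjoint B w‖ ^ 2 = ∑ k, inner ℝ (B (e k)) w ^ 2 := by
  rw [← e.sum_sq_inner_right]
  exact Finset.sum_congr rfl fun k _ => by rw [LinearMap.adjoint_inner_right]

/-- Upper half of the min-max principle for the squared singular values of `B`. -/
theorem eig_le_of_forall_orthogonal (hl : Antitone l)
    (he : ∀ k k', inner ℝ (B (e k)) (B (e k')) = if k = k' then l k else 0)
    (j : Fin d) (hj : 0 < l j) (f : Fin j.val → E) (α : ℝ)
    (hα : ∀ w ∈ LinearMap.range B, (∀ s, inner ℝ (f s) w = 0) →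
      ‖LinearMap.adjoint B w‖ ^ 2 ≤ α * ‖w‖ ^ 2) : l j ≤ α := by
  let c : Fin (j.val + 1) → Fin d := Fin.castLE j.isLt
  have hc : Function.Injective c := Fin.castLE_injective _
  let y : (Fin (j.val + 1) → ℝ) →ₗ[ℝ] V := ∑ k, (LinearMap.proj k).smulRight (e (c k))
  have hy : ∀ a, y a = ∑ k, a k • e (c k) := fun a => by simp [y]
  -- The top `j + 1` eigenvectors against `j` linear constraints leave a nonzero combination.
  obtain ⟨a, ha, ha0⟩ := exists_ne_zero_of_homogeneous (Nat.lt_succ_self j.val)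
    (LinearMap.pi fun s => (innerₗ E (f s)).comp (B.comp y))
  have hcl : ∀ k, l j ≤ l (c k) := fun k => hl (by
    rw [Fin.le_def]; exact Nat.le_of_lt_succ k.isLt)
  set w := B (y a) with hw
  have hwe : ∀ k, inner ℝ (B (e (c k))) w = l (c k) * a k := by
    intro k
    rw [hw, hy, map_sum, inner_sum]
    simp [he, hc.eq_iff, mul_comm, inner_smul_right]
  have hnw : ‖w‖ ^ 2 = ∑ k, l (c k) * a k ^ 2 := by
    rw [← real_inner_self_eq_norm_sq]
    nth_rw 1 [hw]
    rw [hy, map_sum, sum_inner]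
    refine Finset.sum_congr rfl fun k _ => ?_
    rw [map_smul, inner_smul_left, hwe, conj_trivial]; ring
  have hapos : 0 < ∑ k, a k ^ 2 := by
    obtain ⟨k, hk⟩ := Function.ne_iff.1 ha
    exact Finset.sum_pos' (fun _ _ => sq_nonneg _) ⟨k, Finset.mem_univ _, sq_pos_of_ne_zero hk⟩
  -- Here `0 < l j` is needed: without it `B` could kill the chosen combination.
  have hwpos : 0 < ‖w‖ ^ 2 := by
    rw [hnw]
    refine lt_of_lt_of_le (mul_pos hj hapos) ?_
    rw [Finset.mul_sum]
    exact Finset.sum_le_sum fun k _ => mul_le_mul_of_nonneg_right (hcl k) (sq_nonneg _)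
  have h1 := hα w (LinearMap.mem_range_self B _) fun s => congrFun ha0 s
  have h2 : l j * ‖w‖ ^ 2 ≤ ‖LinearMap.adjoint B w‖ ^ 2 := by
    rw [norm_sq_adjoint_apply B e, hnw, Finset.mul_sum]
    calc _ ≤ ∑ k, inner ℝ (B (e (c k))) w ^ 2 := by
          refine Finset.sum_le_sum fun k _ => ?_
          rw [hwe, mul_pow, sq (l (c k)), mul_assoc (l (c k))]
          exact mul_le_mul_of_nonneg_right (hcl k)
            (mul_nonneg (hj.le.trans (hcl k)) (sq_nonneg _))
      _ = ∑ k ∈ Finset.univ.map ⟨c, hc⟩, inner ℝ (B (e k)) w ^ 2 := by simp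
      _ ≤ _ := Finset.sum_le_sum_of_subset_of_nonneg (Finset.subset_univ _)
          fun _ _ _ => sq_nonneg _
  exact le_of_mul_le_mul_right (h2.trans h1) hwpos

/-- Lower half of the min-max principle for the squared singular values of `B`. -/
theorem le_eig_of_forall_span (hl : Antitone l)
    (he : ∀ k k', inner ℝ (B (e k)) (B (e k')) = if k = k' then l k else 0)
    (j : Fin d) (f : Fin (j.val + 1) → E) (α : ℝ)
    (hf : ∀ a : Fin (j.val + 1) → ℝ, a ≠ 0 → ∑ s, a s • f s ≠ 0)
    (hα : ∀ a : Fin (j.val + 1) → ℝ,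
      α * ‖∑ s, a s • f s‖ ^ 2 ≤ ‖LinearMap.adjoint B (∑ s, a s • f s)‖ ^ 2) : α ≤ l j := by
  let c : Fin j.val → Fin d := Fin.castLE j.isLt.le
  let y : (Fin (j.val + 1) → ℝ) →ₗ[ℝ] E := ∑ k, (LinearMap.proj k).smulRight (f k)
  have hy : ∀ a, y a = ∑ k, a k • f k := fun a => by simp [y]
  -- Some nonzero vector of the test space is orthogonal to `B (e k)` for all `k < j`; its image
  -- under the adjoint sees only eigenvalues at most `l j`.
  obtain ⟨a, ha, ha0⟩ := exists_ne_zero_of_homogeneous (Nat.lt_succ_self j.val)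
    (LinearMap.pi fun s => (innerₗ E (B (e (c s)))).comp y)
  have hw0 := hf a ha
  have h1 := hα a
  rw [← hy] at hw0 h1
  set w := y a with hw
  have horth : ∀ k : Fin d, k < j → inner ℝ (B (e k)) w = 0 := by
    intro k hk
    exact congrFun ha0 ⟨k.val, hk⟩
  have hl0 : ∀ k, 0 ≤ l k := fun k => by
    have := he k k
    rw [if_pos rfl] at this
    rw [← this]; exact real_inner_self_nonneg
  set x := LinearMap.adjoint B w with hx
  have hxe : ∀ k, inner ℝ (e k) x = inner ℝ (B (e k)) w := fun k => by
    rw [hx, LinearMap.adjoint_inner_right]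
  have hBx : ‖B x‖ ^ 2 = ∑ k, l k * inner ℝ (e k) x ^ 2 := by
    have h2 : ∀ k, inner ℝ (B (e k)) (B x) = l k * inner ℝ (e k) x := by
      intro k
      conv_lhs => rw [← e.sum_repr' x, map_sum, inner_sum]
      simp [he, inner_smul_right, mul_comm]
    rw [← real_inner_self_eq_norm_sq]
    nth_rw 1 [← e.sum_repr' x]
    rw [map_sum, sum_inner]
    refine Finset.sum_congr rfl fun k _ => ?_
    rw [map_smul, inner_smul_left, h2, conj_trivial]; ring
  have hBx' : ‖B x‖ ^ 2 ≤ l j * ‖x‖ ^ 2 := by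
    rw [hBx, ← e.sum_sq_inner_right x, Finset.mul_sum]
    refine Finset.sum_le_sum fun k _ => ?_
    by_cases hk : k < j
    · rw [hxe, horth k hk]; simp
    · exact mul_le_mul_of_nonneg_right (hl (not_lt.1 hk)) (sq_nonneg _)
  have h3 : ‖x‖ ^ 2 ≤ ‖B x‖ * ‖w‖ := by
    rw [← real_inner_self_eq_norm_sq]
    nth_rw 2 [hx]
    rw [LinearMap.adjoint_inner_right]
    exact real_inner_le_norm _ _
  have h4 : ‖x‖ ^ 2 ≤ l j * ‖w‖ ^ 2 := by
    -- This is `‖x‖² = ⟪B x, w⟫` squared, with `‖B x‖² ≤ l j * ‖x‖²`.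
    have h5 : (‖x‖ ^ 2) ^ 2 ≤ ‖x‖ ^ 2 * (l j * ‖w‖ ^ 2) := by
      calc _ ≤ (‖B x‖ * ‖w‖) ^ 2 := pow_le_pow_left₀ (sq_nonneg _) h3 2
        _ = ‖B x‖ ^ 2 * ‖w‖ ^ 2 := mul_pow _ _ _
        _ ≤ (l j * ‖x‖ ^ 2) * ‖w‖ ^ 2 := mul_le_mul_of_nonneg_right hBx' (sq_nonneg _)
        _ = _ := by ring
    rcases (sq_nonneg ‖x‖).eq_or_lt with h | h
    · rw [← h]; exact mul_nonneg (hl0 j) (sq_nonneg _)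
    · rw [sq (‖x‖ ^ 2)] at h5; exact le_of_mul_le_mul_left h5 h
  have hwpos : 0 < ‖w‖ ^ 2 := by positivity
  exact le_of_mul_le_mul_right (h1.trans h4) hwpos

end MinMax

/-! ### The deterministic bound for principal component directions. -/

section SpikedPCA

variable {V E : Type*} [NormedAddCommGroup V] [InnerProductSpace ℝ V]
  [NormedAddCommGroup E] [InnerProductSpace ℝ E]

/-- The deviation `∑_{s ≥ m} λ_s v_s v_sᵀ - δ` of the dual noise covariance from a multiple of
the identity. -/
def noiseDev {d : ℕ} (m : ℕ) (lam : Fin d → ℝ) (v : Fin d → E) (δ : ℝ) : E →ₗ[ℝ] E :=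
  ∑ s with m ≤ s.val, lam s • ((innerₗ E (v s)).smulRight (v s)) - δ • LinearMap.id

theorem noiseDev_apply {d : ℕ} (m : ℕ) (lam : Fin d → ℝ) (v : Fin d → E) (δ : ℝ) (w : E) :
    noiseDev m lam v δ w = ∑ s with m ≤ s.val, (lam s * inner ℝ (v s) w) • v s - δ • w := by
  simp [noiseDev, smul_smul]

theorem inner_noiseDev {d : ℕ} (m : ℕ) (lam : Fin d → ℝ) (v : Fin d → E) (δ : ℝ) (w w' : E) :
    inner ℝ w' (noiseDev m lam v δ w) =
      ∑ s with m ≤ s.val, lam s * inner ℝ (v s) w * inner ℝ (v s) w' - δ * inner ℝ w w' := by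
  simp only [noiseDev_apply, inner_sub_right, inner_sum, inner_smul_right,
    real_inner_comm w' w, real_inner_comm w' (v _)]

theorem noiseDev_symm {d : ℕ} (m : ℕ) (lam : Fin d → ℝ) (v : Fin d → E) (δ : ℝ) (w w' : E) :
    inner ℝ (noiseDev m lam v δ w) w' = inner ℝ w (noiseDev m lam v δ w') := by
  rw [real_inner_comm, inner_noiseDev, inner_noiseDev, real_inner_comm w]
  congr 1
  exact Finset.sum_congr rfl fun s _ => by ring

variable [FiniteDimensional ℝ V] [FiniteDimensional ℝ E]

variable {d : ℕ} (B : V →ₗ[ℝ] E) (h e : OrthonormalBasis (Fin d) ℝ V) (lam l : Fin d → ℝ)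
  (v : Fin d → E)

/-- The form of `BB*` split into spike, multiple of the identity and deviation, ready for the
min-max bounds. -/
theorem norm_sq_adjoint_eq (hlam : ∀ s, 0 ≤ lam s) (hBh : ∀ s, B (h s) = √(lam s) • v s)
    (m : ℕ) (δ : ℝ) (w : E) :
    ‖LinearMap.adjoint B w‖ ^ 2 = ∑ s with s.val < m, lam s * inner ℝ (v s) w ^ 2 +
      δ * ‖w‖ ^ 2 + inner ℝ w (noiseDev m lam v δ w) := by
  rw [norm_sq_adjoint_apply B h, inner_noiseDev, real_inner_self_eq_norm_sq,
    ← Finset.sum_filter_add_sum_filter_not _ (fun s : Fin d => s.val < m)]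
  have : ∀ s, inner ℝ (B (h s)) w ^ 2 = lam s * inner ℝ (v s) w ^ 2 := fun s => by
    rw [hBh, inner_smul_left, mul_pow, conj_trivial, Real.sq_sqrt (hlam s)]
  simp only [this, not_lt]
  have h2 : ∑ s with m ≤ s.val, lam s * inner ℝ (v s) w * inner ℝ (v s) w =
      ∑ s with m ≤ s.val, lam s * inner ℝ (v s) w ^ 2 :=
    Finset.sum_congr rfl fun s _ => by ring
  rw [h2]; ring

/-- Weyl's inequality with an error relative to `λ_j` itself. The test spaces are adapted to `j`:
the span of `v_0, …, v_j` from below, the complement of `v_0, …, v_{j-1}` from above, so larger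
spikes do not enter the error. -/
theorem spiked_eig_bound (hlam : ∀ s, 0 ≤ lam s) (hanti : Antitone lam)
    (hBh : ∀ s, B (h s) = √(lam s) • v s) (hl : Antitone l)
    (he : ∀ k k', inner ℝ (B (e k)) (B (e k')) = if k = k' then l k else 0)
    (m : ℕ) (j : Fin d) (hjm : j.val < m) (hjpos : 0 < lam j)
    (U : Submodule ℝ E) (hBU : LinearMap.range B ≤ U)
    (hvU : ∀ s : Fin d, s.val < m → v s ∈ U) {δ ε θ : ℝ} (hδ : 0 ≤ δ) (hε : 0 ≤ ε)
    (hmε : m * ε + θ < 1) (hθ : 0 ≤ θ)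
    (hgram : ∀ s t : Fin d, s.val < m → t.val < m →
      |inner ℝ (v s) (v t) - (if s = t then 1 else 0)| ≤ ε)
    (hRU : ∀ w ∈ U, ‖noiseDev m lam v δ w‖ ≤ θ * lam j * ‖w‖) :
    |l j - δ - lam j| ≤ (m * ε + θ) * lam j := by
  have hquad : ∀ w ∈ U, |inner ℝ w (noiseDev m lam v δ w)| ≤ θ * lam j * ‖w‖ ^ 2 := by
    intro w hw
    refine (abs_real_inner_le_norm _ _).trans ?_
    have := mul_le_mul_of_nonneg_left (hRU w hw) (norm_nonneg w)
    nlinarith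
  have hcard : ∀ k : ℕ, ((Finset.univ.filter fun s : Fin d => s.val < k).card : ℝ) ≤ k := by
    intro k
    have h1 : (Finset.univ.filter fun s : Fin d => s.val < k).card ≤ (Finset.range k).card :=
      Finset.card_le_card_of_injOn Fin.val (fun s hs => by simpa using hs)
        (Fin.val_injective.injOn)
    rw [Finset.card_range] at h1
    exact_mod_cast h1
  have hlow : δ + (1 - m * ε - θ) * lam j ≤ l j := by
    let c : Fin (j.val + 1) → Fin d := Fin.castLE j.isLt
    have hc : Function.Injective c := Fin.castLE_injective _
    have hcm : ∀ s, (c s).val < m := fun s =>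
      lt_of_le_of_lt (Nat.le_of_lt_succ s.isLt) hjm
    have hgc : ∀ s ∈ (Finset.univ : Finset (Fin (j.val + 1))), ∀ t ∈ Finset.univ,
        |inner ℝ (v (c s)) (v (c t)) - (if s = t then 1 else 0)| ≤ ε := by
      intro s _ t _
      have := hgram (c s) (c t) (hcm s) (hcm t)
      simpa only [hc.eq_iff] using this
    have hcε : ((Finset.univ : Finset (Fin (j.val + 1))).card : ℝ) * ε ≤ m * ε := by
      refine mul_le_mul_of_nonneg_right ?_ hε
      rw [Finset.card_univ, Fintype.card_fin]; exact_mod_cast hjm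
    refine le_eig_of_forall_span B e l hl he j (fun s => v (c s)) _ ?_ ?_
    · intro a ha h0
      have h1 := (abs_le.1 (abs_norm_sq_sum_smul_sub_le _ (fun s => v (c s)) hgc a)).1
      rw [h0, norm_zero] at h1
      obtain ⟨k, hk⟩ := Function.ne_iff.1 ha
      have h2 : 0 < ∑ k, a k ^ 2 :=
        Finset.sum_pos' (fun _ _ => sq_nonneg _) ⟨k, Finset.mem_univ _, sq_pos_of_ne_zero hk⟩
      nlinarith
    · intro a
      have h1 := le_sum_sq_inner _ (fun s => v (c s)) hgc (by linarith) a
      set w := ∑ s, a s • v (c s) with hw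
      have hwU : w ∈ U := U.sum_mem fun s _ => U.smul_mem _ (hvU _ (hcm s))
      rw [norm_sq_adjoint_eq B h lam v hlam hBh m δ]
      have h2 : lam j * ∑ s, inner ℝ (v (c s)) w ^ 2 ≤
          ∑ s with s.val < m, lam s * inner ℝ (v s) w ^ 2 := by
        rw [Finset.mul_sum]
        calc _ ≤ ∑ s, lam (c s) * inner ℝ (v (c s)) w ^ 2 := by
              refine Finset.sum_le_sum fun s _ => mul_le_mul_of_nonneg_right (hanti ?_)
                (sq_nonneg _)
              rw [Fin.le_def]; exact Nat.le_of_lt_succ s.isLt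
          _ = ∑ s ∈ Finset.univ.map ⟨c, hc⟩, lam s * inner ℝ (v s) w ^ 2 := by simp
          _ ≤ _ := Finset.sum_le_sum_of_subset_of_nonneg
              (fun s hs => by
                obtain ⟨t, -, rfl⟩ := Finset.mem_map.1 hs
                simpa using hcm t)
              fun _ _ _ => mul_nonneg (hlam _) (sq_nonneg _)
      have h3 := (abs_le.1 (hquad w hwU)).1
      have h4 : (1 - m * ε) * ‖w‖ ^ 2 ≤ ∑ s, inner ℝ (v (c s)) w ^ 2 :=
        (mul_le_mul_of_nonneg_right (by linarith) (sq_nonneg _)).trans h1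
      have h5 := mul_le_mul_of_nonneg_left h4 hjpos.le
      nlinarith
  have hup : l j ≤ δ + (1 + m * ε + θ) * lam j := by
    refine eig_le_of_forall_orthogonal B e l hl he j ?_
      (fun s => v (Fin.castLE j.isLt.le s)) _ ?_
    -- The lower bound supplies the positivity of `l j` that the upper half of min-max requires.
    · refine lt_of_lt_of_le ?_ hlow
      have : 0 < (1 - m * ε - θ) * lam j := mul_pos (by linarith) hjpos
      linarith
    · intro w hw horth
      rw [norm_sq_adjoint_eq B h lam v hlam hBh m δ]
      have h1 := (abs_le.1 (hquad w (hBU hw))).2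
      have h2 := sum_sq_inner_le (Finset.univ.filter fun s : Fin d => s.val < m) v hε
        (fun s hs t ht => hgram s t (by simpa using hs) (by simpa using ht)) w
      have h3 : ∑ s with s.val < m, lam s * inner ℝ (v s) w ^ 2 ≤
          lam j * ∑ s with s.val < m, inner ℝ (v s) w ^ 2 := by
        rw [Finset.mul_sum]
        refine Finset.sum_le_sum fun s _ => ?_
        by_cases hs : s < j
        · have : inner ℝ (v s) w = 0 := horth ⟨s.val, hs⟩
          rw [this]; simp
        · exact mul_le_mul_of_nonneg_right (hanti (not_lt.1 hs)) (sq_nonneg _)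
      have h4 : ∑ s with s.val < m, inner ℝ (v s) w ^ 2 ≤ (1 + m * ε) * ‖w‖ ^ 2 := by
        refine h2.trans (mul_le_mul_of_nonneg_right ?_ (sq_nonneg _))
        have := mul_le_mul_of_nonneg_right (hcard m) hε
        linarith
      have h5 := mul_le_mul_of_nonneg_left h4 hjpos.le
      nlinarith
  rw [abs_le]; constructor <;> nlinarith

/-- For `c ≤ 1` one has `1 / (1 + c) ≤ 1 - c / 2`, so the smaller of `x`, `y` is at most `1 - c / 2`
times the larger, and moving `x` to `κ` costs only `c / 8`. -/
theorem spiked_gap {x y κ c : ℝ} (hx : 0 < x) (hy : 0 < y) (hc : 0 < c) (hc1 : c ≤ 1)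
    (hκ : |κ - x| ≤ c / 8 * x) (hxy : (1 + c) * y ≤ x ∨ (1 + c) * x ≤ y) :
    c / 4 * max x y ≤ |κ - y| := by
  obtain ⟨h1, h2⟩ := abs_le.1 hκ
  rcases hxy with h | h
  · have hyx : y ≤ x := by nlinarith
    rw [max_eq_left hyx]
    refine le_trans ?_ (le_abs_self _)
    have : y ≤ (1 - c / 2) * x := by
      have : (1 + c) * y ≤ (1 + c) * ((1 - c / 2) * x) := by
        nlinarith [mul_nonneg (mul_nonneg hc.le (sub_nonneg.2 hc1)) hx.le]
      exact le_of_mul_le_mul_left this (by linarith)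
    nlinarith
  · have hyx : x ≤ y := by nlinarith
    rw [max_eq_right hyx, abs_sub_comm]
    refine le_trans ?_ (le_abs_self _)
    have : x ≤ (1 - c / 2) * y := by
      have : (1 + c) * x ≤ (1 + c) * ((1 - c / 2) * y) := by
        nlinarith [mul_nonneg (mul_nonneg hc.le (sub_nonneg.2 hc1)) hy.le]
      exact le_of_mul_le_mul_left this (by linarith)
    nlinarith

/-- Deterministic error bound for a scaled principal component direction. -/
theorem spiked_pca_bound (hlam : ∀ s, 0 ≤ lam s) (hanti : Antitone lam)
    (hBh : ∀ s, B (h s) = √(lam s) • v s) (hl : Antitone l)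
    (he : ∀ k k', inner ℝ (B (e k)) (B (e k')) = if k = k' then l k else 0)
    (m : ℕ) (hmd : m ≤ d) (j : Fin d) (hjm : j.val < m)
    (hpos : ∀ s : Fin d, s.val < m → 0 < lam s)
    {c : ℝ} (hc : 0 < c) (hc1 : c ≤ 1)
    (hgap : ∀ s t : Fin d, s < t → t.val < m → (1 + c) * lam t ≤ lam s)
    (U : Submodule ℝ E) (hBU : LinearMap.range B ≤ U)
    (hvU : ∀ s : Fin d, s.val < m → v s ∈ U) {δ ε : ℝ} (hδ : 0 ≤ δ) (hε : 0 ≤ ε)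
    (hmε : m * ε ≤ c / 16)
    (hgram : ∀ s t : Fin d, s.val < m → t.val < m →
      |inner ℝ (v s) (v t) - (if s = t then 1 else 0)| ≤ ε)
    (hRv : ∀ s : Fin d, s.val < m → ‖noiseDev m lam v δ (v s)‖ ≤ ε * lam j)
    (hRU : ∀ w ∈ U, ‖noiseDev m lam v δ w‖ ≤ c / 16 * lam j * ‖w‖)
    (hvRv : |inner ℝ (v j) (noiseDev m lam v δ (v j))| ≤ ε ^ 2 * lam j)
    (hsign : 0 ≤ inner ℝ (h j) (e j)) :
    |‖√(l j) • e j - √(lam j) • h j‖ ^ 2 / lam j - δ / lam j| ≤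
      spikeConst m (c / 4) * ε ^ 2 := by
  have hlj := hpos j hjm
  -- The budget `c / 16` for the Gram error and `c / 16` for the operator add up to the `c / 8` of
  -- `spiked_gap`.
  have hloc := spiked_eig_bound B h e lam l v hlam hanti hBh hl he m j hjm hlj U hBU hvU hδ hε
    (θ := c / 16) (by linarith) (by positivity) hgram hRU
  have hloc' : |l j - δ - lam j| ≤ c / 8 * lam j :=
    hloc.trans (mul_le_mul_of_nonneg_right (by linarith) hlj.le)
  have hκ : 3 / 4 * lam j ≤ l j - δ := by
    have := (abs_le.1 hloc').1
    nlinarith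
  have hLpos : 0 < l j := by nlinarith
  have hsq : 0 < √(l j) := Real.sqrt_pos.2 hLpos
  have hsqj : 0 < √(lam j) := Real.sqrt_pos.2 hlj
  have hsq2 : √(l j) * √(l j) = l j := Real.mul_self_sqrt hLpos.le
  have hsqj2 : √(lam j) * √(lam j) = lam j := Real.mul_self_sqrt hlj.le
  set R := noiseDev m lam v δ with hR
  set I := Finset.univ.filter fun s : Fin d => s.val < m with hI
  have hIm : ∀ s, s ∈ I ↔ s.val < m := fun s => by simp [hI]
  have hcard : I.card = m := by
    rw [hI, Fin.card_filter_val_lt, min_eq_right hmd]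
  set u : E := (√(l j))⁻¹ • B (e j) with hu
  have huB : B (e j) = √(l j) • u := by rw [hu, smul_smul, mul_inv_cancel₀ hsq.ne', one_smul]
  have hunorm : ‖u‖ = 1 := by
    have h1 : ‖B (e j)‖ ^ 2 = l j := by
      rw [← real_inner_self_eq_norm_sq, he, if_pos rfl]
    have h2 : ‖B (e j)‖ = √(l j) := by rw [← h1, Real.sqrt_sq (norm_nonneg _)]
    rw [hu, norm_smul, h2, Real.norm_eq_abs, abs_of_pos (by positivity), inv_mul_cancel₀ hsq.ne']
  have hadj : LinearMap.adjoint B (B (e j)) = l j • e j := by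
    refine e.repr.injective (PiLp.ext fun k => ?_)
    rw [e.repr_apply_apply, e.repr_apply_apply, LinearMap.adjoint_inner_right, he,
      inner_smul_right, orthonormal_iff_ite.1 e.orthonormal]
    split_ifs with hk
    · rw [hk, mul_one]
    · rw [mul_zero]
  have heig : (l j - δ) • u - R u = ∑ s ∈ I, (lam s * inner ℝ (v s) u) • v s := by
    have h1 : B (LinearMap.adjoint B u) = ∑ s, (lam s * inner ℝ (v s) u) • v s := by
      conv_lhs => rw [← h.sum_repr' (LinearMap.adjoint B u), map_sum]
      refine Finset.sum_congr rfl fun s _ => ?_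
      rw [map_smul, LinearMap.adjoint_inner_right, hBh, inner_smul_left, conj_trivial, smul_smul]
      congr 1
      calc _ = (√(lam s) * √(lam s)) * inner ℝ (v s) u := by ring
        _ = _ := by rw [Real.mul_self_sqrt (hlam s)]
    have h2 : B (LinearMap.adjoint B u) = l j • u := by
      rw [hu, map_smul, hadj, map_smul, map_smul, smul_comm]
    rw [h2, ← Finset.sum_filter_add_sum_filter_not _ (fun s : Fin d => s.val < m)] at h1
    simp only [not_lt] at h1
    rw [hR, noiseDev_apply, sub_smul, h1]
    abel
  -- Both sides are `⟪B (h j), B (e j)⟫ / √(l j)`. This transfers the sign convention to `u` and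
  -- turns the cross term of the squared distance into a dual quantity.
  have hb : √(lam j) * inner ℝ (v j) u = √(l j) * inner ℝ (h j) (e j) := by
    have h1 : inner ℝ (B (h j)) (B (e j)) = l j * inner ℝ (h j) (e j) := by
      rw [← LinearMap.adjoint_inner_right, hadj, inner_smul_right]
    rw [hBh, huB, inner_smul_left, inner_smul_right, conj_trivial] at h1
    refine mul_left_cancel₀ hsq.ne' ?_
    calc _ = √(lam j) * (√(l j) * inner ℝ (v j) u) := by ring
      _ = _ := by rw [h1, ← mul_assoc, hsq2]
  have hbpos : 0 ≤ inner ℝ (v j) u := by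
    have : 0 ≤ √(lam j) * inner ℝ (v j) u := by rw [hb]; positivity
    exact nonneg_of_mul_nonneg_right this hsqj
  have hmain := spiked_eigvec_bound I j ((hIm j).2 hjm) lam v (fun s hs => hpos s ((hIm s).1 hs)) R
    (noiseDev_symm m lam v δ) u hunorm U
    (U.smul_mem _ (hBU (LinearMap.mem_range_self B _))) (hvU j hjm) (κ := l j - δ) (g := c / 4)
    (ε := ε) (by positivity) hε
    (by
      have : (1 : ℝ) ≤ m := by exact_mod_cast (Nat.zero_lt_of_lt hjm)
      nlinarith)
    (by
      rw [hcard, div_mul_eq_mul_div, div_le_iff₀ (by positivity)]; linarith)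
    heig (fun s hs t ht => hgram s t ((hIm s).1 hs) ((hIm t).1 ht))
    (fun t ht htj => spiked_gap hlj (hpos t ((hIm t).1 ht)) hc hc1 hloc' (by
      rcases lt_or_gt_of_ne htj with h1 | h1
      · exact Or.inr (hgap t j h1 hjm)
      · exact Or.inl (hgap j t h1 ((hIm t).1 ht))))
    hκ (fun s hs => hRv s ((hIm s).1 hs))
    (fun w hw => (hRU w hw).trans (mul_le_mul_of_nonneg_right
      (mul_le_mul_of_nonneg_right (by linarith) hlj.le) (norm_nonneg _)))
    hvRv hbpos
  rw [hcard] at hmain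
  refine le_trans ?_ hmain
  have hquad : l j = ∑ s ∈ I, lam s * inner ℝ (v s) u ^ 2 + δ + inner ℝ u (R u) := by
    have h1 := congrArg (fun x => inner ℝ u x) heig
    simp only [inner_sub_right, inner_smul_right, inner_sum, real_inner_self_eq_norm_sq,
      hunorm] at h1
    have h2 : ∑ s ∈ I, lam s * inner ℝ (v s) u * inner ℝ u (v s) =
        ∑ s ∈ I, lam s * inner ℝ (v s) u ^ 2 :=
      Finset.sum_congr rfl fun s _ => by rw [real_inner_comm u]; ring
    rw [h2] at h1
    linarith
  rw [← Finset.add_sum_erase I _ ((hIm j).2 hjm)] at hquad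
  have hnorm : ‖√(l j) • e j - √(lam j) • h j‖ ^ 2 =
      l j + lam j - 2 * lam j * inner ℝ (v j) u := by
    rw [norm_sub_sq_real, norm_smul, norm_smul, inner_smul_left, inner_smul_right,
      e.norm_eq_one, h.norm_eq_one, mul_one, mul_one, Real.norm_eq_abs, Real.norm_eq_abs,
      sq_abs, sq_abs, Real.sq_sqrt hLpos.le, Real.sq_sqrt hlj.le, conj_trivial,
      real_inner_comm (h j) (e j)]
    have h1 : √(l j) * (√(lam j) * inner ℝ (h j) (e j)) = lam j * inner ℝ (v j) u := by
      calc _ = √(lam j) * (√(l j) * inner ℝ (h j) (e j)) := by ring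
        _ = _ := by rw [← hb, ← mul_assoc, hsqj2]
    rw [h1]; ring
  -- The exact identity behind the theorem: completing the square in `⟪v j, u⟫` cancels all
  -- first-order terms.
  have hfinal : ‖√(l j) • e j - √(lam j) • h j‖ ^ 2 / lam j - δ / lam j =
      (1 - inner ℝ (v j) u) ^ 2 + ∑ s ∈ I.erase j, lam s / lam j * inner ℝ (v s) u ^ 2 +
      inner ℝ u (R u) / lam j := by
    have h1 : ∑ s ∈ I.erase j, lam s / lam j * inner ℝ (v s) u ^ 2 =
        (∑ s ∈ I.erase j, lam s * inner ℝ (v s) u ^ 2) / lam j := by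
      rw [Finset.sum_div]; exact Finset.sum_congr rfl fun s _ => by ring
    rw [hnorm, h1]
    field_simp
    linarith
  rw [hfinal]
  refine (abs_add_le _ _).trans ?_
  rw [abs_div, abs_of_pos hlj]
  gcongr
  rw [abs_of_nonneg]
  exact add_nonneg (sq_nonneg _) (Finset.sum_nonneg fun s hs => mul_nonneg
    (div_nonneg (hlam s) hlj.le) (sq_nonneg _))

end SpikedPCA

/-! ### Moments of functions of independent copies. -/

section PiMoments

variable {X : Type*} [MeasurableSpace X] {n : ℕ} (μ : Measure X) [IsProbabilityMeasure μ]

theorem iIndepFun_eval : iIndepFun (fun (i : Fin n) (ζ : Fin n → X) => ζ i)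
    (Measure.pi fun _ : Fin n => μ) :=
  iIndepFun_pi (X := fun _ : Fin n => (id : X → X)) fun _ => aemeasurable_id

variable {μ}

theorem memLp_eval {f : X → ℝ} {p : ENNReal} (hf : MemLp f p μ) (i : Fin n) :
    MemLp (fun ζ : Fin n → X => f (ζ i)) p (Measure.pi fun _ => μ) :=
  hf.comp_measurePreserving (measurePreserving_eval (fun _ => μ) i)

theorem integral_eval {f : X → ℝ} (hf : Measurable f) (i : Fin n) :
    ∫ ζ, f (ζ i) ∂(Measure.pi fun _ : Fin n => μ) = ∫ w, f w ∂μ := by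
  have h := (measurePreserving_eval (fun _ : Fin n => μ) i).map_eq
  conv_rhs => rw [← h]
  rw [integral_map (measurable_pi_apply i).aemeasurable hf.aestronglyMeasurable]

theorem integral_pair {f g : X → ℝ} (hf : Measurable f) (hg : Measurable g) {i k : Fin n}
    (hik : i ≠ k) : ∫ ζ, f (ζ i) * g (ζ k) ∂(Measure.pi fun _ : Fin n => μ) =
      (∫ w, f w ∂μ) * ∫ w, g w ∂μ := by
  rw [← integral_eval hf i, ← integral_eval hg k]
  exact ((iIndepFun_eval μ).indepFun hik).integral_fun_comp_mul_comp
    (measurable_pi_apply i).aemeasurable (measurable_pi_apply k).aemeasurable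
    hf.aestronglyMeasurable hg.aestronglyMeasurable

/-- Independence keeps the exponent, where Hölder would halve it; thus the pair kernels have fourth
moments although the coordinates have only four. -/
theorem memLp_pair {f g : X → ℝ} {p : ENNReal} (hp : p ≠ 0) (hp' : p ≠ ⊤) (hf : MemLp f p μ)
    (hg : MemLp g p μ) (hfm : Measurable f) (hgm : Measurable g) {i k : Fin n} (hik : i ≠ k) :
    MemLp (fun ζ : Fin n → X => f (ζ i) * g (ζ k)) p (Measure.pi fun _ => μ) := by
  have hm : AEStronglyMeasurable (fun ζ : Fin n → X => f (ζ i) * g (ζ k))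
      (Measure.pi fun _ => μ) := by
    have : Measurable fun ζ : Fin n → X => f (ζ i) * g (ζ k) :=
      (hfm.comp (measurable_pi_apply i)).mul (hgm.comp (measurable_pi_apply k))
    exact this.aestronglyMeasurable
  rw [← integrable_norm_rpow_iff hm hp hp']
  have h1 := (integrable_norm_rpow_iff (memLp_eval hf i).1 hp hp').2 (memLp_eval hf i)
  have h2 := (integrable_norm_rpow_iff (memLp_eval hg k).1 hp hp').2 (memLp_eval hg k)
  have hind : IndepFun (fun ζ : Fin n → X => ‖f (ζ i)‖ ^ p.toReal)
      (fun ζ : Fin n → X => ‖g (ζ k)‖ ^ p.toReal) (Measure.pi fun _ => μ) :=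
    ((iIndepFun_eval μ).indepFun hik).comp (φ := fun w => ‖f w‖ ^ p.toReal)
      (ψ := fun w => ‖g w‖ ^ p.toReal) (by fun_prop) (by fun_prop)
  refine (hind.integrable_mul h1 h2).congr (Eventually.of_forall fun ζ => ?_)
  simp only [Pi.mul_apply, norm_mul]
  rw [Real.mul_rpow (norm_nonneg _) (norm_nonneg _)]

/-- A centred factor whose observation occurs nowhere else integrates out to zero; all orthogonality
of the kernel sums rests on this. -/
theorem integral_eq_zero_of_notMem {f : X → ℝ} (hf : Measurable f) (h0 : ∫ w, f w ∂μ = 0)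
    {i : Fin n} {T : Finset (Fin n)} (hi : i ∉ T) {G : (T → X) → ℝ} (hG : Measurable G) :
    ∫ ζ, f (ζ i) * G (fun t => ζ t) ∂(Measure.pi fun _ : Fin n => μ) = 0 := by
  have h := (iIndepFun_eval (n := n) μ).indepFun_finset {i} T
    (Finset.disjoint_singleton_left.2 hi) (fun i => measurable_pi_apply i)
  have h1 := h.integral_fun_comp_mul_comp
    (f := fun w : ({i} : Finset (Fin n)) → X => f (w ⟨i, Finset.mem_singleton_self i⟩))
    (g := G) (measurable_pi_lambda _ fun _ => measurable_pi_apply _).aemeasurable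
    (measurable_pi_lambda _ fun _ => measurable_pi_apply _).aemeasurable
    (hf.comp (measurable_pi_apply _)).aestronglyMeasurable hG.aestronglyMeasurable
  rw [h1, integral_eval hf i, h0, zero_mul]

theorem integral_quad_eq_zero {f₁ f₂ f₃ f₄ : X → ℝ} (h₁ : Measurable f₁) (h₂ : Measurable f₂)
    (h₃ : Measurable f₃) (h₄ : Measurable f₄) (h0 : ∫ w, f₁ w ∂μ = 0) {i a b c : Fin n}
    (ha : i ≠ a) (hb : i ≠ b) (hc : i ≠ c) :
    ∫ ζ, f₁ (ζ i) * (f₂ (ζ a) * f₃ (ζ b) * f₄ (ζ c)) ∂(Measure.pi fun _ : Fin n => μ) = 0 := by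
  have hi : i ∉ ({a, b, c} : Finset (Fin n)) := by simp [ha, hb, hc]
  exact integral_eq_zero_of_notMem h₁ h0 hi
    (G := fun w => f₂ (w ⟨a, by simp⟩) * f₃ (w ⟨b, by simp⟩) * f₄ (w ⟨c, by simp⟩))
    (by fun_prop)

theorem integral_quad {f₁ f₂ f₃ f₄ : X → ℝ} (h₁ : Measurable f₁) (h₂ : Measurable f₂)
    (h₃ : Measurable f₃) (h₄ : Measurable f₄) {i a b c : Fin n} (hia : i ≠ a) (hib : i ≠ b)
    (hic : i ≠ c) (hab : a ≠ b) (hac : a ≠ c) (hbc : b ≠ c) :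
    ∫ ζ, f₁ (ζ i) * f₂ (ζ a) * f₃ (ζ b) * f₄ (ζ c) ∂(Measure.pi fun _ : Fin n => μ) =
      (∫ w, f₁ w ∂μ) * (∫ w, f₂ w ∂μ) * (∫ w, f₃ w ∂μ) * ∫ w, f₄ w ∂μ := by
  have hinj : Function.Injective ![i, a, b, c] := by
    intro x y hxy
    fin_cases x <;> fin_cases y <;> simp_all [eq_comm]
  have hm : ∀ t, Measurable (![f₁, f₂, f₃, f₄] t) := by
    intro t; fin_cases t <;> assumption
  have h := ((iIndepFun_eval (n := n) μ).precomp hinj).integral_fun_prod_comp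
    (f := fun t => ![f₁, f₂, f₃, f₄] t) (fun t => (measurable_pi_apply _).aemeasurable)
    (fun t => (hm t).aestronglyMeasurable)
  simp only [integral_eval (hm _), Fin.prod_univ_four] at h
  exact h

theorem integral_sq_sum_of_orthogonal {Ω ι : Type*} [MeasurableSpace Ω] {P : Measure Ω}
    (s : Finset ι) (Y : ι → Ω → ℝ) (hY : ∀ k ∈ s, MemLp (Y k) 2 P)
    (horth : ∀ k ∈ s, ∀ k' ∈ s, k ≠ k' → ∫ ω, Y k ω * Y k' ω ∂P = 0) :
    ∫ ω, (∑ k ∈ s, Y k ω) ^ 2 ∂P = ∑ k ∈ s, ∫ ω, Y k ω ^ 2 ∂P := by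
  classical
  have hI : ∀ k ∈ s, ∀ k' ∈ s, Integrable (fun ω => Y k ω * Y k' ω) P :=
    fun k hk k' hk' => (hY k hk).integrable_mul (hY k' hk')
  simp only [sq, Finset.sum_mul_sum]
  rw [integral_finsetSum _ fun k hk => integrable_finsetSum _ fun k' hk' => hI k hk k' hk']
  refine Finset.sum_congr rfl fun k hk => ?_
  rw [integral_finsetSum _ fun k' hk' => hI k hk k' hk']
  exact Finset.sum_eq_single_of_mem k hk fun k' hk' hne => horth k hk k' hk' hne.symm

theorem integral_sq_sum_eval {f : X → ℝ} (hf : Measurable f) (hf2 : MemLp f 2 μ)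
    (h0 : ∫ w, f w ∂μ = 0) :
    ∫ ζ, (∑ i, f (ζ i)) ^ 2 ∂(Measure.pi fun _ : Fin n => μ) = n * ∫ w, f w ^ 2 ∂μ := by
  rw [integral_sq_sum_of_orthogonal _ _ fun i _ => memLp_eval hf2 i]
  · simp only [integral_eval (hf.pow_const 2)]
    simp
  · intro i _ k _ hik
    rw [integral_pair hf hf hik, h0, zero_mul]

end PiMoments

/-! ### Second moments of sums of pair kernels. -/

section PairKernel

variable {d n : ℕ}

/-- The kernel `∑_r a_r ψ_r(ζ_i) φ_r(ζ_k)` of a pair of observations. -/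
def pairKernel (a : Fin d → ℝ) (ψ φ : Fin d → Vec d → ℝ) (ζ : Fin n → Vec d) (i k : Fin n) : ℝ :=
  ∑ r, a r * (ψ r (ζ i) * φ r (ζ k))

theorem pairKernel_swap (a : Fin d → ℝ) (ψ φ : Fin d → Vec d → ℝ) (ζ : Fin n → Vec d)
    (i k : Fin n) : pairKernel a ψ φ ζ i k = pairKernel a φ ψ ζ k i :=
  Finset.sum_congr rfl fun r _ => by ring

variable {μ : Measure (Vec d)} [IsProbabilityMeasure μ] {ψ φ ψ' φ' : Fin d → Vec d → ℝ}
  (a : Fin d → ℝ)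

theorem memLp_pairKernel {p : ENNReal} (hp : p ≠ 0) (hp' : p ≠ ⊤)
    (hψm : ∀ r, Measurable (ψ r)) (hφm : ∀ r, Measurable (φ r))
    (hψ : ∀ r, MemLp (ψ r) p μ) (hφ : ∀ r, MemLp (φ r) p μ) {i k : Fin n} (hik : i ≠ k) :
    MemLp (fun ζ => pairKernel a ψ φ ζ i k) p (Measure.pi fun _ : Fin n => μ) :=
  memLp_finsetSum _ fun r _ =>
    (memLp_pair hp hp' (hψ r) (hφ r) (hψm r) (hφm r) hik).const_mul _

theorem integral_pairKernel_mul_eq_zero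
    (hψm : ∀ r, Measurable (ψ r)) (hφm : ∀ r, Measurable (φ r))
    (hψm' : ∀ r, Measurable (ψ' r)) (hφm' : ∀ r, Measurable (φ' r))
    (hψ : ∀ r, MemLp (ψ r) 2 μ) (hφ : ∀ r, MemLp (φ r) 2 μ)
    (hψ' : ∀ r, MemLp (ψ' r) 2 μ) (hφ' : ∀ r, MemLp (φ' r) 2 μ)
    (h0 : ∀ r, a r ≠ 0 → ∫ w, ψ r w ∂μ = 0) {i k i' k' : Fin n} (hik : i ≠ k) (hik' : i' ≠ k')
    (h1 : i ≠ i') (h2 : i ≠ k') :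
    ∫ ζ, pairKernel a ψ φ ζ i k * pairKernel a ψ' φ' ζ i' k'
      ∂(Measure.pi fun _ : Fin n => μ) = 0 := by
  have hI : ∀ r r', Integrable (fun ζ : Fin n → Vec d =>
      a r * (ψ r (ζ i) * φ r (ζ k)) * (a r' * (ψ' r' (ζ i') * φ' r' (ζ k'))))
      (Measure.pi fun _ => μ) := fun r r' =>
    ((memLp_pair two_ne_zero (by simp) (hψ r) (hφ r) (hψm r) (hφm r) hik).const_mul
      (a r)).integrable_mul ((memLp_pair two_ne_zero (by simp) (hψ' r') (hφ' r') (hψm' r')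
        (hφm' r') hik').const_mul (a r'))
  simp only [pairKernel, Finset.sum_mul_sum]
  rw [integral_finsetSum _ fun r _ => integrable_finsetSum _ fun r' _ => hI r r']
  refine Finset.sum_eq_zero fun r _ => ?_
  rw [integral_finsetSum _ fun r' _ => hI r r']
  refine Finset.sum_eq_zero fun r' _ => ?_
  by_cases hr : a r = 0
  · simp [hr]
  have h := integral_quad_eq_zero (hψm r) (hφm r) (hψm' r') (hφm' r') (h0 r hr) hik h1 h2
  calc _ = ∫ ζ, (a r * a r') * (ψ r (ζ i) * (φ r (ζ k) * ψ' r' (ζ i') * φ' r' (ζ k')))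
        ∂(Measure.pi fun _ : Fin n => μ) := by
          congr 1; ext ζ; ring
    _ = 0 := by rw [integral_const_mul, h, mul_zero]

/-- Orthonormality is asked only where the weights are nonzero, since the products `z_r z_s` with
`s` fixed are orthonormal only for `r ≠ s`, and the weight of a spiked `s` is zero. -/
theorem integral_pairKernel_sq
    (hψm : ∀ r, Measurable (ψ r)) (hφm : ∀ r, Measurable (φ r))
    (hψ : ∀ r, MemLp (ψ r) 2 μ) (hφ : ∀ r, MemLp (φ r) 2 μ)
    (hψc : ∀ r r', a r ≠ 0 → a r' ≠ 0 → ∫ w, ψ r w * ψ r' w ∂μ = if r = r' then 1 else 0)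
    (hφc : ∀ r r', a r ≠ 0 → a r' ≠ 0 → ∫ w, φ r w * φ r' w ∂μ = if r = r' then 1 else 0)
    {i k : Fin n} (hik : i ≠ k) :
    ∫ ζ, pairKernel a ψ φ ζ i k ^ 2 ∂(Measure.pi fun _ : Fin n => μ) = ∑ r, a r ^ 2 := by
  have hI : ∀ r r', Integrable (fun ζ : Fin n → Vec d =>
      a r * (ψ r (ζ i) * φ r (ζ k)) * (a r' * (ψ r' (ζ i) * φ r' (ζ k))))
      (Measure.pi fun _ => μ) := fun r r' =>
    ((memLp_pair two_ne_zero (by simp) (hψ r) (hφ r) (hψm r) (hφm r) hik).const_mul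
      (a r)).integrable_mul ((memLp_pair two_ne_zero (by simp) (hψ r') (hφ r') (hψm r')
        (hφm r') hik).const_mul (a r'))
  simp only [pairKernel, sq, Finset.sum_mul_sum]
  rw [integral_finsetSum _ fun r _ => integrable_finsetSum _ fun r' _ => hI r r']
  refine Finset.sum_congr rfl fun r _ => ?_
  rw [integral_finsetSum _ fun r' _ => hI r r']
  have h : ∀ r', ∫ ζ, a r * (ψ r (ζ i) * φ r (ζ k)) * (a r' * (ψ r' (ζ i) * φ r' (ζ k)))
      ∂(Measure.pi fun _ : Fin n => μ) = if r = r' then a r * a r' else 0 := by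
    intro r'
    have h1 := integral_pair (μ := μ) (f := fun w => ψ r w * ψ r' w)
      (g := fun w => φ r w * φ r' w)
      ((hψm r).mul (hψm r')) ((hφm r).mul (hφm r')) hik
    calc _ = ∫ ζ, (a r * a r') * ((ψ r (ζ i) * ψ r' (ζ i)) * (φ r (ζ k) * φ r' (ζ k)))
          ∂(Measure.pi fun _ : Fin n => μ) := by
            congr 1; ext ζ; ring
      _ = _ := by
        rw [integral_const_mul, h1]
        by_cases hr : a r = 0
        · simp [hr]
        by_cases hr' : a r' = 0
        · simp [hr']
        rw [hψc r r' hr hr', hφc r r' hr hr']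
        split_ifs <;> simp
  simp [h]

/-- Second moment of `A φ`, summed over rows, where `A` is the off-diagonal kernel matrix. -/
theorem integral_sum_sq_row_pairKernel
    (hψm : ∀ r, Measurable (ψ r)) (hφm : ∀ r, Measurable (φ r))
    (hψ : ∀ r, MemLp (ψ r) 2 μ) (hφ : ∀ r, MemLp (φ r) 2 μ) (h0 : ∀ r, a r ≠ 0 → ∫ w, φ r w ∂μ = 0)
    (hψc : ∀ r r', a r ≠ 0 → a r' ≠ 0 → ∫ w, ψ r w * ψ r' w ∂μ = if r = r' then 1 else 0)
    (hφc : ∀ r r', a r ≠ 0 → a r' ≠ 0 → ∫ w, φ r w * φ r' w ∂μ = if r = r' then 1 else 0) :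
    ∫ ζ, ∑ i, (∑ k ∈ Finset.univ.erase i, pairKernel a ψ φ ζ i k) ^ 2
      ∂(Measure.pi fun _ : Fin n => μ) ≤ n ^ 2 * ∑ r, a r ^ 2 := by
  have hL : ∀ i : Fin n, ∀ k ∈ Finset.univ.erase i, MemLp (fun ζ => pairKernel a ψ φ ζ i k) 2
      (Measure.pi fun _ : Fin n => μ) := fun i k hk =>
    memLp_pairKernel a two_ne_zero (by simp) hψm hφm hψ hφ (Finset.ne_of_mem_erase hk).symm
  rw [integral_finsetSum _ fun i _ => (memLp_finsetSum _ (hL i)).integrable_sq]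
  have hrow : ∀ i : Fin n, ∫ ζ, (∑ k ∈ Finset.univ.erase i, pairKernel a ψ φ ζ i k) ^ 2
      ∂(Measure.pi fun _ : Fin n => μ) ≤ n * ∑ r, a r ^ 2 := by
    intro i
    rw [integral_sq_sum_of_orthogonal _ _ (hL i)]
    · rw [Finset.sum_congr rfl fun k hk => integral_pairKernel_sq a hψm hφm hψ hφ hψc hφc
        (Finset.ne_of_mem_erase hk).symm, Finset.sum_const, nsmul_eq_mul]
      refine mul_le_mul_of_nonneg_right ?_ (Finset.sum_nonneg fun _ _ => sq_nonneg _)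
      exact_mod_cast (Finset.card_erase_le).trans (by simp)
    -- Within row `i` the index `k` occurs only once, so distinct terms are orthogonal.
    · intro k hk k' hk' hne
      have hk := Finset.ne_of_mem_erase hk
      have hk' := Finset.ne_of_mem_erase hk'
      simp only [pairKernel_swap a ψ φ]
      exact integral_pairKernel_mul_eq_zero a hφm hψm hφm hψm hφ hψ hφ hψ h0 hk hk' hne hk
  calc _ ≤ ∑ _i : Fin n, n * ∑ r, a r ^ 2 := Finset.sum_le_sum fun i _ => hrow i
    _ = _ := by simp; ring

/-- Second moment of `∑_{i ≠ k} K(ζ_i, ζ_k)` for a degenerate symmetric kernel. -/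
theorem integral_sq_sum_pairKernel
    (hφm : ∀ r, Measurable (φ r)) (hφ : ∀ r, MemLp (φ r) 2 μ) (h0 : ∀ r, a r ≠ 0 → ∫ w, φ r w ∂μ = 0)
    (hφc : ∀ r r', a r ≠ 0 → a r' ≠ 0 → ∫ w, φ r w * φ r' w ∂μ = if r = r' then 1 else 0) :
    ∫ ζ, (∑ i, ∑ k ∈ Finset.univ.erase i, pairKernel a φ φ ζ i k) ^ 2
      ∂(Measure.pi fun _ : Fin n => μ) ≤ 4 * n ^ 2 * ∑ r, a r ^ 2 := by
  -- Each unordered pair is counted once, as otherwise `(i, k)` and `(k, i)` would be correlated.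
  -- The doubling gives the factor `4 = 2²`.
  set s : Finset (Fin n × Fin n) := Finset.univ.filter fun x => x.1 < x.2 with hs
  have hsum : ∀ ζ : Fin n → Vec d, ∑ i, ∑ k ∈ Finset.univ.erase i, pairKernel a φ φ ζ i k =
      2 * ∑ x ∈ s, pairKernel a φ φ ζ x.1 x.2 := by
    intro ζ
    have h1 : ∀ i k : Fin n, (if k ≠ i then pairKernel a φ φ ζ i k else 0) =
        (if i < k then pairKernel a φ φ ζ i k else 0) +
        (if k < i then pairKernel a φ φ ζ k i else 0) := by
      intro i k
      rcases lt_trichotomy i k with h | h | h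
      · simp [h, h.ne', h.not_gt]
      · simp [h]
      · simp [h, h.ne, h.not_gt, pairKernel_swap a φ φ ζ i k]
    have h2 : ∀ i : Fin n, ∑ k ∈ Finset.univ.erase i, pairKernel a φ φ ζ i k =
        ∑ k, if k ≠ i then pairKernel a φ φ ζ i k else 0 := by
      intro i
      rw [← Finset.sum_filter]
      exact Finset.sum_congr (by ext; simp) fun _ _ => rfl
    simp only [h2, h1, Finset.sum_add_distrib]
    rw [Finset.sum_comm (f := fun i k => if k < i then pairKernel a φ φ ζ k i else 0), ← two_mul,
      hs, Finset.sum_filter, Fintype.sum_prod_type]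
  have hL : ∀ x ∈ s, MemLp (fun ζ => pairKernel a φ φ ζ x.1 x.2) 2
      (Measure.pi fun _ : Fin n => μ) := fun x hx =>
    memLp_pairKernel a two_ne_zero (by simp) hφm hφm hφ hφ (by
      simp only [hs, Finset.mem_filter] at hx; exact hx.2.ne)
  simp only [hsum, mul_pow]
  rw [integral_const_mul, integral_sq_sum_of_orthogonal _ _ hL]
  · have hT : 0 ≤ ∑ r, a r ^ 2 := Finset.sum_nonneg fun _ _ => sq_nonneg _
    have hcard : (s.card : ℝ) ≤ n ^ 2 := by
      have := Finset.card_le_univ s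
      rw [Fintype.card_prod, Fintype.card_fin] at this
      rw [sq]; exact_mod_cast this
    rw [Finset.sum_congr rfl fun x hx => integral_pairKernel_sq a hφm hφm hφ hφ hφc hφc
      (by simp only [hs, Finset.mem_filter] at hx; exact hx.2.ne), Finset.sum_const, nsmul_eq_mul]
    nlinarith [mul_le_mul_of_nonneg_right hcard hT]
  · rintro ⟨i, k⟩ hx ⟨i', k'⟩ hx' hne
    simp only [hs, Finset.mem_filter, Finset.mem_univ, true_and] at hx hx'
    simp only [ne_eq, Prod.mk.injEq, not_and_or] at hne
    by_cases h : i ≠ i' ∧ i ≠ k'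
    · exact integral_pairKernel_mul_eq_zero a hφm hφm hφm hφm hφ hφ hφ hφ h0 hx.ne hx'.ne
        h.1 h.2
    -- Two distinct increasing pairs share at most one index; if `i` is shared, `k` is not.
    · have hk : k ≠ i' ∧ k ≠ k' := by
        constructor <;> rintro rfl <;> simp_all <;> omega
      simp only [pairKernel_swap a φ φ _ i k]
      exact integral_pairKernel_mul_eq_zero a hφm hφm hφm hφm hφ hφ hφ hφ h0 hx.ne' hx'.ne
        hk.1 hk.2

end PairKernel

/-! ### Fourth moments of the off-diagonal kernel matrix. -/

section FourthMoments

variable {d n : ℕ}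

/-- Moment assumptions on the sphered coordinates, with an explicit bound on fourth moments. -/
structure MomentBounds (μ : Measure (Vec d)) (C : ℝ) : Prop where
  one_le : 1 ≤ C
  memLp_four : ∀ j, MemLp (fun w : Vec d => w j) 4 μ
  mean_zero : ∀ j, ∫ w, w j ∂μ = 0
  cov_eq_one : ∀ j k, ∫ w, w j * w k ∂μ = if j = k then 1 else 0
  moment_two_two : ∀ j₁ j₂ : Fin d, j₁ ≠ j₂ → ∫ w, w j₁ ^ 2 * w j₂ ^ 2 ∂μ = 1
  moment_four : ∀ j₁ j₂ j₃ j₄ : Fin d, j₁ ≠ j₂ → j₁ ≠ j₃ → j₁ ≠ j₄ →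
    ∫ w, w j₁ * w j₂ * w j₃ * w j₄ ∂μ = 0
  fourth_le : ∀ j, ∫ w, w j ^ 4 ∂μ ≤ C

instance holderTriple_four_four_two : ENNReal.HolderTriple 4 4 2 where
  inv_add_inv_eq_inv := by
    have h : (4 : ENNReal)⁻¹ + 4⁻¹ = 2 * 4⁻¹ := (two_mul _).symm
    rw [h, show (4 : ENNReal) = 2 * 2 by norm_num,
      ENNReal.mul_inv (Or.inl two_ne_zero) (Or.inl (by simp)), ← mul_assoc,
      ENNReal.mul_inv_cancel two_ne_zero (by simp), one_mul]

theorem memLp_two_mul_of_four {Ω : Type*} [MeasurableSpace Ω] {P : Measure Ω} {f g : Ω → ℝ}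
    (hf : MemLp f 4 P) (hg : MemLp g 4 P) : MemLp (fun ω => f ω * g ω) 2 P :=
  hg.mul hf

theorem integrable_mul_four {Ω : Type*} [MeasurableSpace Ω] {P : Measure Ω}
    {f₁ f₂ f₃ f₄ : Ω → ℝ} (h₁ : MemLp f₁ 4 P) (h₂ : MemLp f₂ 4 P) (h₃ : MemLp f₃ 4 P)
    (h₄ : MemLp f₄ 4 P) : Integrable (fun ω => f₁ ω * f₂ ω * f₃ ω * f₄ ω) P := by
  refine ((memLp_two_mul_of_four h₁ h₂).integrable_mul (memLp_two_mul_of_four h₃ h₄)).congr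
    (Eventually.of_forall fun ω => ?_)
  simp only [Pi.mul_apply]; ring

theorem integrable_pow_four {Ω : Type*} [MeasurableSpace Ω] {P : Measure Ω} {f : Ω → ℝ}
    (hf : MemLp f 4 P) : Integrable (fun ω => f ω ^ 4) P :=
  (integrable_mul_four hf hf hf hf).congr (Eventually.of_forall fun ω => by ring)

theorem abs_integral_mul_four_le {Ω : Type*} [MeasurableSpace Ω] {P : Measure Ω}
    {f₁ f₂ f₃ f₄ : Ω → ℝ} (h₁ : MemLp f₁ 4 P) (h₂ : MemLp f₂ 4 P) (h₃ : MemLp f₃ 4 P)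
    (h₄ : MemLp f₄ 4 P) {D : ℝ} (b₁ : ∫ ω, f₁ ω ^ 4 ∂P ≤ D) (b₂ : ∫ ω, f₂ ω ^ 4 ∂P ≤ D)
    (b₃ : ∫ ω, f₃ ω ^ 4 ∂P ≤ D) (b₄ : ∫ ω, f₄ ω ^ 4 ∂P ≤ D) :
    |∫ ω, f₁ ω * f₂ ω * f₃ ω * f₄ ω ∂P| ≤ D := by
  have i₁ := integrable_pow_four h₁
  have i₂ := integrable_pow_four h₂
  have i₃ := integrable_pow_four h₃
  have i₄ := integrable_pow_four h₄
  have i12 : Integrable (fun ω => f₁ ω ^ 4 + f₂ ω ^ 4) P := i₁.add i₂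
  have i34 : Integrable (fun ω => f₃ ω ^ 4 + f₄ ω ^ 4) P := i₃.add i₄
  have amgm : ∀ a b c e : ℝ, |a * b * c * e| ≤ 1 / 4 * ((a ^ 4 + b ^ 4) + (c ^ 4 + e ^ 4)) := by
    intro a b c e
    rw [abs_le]
    constructor <;> nlinarith [sq_nonneg (a * b - c * e), sq_nonneg (a * b + c * e),
      sq_nonneg (a ^ 2 - b ^ 2), sq_nonneg (c ^ 2 - e ^ 2)]
  calc _ ≤ ∫ ω, |f₁ ω * f₂ ω * f₃ ω * f₄ ω| ∂P := abs_integral_le_integral_abs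
    _ ≤ ∫ ω, 1 / 4 * ((f₁ ω ^ 4 + f₂ ω ^ 4) + (f₃ ω ^ 4 + f₄ ω ^ 4)) ∂P :=
        integral_mono (integrable_mul_four h₁ h₂ h₃ h₄).abs ((i12.add i34).const_mul _)
          fun ω => amgm _ _ _ _
    _ ≤ D := by
        rw [integral_const_mul, integral_add i12 i34, integral_add i₁ i₂, integral_add i₃ i₄]
        linarith

theorem integral_mul_four_sum {Ω ι : Type*} [MeasurableSpace Ω] [Fintype ι] {P : Measure Ω}
    {f₁ f₂ f₃ f₄ : ι → Ω → ℝ} (h₁ : ∀ r, MemLp (f₁ r) 4 P) (h₂ : ∀ r, MemLp (f₂ r) 4 P)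
    (h₃ : ∀ r, MemLp (f₃ r) 4 P) (h₄ : ∀ r, MemLp (f₄ r) 4 P) :
    ∫ ω, (∑ r, f₁ r ω) * (∑ r, f₂ r ω) * (∑ r, f₃ r ω) * (∑ r, f₄ r ω) ∂P =
      ∑ r₁, ∑ r₂, ∑ r₃, ∑ r₄, ∫ ω, f₁ r₁ ω * f₂ r₂ ω * f₃ r₃ ω * f₄ r₄ ω ∂P := by
  have hexp : ∀ ω, (∑ r, f₁ r ω) * (∑ r, f₂ r ω) * (∑ r, f₃ r ω) * (∑ r, f₄ r ω) =
      ∑ r₁, ∑ r₂, ∑ r₃, ∑ r₄, f₁ r₁ ω * f₂ r₂ ω * f₃ r₃ ω * f₄ r₄ ω := by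
    intro ω
    simp only [← Finset.mul_sum, ← Finset.sum_mul]
  have hI := fun r₁ r₂ r₃ r₄ => integrable_mul_four (h₁ r₁) (h₂ r₂) (h₃ r₃) (h₄ r₄)
  simp only [hexp]
  rw [integral_finsetSum _ fun r₁ _ => integrable_finsetSum _ fun r₂ _ =>
    integrable_finsetSum _ fun r₃ _ => integrable_finsetSum _ fun r₄ _ => hI r₁ r₂ r₃ r₄]
  refine Finset.sum_congr rfl fun r₁ _ => ?_
  rw [integral_finsetSum _ fun r₂ _ =>
    integrable_finsetSum _ fun r₃ _ => integrable_finsetSum _ fun r₄ _ => hI r₁ r₂ r₃ r₄]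
  refine Finset.sum_congr rfl fun r₂ _ => ?_
  rw [integral_finsetSum _ fun r₃ _ => integrable_finsetSum _ fun r₄ _ => hI r₁ r₂ r₃ r₄]
  refine Finset.sum_congr rfl fun r₃ _ => ?_
  rw [integral_finsetSum _ fun r₄ _ => hI r₁ r₂ r₃ r₄]

/-- The coordinate functions on `Vec d`. -/
def coord (r : Fin d) (w : Vec d) : ℝ := w r

theorem measurable_coord (r : Fin d) : Measurable (coord r) :=
  (EuclideanSpace.proj (𝕜 := ℝ) r).continuous.measurable

theorem MomentBounds.abs_moment_le {μ : Measure (Vec d)} {C : ℝ} (hμ : MomentBounds μ C)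
    (j₁ j₂ j₃ j₄ : Fin d) : |∫ w, w j₁ * w j₂ * w j₃ * w j₄ ∂μ| ≤ C :=
  abs_integral_mul_four_le (hμ.memLp_four _) (hμ.memLp_four _) (hμ.memLp_four _)
    (hμ.memLp_four _) (hμ.fourth_le _) (hμ.fourth_le _) (hμ.fourth_le _) (hμ.fourth_le _)

variable {μ : Measure (Vec d)} {C : ℝ}

namespace MomentBounds

/-- A mixed fourth moment vanishes as soon as one index occurs once, so only the three pairings
survive. -/
theorem moment_sq_le (hμ : MomentBounds μ C) (j₁ j₂ j₃ j₄ : Fin d) :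
    (∫ w, w j₁ * w j₂ * w j₃ * w j₄ ∂μ) ^ 2 ≤ C ^ 2 *
      ((if j₁ = j₂ ∧ j₃ = j₄ then 1 else 0) + (if j₁ = j₃ ∧ j₂ = j₄ then 1 else 0) +
        (if j₁ = j₄ ∧ j₂ = j₃ then 1 else 0)) := by
  have hle : (∫ w, w j₁ * w j₂ * w j₃ * w j₄ ∂μ) ^ 2 ≤ C ^ 2 := by
    rw [← sq_abs]; exact pow_le_pow_left₀ (abs_nonneg _) (hμ.abs_moment_le _ _ _ _) 2
  have hC : 0 ≤ C ^ 2 := sq_nonneg C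
  by_cases h12 : j₁ = j₂ ∧ j₃ = j₄
  · rw [if_pos h12]
    refine hle.trans (le_mul_of_one_le_right hC ?_)
    split_ifs <;> norm_num
  by_cases h13 : j₁ = j₃ ∧ j₂ = j₄
  · rw [if_pos h13]
    refine hle.trans (le_mul_of_one_le_right hC ?_)
    split_ifs <;> norm_num
  by_cases h14 : j₁ = j₄ ∧ j₂ = j₃
  · rw [if_pos h14]
    refine hle.trans (le_mul_of_one_le_right hC ?_)
    split_ifs; norm_num
  rw [if_neg h12, if_neg h13, if_neg h14]
  have key : ∫ w, w j₁ * w j₂ * w j₃ * w j₄ ∂μ = 0 := by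
    have m1 := hμ.moment_four j₁ j₂ j₃ j₄
    have m2 := hμ.moment_four j₂ j₁ j₃ j₄
    have m3 := hμ.moment_four j₃ j₁ j₂ j₄
    have m4 := hμ.moment_four j₄ j₁ j₂ j₃
    have e2 : ∫ w, w j₁ * w j₂ * w j₃ * w j₄ ∂μ = ∫ w, w j₂ * w j₁ * w j₃ * w j₄ ∂μ := by
      congr 1; ext w; ring
    have e3 : ∫ w, w j₁ * w j₂ * w j₃ * w j₄ ∂μ = ∫ w, w j₃ * w j₁ * w j₂ * w j₄ ∂μ := by
      congr 1; ext w; ring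
    have e4 : ∫ w, w j₁ * w j₂ * w j₃ * w j₄ ∂μ = ∫ w, w j₄ * w j₁ * w j₂ * w j₃ ∂μ := by
      congr 1; ext w; ring
    by_cases g1 : j₁ ≠ j₂ ∧ j₁ ≠ j₃ ∧ j₁ ≠ j₄
    · exact m1 g1.1 g1.2.1 g1.2.2
    by_cases g2 : j₂ ≠ j₁ ∧ j₂ ≠ j₃ ∧ j₂ ≠ j₄
    · rw [e2]; exact m2 g2.1 g2.2.1 g2.2.2
    by_cases g3 : j₃ ≠ j₁ ∧ j₃ ≠ j₂ ∧ j₃ ≠ j₄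
    · rw [e3]; exact m3 g3.1 g3.2.1 g3.2.2
    by_cases g4 : j₄ ≠ j₁ ∧ j₄ ≠ j₂ ∧ j₄ ≠ j₃
    · rw [e4]; exact m4 g4.1 g4.2.1 g4.2.2
    exfalso
    clear m1 m2 m3 m4 e2 e3 e4 hle
    grind
  rw [key]; simp

variable [IsProbabilityMeasure μ]

theorem memLp_two (hμ : MomentBounds μ C) (r : Fin d) : MemLp (coord r) 2 μ :=
  (hμ.memLp_four r).mono_exponent (by norm_num)

theorem memLp_four_term (hμ : MomentBounds μ C) (a : Fin d → ℝ) {i k : Fin n} (hik : i ≠ k) (r : Fin d) :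
    MemLp (fun ζ : Fin n → Vec d => a r * (coord r (ζ i) * coord r (ζ k))) 4
      (Measure.pi fun _ => μ) :=
  (memLp_pair (by norm_num) (by simp) (hμ.memLp_four r) (hμ.memLp_four r) (measurable_coord r)
    (measurable_coord r) hik).const_mul _

/-- By independence of the two observations each term of the expansion carries the square of a
coordinate moment; each of the three pairings then contributes `C² (∑ a²)²`. -/
theorem integral_pairKernel_pow_four_le (hμ : MomentBounds μ C) {a : Fin d → ℝ} (ha : ∀ r, 0 ≤ a r) {i k : Fin n}
    (hik : i ≠ k) : ∫ ζ, pairKernel a coord coord ζ i k ^ 4 ∂(Measure.pi fun _ : Fin n => μ) ≤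
      3 * C ^ 2 * (∑ r, a r ^ 2) ^ 2 := by
  have h4 := fun r => hμ.memLp_four_term a hik r
  have e : ∀ ζ : Fin n → Vec d, pairKernel a coord coord ζ i k ^ 4 =
      pairKernel a coord coord ζ i k * pairKernel a coord coord ζ i k *
        pairKernel a coord coord ζ i k * pairKernel a coord coord ζ i k := fun ζ => by ring
  rw [funext e]
  simp only [pairKernel]
  rw [integral_mul_four_sum h4 h4 h4 h4]
  have hterm : ∀ r₁ r₂ r₃ r₄ : Fin d, ∫ ζ, a r₁ * (coord r₁ (ζ i) * coord r₁ (ζ k)) *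
      (a r₂ * (coord r₂ (ζ i) * coord r₂ (ζ k))) * (a r₃ * (coord r₃ (ζ i) * coord r₃ (ζ k))) *
      (a r₄ * (coord r₄ (ζ i) * coord r₄ (ζ k))) ∂(Measure.pi fun _ : Fin n => μ) ≤
      (a r₁ * a r₂ * a r₃ * a r₄) * (C ^ 2 *
      ((if r₁ = r₂ ∧ r₃ = r₄ then 1 else 0) + (if r₁ = r₃ ∧ r₂ = r₄ then 1 else 0) +
        (if r₁ = r₄ ∧ r₂ = r₃ then 1 else 0))) := by
    intro r₁ r₂ r₃ r₄
    have hm : Measurable fun w : Vec d => coord r₁ w * coord r₂ w * coord r₃ w * coord r₄ w :=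
      (((measurable_coord _).mul (measurable_coord _)).mul (measurable_coord _)).mul
        (measurable_coord _)
    have h := integral_pair (μ := μ) hm hm hik
    calc _ = (a r₁ * a r₂ * a r₃ * a r₄) * (∫ w, w r₁ * w r₂ * w r₃ * w r₄ ∂μ) ^ 2 := by
          rw [sq]
          refine Eq.trans ?_ (congrArg _ h)
          rw [← integral_const_mul]
          congr 1; ext ζ; ring
      _ ≤ _ := mul_le_mul_of_nonneg_left (hμ.moment_sq_le _ _ _ _)
          (mul_nonneg (mul_nonneg (mul_nonneg (ha _) (ha _)) (ha _)) (ha _))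
  calc _ ≤ ∑ r₁, ∑ r₂, ∑ r₃, ∑ r₄, (a r₁ * a r₂ * a r₃ * a r₄) * (C ^ 2 *
      ((if r₁ = r₂ ∧ r₃ = r₄ then 1 else 0) + (if r₁ = r₃ ∧ r₂ = r₄ then 1 else 0) +
        (if r₁ = r₄ ∧ r₂ = r₃ then 1 else 0))) :=
        Finset.sum_le_sum fun _ _ => Finset.sum_le_sum fun _ _ => Finset.sum_le_sum fun _ _ =>
          Finset.sum_le_sum fun _ _ => hterm _ _ _ _
    _ = _ := by
        have e : ∀ r₁ r₂ r₃ r₄ : Fin d, (a r₁ * a r₂ * a r₃ * a r₄) * (C ^ 2 *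
            ((if r₁ = r₂ ∧ r₃ = r₄ then (1 : ℝ) else 0) + (if r₁ = r₃ ∧ r₂ = r₄ then 1 else 0) +
            (if r₁ = r₄ ∧ r₂ = r₃ then 1 else 0))) =
            (if r₁ = r₂ then if r₃ = r₄ then C ^ 2 * (a r₁ * a r₂ * a r₃ * a r₄) else 0 else 0) +
            (if r₁ = r₃ then if r₂ = r₄ then C ^ 2 * (a r₁ * a r₂ * a r₃ * a r₄) else 0 else 0) +
            (if r₂ = r₃ then if r₁ = r₄ then C ^ 2 * (a r₁ * a r₂ * a r₃ * a r₄) else 0 else 0) := by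
          intro r₁ r₂ r₃ r₄
          simp only [ite_and, mul_add, mul_ite, mul_one, mul_zero]
          congr 1
          · congr 1 <;> split_ifs <;> ring
          · split_ifs <;> ring
        have e3 : ∀ r₁ r₂ : Fin d, C ^ 2 * (a r₁ * a r₂ * a r₂ * a r₁) =
            C ^ 2 * (a r₁ ^ 2 * a r₂ ^ 2) := fun _ _ => by ring
        have e2 : ∀ r₁ r₂ : Fin d, C ^ 2 * (a r₁ * a r₂ * a r₁ * a r₂) =
            C ^ 2 * (a r₁ ^ 2 * a r₂ ^ 2) := fun _ _ => by ring
        have e1 : ∀ r₁ r₂ : Fin d, C ^ 2 * (a r₁ * a r₁ * a r₂ * a r₂) =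
            C ^ 2 * (a r₁ ^ 2 * a r₂ ^ 2) := fun _ _ => by ring
        simp only [e, Finset.sum_add_distrib, Finset.sum_ite_eq, Finset.sum_const_zero,
          Finset.mem_univ, if_true, Finset.sum_ite_irrel, e1, e2, e3]
        simp only [← Finset.mul_sum, ← Finset.sum_mul]
        ring

/-- The product runs around the cycle `i, l, k, l'`. Each of these observations meets two kernels,
so its covariance identifies their coordinates, and a single sum over `r` remains. -/
theorem integral_four_pairKernel (hμ : MomentBounds μ C) {a : Fin d → ℝ} {i k l l' : Fin n} (hik : i ≠ k) (hil : i ≠ l)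
    (hil' : i ≠ l') (hkl : k ≠ l) (hkl' : k ≠ l') (hll' : l ≠ l') :
    ∫ ζ, pairKernel a coord coord ζ i l * pairKernel a coord coord ζ l k *
      pairKernel a coord coord ζ i l' * pairKernel a coord coord ζ l' k
      ∂(Measure.pi fun _ : Fin n => μ) = ∑ r, a r ^ 4 := by
  simp only [pairKernel]
  rw [integral_mul_four_sum (hμ.memLp_four_term a hil) (hμ.memLp_four_term a hkl.symm)
    (hμ.memLp_four_term a hil') (hμ.memLp_four_term a hkl'.symm)]
  have hterm : ∀ r₁ r₂ r₃ r₄ : Fin d, ∫ ζ, a r₁ * (coord r₁ (ζ i) * coord r₁ (ζ l)) *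
      (a r₂ * (coord r₂ (ζ l) * coord r₂ (ζ k))) * (a r₃ * (coord r₃ (ζ i) * coord r₃ (ζ l'))) *
      (a r₄ * (coord r₄ (ζ l') * coord r₄ (ζ k))) ∂(Measure.pi fun _ : Fin n => μ) =
      if r₃ = r₄ then if r₁ = r₃ then if r₁ = r₂ then a r₁ * a r₂ * a r₃ * a r₄ else 0 else 0
        else 0 := by
    intro r₁ r₂ r₃ r₄
    have hm : ∀ r s : Fin d, Measurable fun w : Vec d => coord r w * coord s w :=
      fun r s => (measurable_coord r).mul (measurable_coord s)
    have h := integral_quad (μ := μ) (hm r₁ r₃) (hm r₁ r₂) (hm r₂ r₄) (hm r₃ r₄) hil hik hil'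
      hkl.symm hll' hkl'
    have hc : ∀ r s : Fin d, ∫ w, coord r w * coord s w ∂μ = if r = s then 1 else 0 :=
      hμ.cov_eq_one
    rw [hc, hc, hc, hc] at h
    calc _ = (a r₁ * a r₂ * a r₃ * a r₄) * ((if r₁ = r₃ then 1 else 0) *
        (if r₁ = r₂ then 1 else 0) * (if r₂ = r₄ then 1 else 0) * (if r₃ = r₄ then 1 else 0)) := by
          rw [← h, ← integral_const_mul]
          congr 1; ext ζ; ring
      _ = _ := by
          split_ifs <;> simp_all
  simp only [hterm, Finset.sum_ite_eq, Finset.mem_univ, if_true]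
  refine Finset.sum_congr rfl fun r _ => ?_
  ring

end MomentBounds

/-- The off-diagonal part of the kernel matrix `(∑_r a_r ζ_ir ζ_kr)_{ik}`. -/
def offKernel (a : Fin d → ℝ) (ζ : Fin n → Vec d) (i k : Fin n) : ℝ :=
  if i = k then 0 else pairKernel a coord coord ζ i k

theorem offKernel_swap (a : Fin d → ℝ) (ζ : Fin n → Vec d) (i k : Fin n) :
    offKernel a ζ i k = offKernel a ζ k i := by
  simp only [offKernel, eq_comm (a := i), pairKernel_swap a coord coord ζ i k]

namespace MomentBounds

variable [IsProbabilityMeasure μ]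

theorem memLp_offKernel (hμ : MomentBounds μ C) (a : Fin d → ℝ) (i k : Fin n) :
    MemLp (fun ζ => offKernel a ζ i k) 4 (Measure.pi fun _ : Fin n => μ) := by
  by_cases h : i = k
  · simp only [offKernel, if_pos h]; exact MemLp.zero'
  · simp only [offKernel, if_neg h]
    exact memLp_pairKernel a (by norm_num) (by simp) measurable_coord measurable_coord
      hμ.memLp_four hμ.memLp_four h

theorem integral_offKernel_pow_four_le (hμ : MomentBounds μ C) {a : Fin d → ℝ} (ha : ∀ r, 0 ≤ a r) (i k : Fin n) :
    ∫ ζ, offKernel a ζ i k ^ 4 ∂(Measure.pi fun _ : Fin n => μ) ≤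
      3 * C ^ 2 * (∑ r, a r ^ 2) ^ 2 := by
  by_cases h : i = k
  · simp only [offKernel, if_pos h]; simp; positivity
  · simp only [offKernel, if_neg h]; exact hμ.integral_pairKernel_pow_four_le ha h

/-- When `i = k` or `l = l'` the cycle degenerates and the fourth moment bound is used; any other
coincidence hits the zero diagonal. -/
theorem integral_four_offKernel_le (hμ : MomentBounds μ C) {a : Fin d → ℝ} (ha : ∀ r, 0 ≤ a r) (i k l l' : Fin n) :
    ∫ ζ, offKernel a ζ i l * offKernel a ζ l k * offKernel a ζ i l' * offKernel a ζ l' k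
      ∂(Measure.pi fun _ : Fin n => μ) ≤ ∑ r, a r ^ 4 +
        (if i = k then 3 * C ^ 2 * (∑ r, a r ^ 2) ^ 2 else 0) +
        (if l = l' then 3 * C ^ 2 * (∑ r, a r ^ 2) ^ 2 else 0) := by
  have h0 : 0 ≤ ∑ r, a r ^ 4 := Finset.sum_nonneg fun r _ => by positivity
  have hT : 0 ≤ 3 * C ^ 2 * (∑ r, a r ^ 2) ^ 2 := by positivity
  by_cases h : i = k ∨ l = l'
  · refine (le_abs_self _).trans ((abs_integral_mul_four_le (hμ.memLp_offKernel a _ _)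
      (hμ.memLp_offKernel a _ _) (hμ.memLp_offKernel a _ _) (hμ.memLp_offKernel a _ _)
      (hμ.integral_offKernel_pow_four_le ha _ _) (hμ.integral_offKernel_pow_four_le ha _ _)
      (hμ.integral_offKernel_pow_four_le ha _ _)
      (hμ.integral_offKernel_pow_four_le ha _ _)).trans ?_)
    rcases h with h | h
    · rw [if_pos h]; split_ifs <;> linarith
    · rw [if_pos h]; split_ifs <;> linarith
  · rw [not_or] at h
    rw [if_neg h.1, if_neg h.2, add_zero, add_zero]
    by_cases hd : i = l ∨ l = k ∨ i = l' ∨ l' = k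
    · have hz : ∀ ζ : Fin n → Vec d, offKernel a ζ i l * offKernel a ζ l k * offKernel a ζ i l' *
          offKernel a ζ l' k = 0 := by
        intro ζ
        rcases hd with hd | hd | hd | hd <;> simp [offKernel, hd]
      simpa only [hz, integral_zero] using h0
    · simp only [not_or] at hd
      simp only [offKernel, if_neg hd.1, if_neg hd.2.1, if_neg hd.2.2.1, if_neg hd.2.2.2]
      exact (hμ.integral_four_pairKernel h.1 hd.1 hd.2.2.1 (Ne.symm hd.2.1) (Ne.symm hd.2.2.2)
        h.2).le

/-- The `n⁴` generic cycles cost only `∑ a⁴`, which is negligible against `(∑ a²)²` under the noise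
condition; the larger bound applies to the two degenerate families, of `n³` terms each. -/
theorem integral_frobenius_sq_le (hμ : MomentBounds μ C) {a : Fin d → ℝ} (ha : ∀ r, 0 ≤ a r) :
    ∫ ζ, ∑ i, ∑ k, (∑ l, offKernel a ζ i l * offKernel a ζ l k) ^ 2
      ∂(Measure.pi fun _ : Fin n => μ) ≤
      n ^ 4 * ∑ r, a r ^ 4 + 6 * C ^ 2 * n ^ 3 * (∑ r, a r ^ 2) ^ 2 := by
  have hI : ∀ i k l l' : Fin n, Integrable (fun ζ => offKernel a ζ i l * offKernel a ζ l k *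
      offKernel a ζ i l' * offKernel a ζ l' k) (Measure.pi fun _ : Fin n => μ) :=
    fun i k l l' => integrable_mul_four (hμ.memLp_offKernel a _ _)
      (hμ.memLp_offKernel a _ _) (hμ.memLp_offKernel a _ _) (hμ.memLp_offKernel a _ _)
  have e : ∀ (ζ : Fin n → Vec d) (i k : Fin n),
      (∑ l, offKernel a ζ i l * offKernel a ζ l k) ^ 2 =
      ∑ l, ∑ l', offKernel a ζ i l * offKernel a ζ l k * offKernel a ζ i l' *
        offKernel a ζ l' k := by
    intro ζ i k
    rw [sq, Finset.sum_mul_sum]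
    exact Finset.sum_congr rfl fun l _ => Finset.sum_congr rfl fun l' _ => by ring
  simp only [e]
  rw [integral_finsetSum _ fun i _ => integrable_finsetSum _ fun k _ => integrable_finsetSum _
    fun l _ => integrable_finsetSum _ fun l' _ => hI i k l l']
  have h1 : ∀ i k : Fin n, ∫ ζ, ∑ l, ∑ l', offKernel a ζ i l * offKernel a ζ l k *
      offKernel a ζ i l' * offKernel a ζ l' k ∂(Measure.pi fun _ : Fin n => μ) =
      ∑ l, ∑ l', ∫ ζ, offKernel a ζ i l * offKernel a ζ l k *
      offKernel a ζ i l' * offKernel a ζ l' k ∂(Measure.pi fun _ : Fin n => μ) := by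
    intro i k
    rw [integral_finsetSum _ fun l _ => integrable_finsetSum _ fun l' _ => hI i k l l']
    exact Finset.sum_congr rfl fun l _ => integral_finsetSum _ fun l' _ => hI i k l l'
  calc _ = ∑ i, ∑ k, ∑ l, ∑ l', ∫ ζ, offKernel a ζ i l * offKernel a ζ l k *
      offKernel a ζ i l' * offKernel a ζ l' k ∂(Measure.pi fun _ : Fin n => μ) := by
        refine Finset.sum_congr rfl fun i _ => ?_
        rw [integral_finsetSum _ fun k _ => integrable_finsetSum _
          fun l _ => integrable_finsetSum _ fun l' _ => hI i k l l']
        exact Finset.sum_congr rfl fun k _ => h1 i k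
    _ ≤ ∑ i : Fin n, ∑ k : Fin n, ∑ l : Fin n, ∑ l' : Fin n, (∑ r, a r ^ 4 +
        (if i = k then 3 * C ^ 2 * (∑ r, a r ^ 2) ^ 2 else 0) +
        (if l = l' then 3 * C ^ 2 * (∑ r, a r ^ 2) ^ 2 else 0)) :=
        Finset.sum_le_sum fun _ _ => Finset.sum_le_sum fun _ _ => Finset.sum_le_sum fun _ _ =>
          Finset.sum_le_sum fun _ _ => hμ.integral_four_offKernel_le ha _ _ _ _
    _ = _ := by
        simp only [Finset.sum_add_distrib, Finset.sum_const, Finset.card_univ, Fintype.card_fin,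
          nsmul_eq_mul, Finset.sum_ite_eq, Finset.mem_univ, if_true, ← Finset.mul_sum]
        ring

end MomentBounds
end FourthMoments

/-! ### Nonnegative variables with bounded mean, and Markov's inequality. -/

section MeanBounds

/-- `f` is nonnegative and integrable, with mean at most `c`. -/
structure MeanLE {Ω : Type*} [MeasurableSpace Ω] (P : Measure Ω) (f : Ω → ℝ) (c : ℝ) : Prop where
  nonneg : ∀ ω, 0 ≤ f ω
  integrable : Integrable f P
  integral_le : ∫ ω, f ω ∂P ≤ c

namespace MeanLE

variable {Ω : Type*} [MeasurableSpace Ω] {P : Measure Ω} {f g : Ω → ℝ} {b c : ℝ}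

theorem add (hf : MeanLE P f b) (hg : MeanLE P g c) : MeanLE P (fun ω => f ω + g ω) (b + c) where
  nonneg ω := add_nonneg (hf.nonneg ω) (hg.nonneg ω)
  integrable := hf.integrable.add hg.integrable
  integral_le := by
    rw [integral_add hf.integrable hg.integrable]
    exact add_le_add hf.integral_le hg.integral_le

theorem sum {ι : Type*} {s : Finset ι} {F : ι → Ω → ℝ} (hF : ∀ k ∈ s, MeanLE P (F k) c) :
    MeanLE P (fun ω => ∑ k ∈ s, F k ω) (s.card * c) where
  nonneg ω := Finset.sum_nonneg fun k hk => (hF k hk).nonneg ω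
  integrable := integrable_finsetSum _ fun k hk => (hF k hk).integrable
  integral_le := by
    rw [integral_finsetSum _ fun k hk => (hF k hk).integrable, ← nsmul_eq_mul]
    exact Finset.sum_le_card_nsmul _ _ _ fun k hk => (hF k hk).integral_le

theorem div (hf : MeanLE P f b) {t : ℝ} (ht : 0 < t) (hb : b ≤ t * c) :
    MeanLE P (fun ω => f ω / t) c where
  nonneg ω := div_nonneg (hf.nonneg ω) ht.le
  integrable := hf.integrable.div_const t
  integral_le := by
    rw [integral_div, div_le_iff₀ ht]
    linarith [hf.integral_le]

theorem measure_lt_le (hf : MeanLE P f c) {L : ℝ} (hL : 0 < L) [IsFiniteMeasure P] :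
    P {ω | L < f ω} ≤ ENNReal.ofReal (c / L) := by
  have h := mul_meas_ge_le_integral_of_nonneg (Eventually.of_forall hf.nonneg) hf.integrable L
  have h1 : P.real {ω | L ≤ f ω} ≤ c / L := by
    rw [le_div_iff₀ hL, mul_comm]; exact h.trans hf.integral_le
  calc P {ω | L < f ω} ≤ P {ω | L ≤ f ω} := measure_mono fun _ hω => (Set.mem_ofPred.1 hω).le
    _ = ENNReal.ofReal (P.real {ω | L ≤ f ω}) := (ofReal_measureReal).symm
    _ ≤ _ := ENNReal.ofReal_le_ofReal h1

end MeanLE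
end MeanBounds

/-! ### Mean bounds for the individual fluctuations. -/

section Statistics

variable {d n : ℕ}

/-- The centred diagonal of the noise part of the dual covariance matrix. -/
def diagDev (a : Fin d → ℝ) (w : Vec d) : ℝ := ∑ r, a r * (w r ^ 2 - 1)

/-- The coordinates multiplied by a fixed coordinate. -/
def coordMul (s r : Fin d) (w : Vec d) : ℝ := coord r w * coord s w

theorem measurable_coordMul (s r : Fin d) : Measurable (coordMul s r) :=
  (measurable_coord r).mul (measurable_coord s)

theorem measurable_diagDev (a : Fin d → ℝ) : Measurable (diagDev a) :=
  Finset.measurable_sum _ fun r _ => (((measurable_coord r).pow_const 2).sub_const 1).const_mul _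

variable {μ : Measure (Vec d)} {C : ℝ}

namespace MomentBounds

theorem memLp_coordMul (hμ : MomentBounds μ C) (s r : Fin d) : MemLp (coordMul s r) 2 μ :=
  memLp_two_mul_of_four (hμ.memLp_four r) (hμ.memLp_four s)

/-- The moment conditions make the functions `z_r z_s` orthonormal in `r ≠ s`, so the kernel
estimates apply to `A z_s` and `z_sᵀ A z_s` as they do to `A 1`. -/
theorem integral_coordMul_mul (hμ : MomentBounds μ C) {s r r' : Fin d} (hr : r ≠ s)
    (hr' : r' ≠ s) : ∫ w, coordMul s r w * coordMul s r' w ∂μ = if r = r' then 1 else 0 := by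
  split_ifs with h
  · subst h
    rw [← hμ.moment_two_two r s hr]
    congr 1; ext w; simp only [coordMul, coord]; ring
  · rw [← hμ.moment_four r s r' s hr h hr]
    congr 1; ext w; simp only [coordMul, coord]; ring

theorem integral_sq_eq_one (hμ : MomentBounds μ C) (j : Fin d) : ∫ w, w j ^ 2 ∂μ = 1 := by
  have h := hμ.cov_eq_one j j
  rw [if_pos rfl] at h
  rw [← h]; congr 1; ext w; ring

variable [IsProbabilityMeasure μ]

theorem integral_sq_sub_mul (hμ : MomentBounds μ C) (r r' : Fin d) :
    ∫ w, (w r ^ 2 - 1) * (w r' ^ 2 - 1) ∂μ ≤ if r = r' then C else 0 := by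
  have i1 : Integrable (fun w : Vec d => w r ^ 2 * w r' ^ 2) μ :=
    (integrable_mul_four (hμ.memLp_four r) (hμ.memLp_four r) (hμ.memLp_four r')
      (hμ.memLp_four r')).congr (Eventually.of_forall fun w => by ring)
  have i2 : ∀ r, Integrable (fun w : Vec d => w r ^ 2) μ := fun r => (hμ.memLp_two r).integrable_sq
  have h : ∫ w, (w r ^ 2 - 1) * (w r' ^ 2 - 1) ∂μ = ∫ w, w r ^ 2 * w r' ^ 2 ∂μ - 1 := by
    have e : ∀ w : Vec d, (w r ^ 2 - 1) * (w r' ^ 2 - 1) =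
        w r ^ 2 * w r' ^ 2 - w r ^ 2 - w r' ^ 2 + 1 := fun w => by ring
    simp only [e]
    have i3 : Integrable (fun w : Vec d => w r ^ 2 * w r' ^ 2 - w r ^ 2) μ := i1.sub (i2 r)
    have i4 : Integrable (fun w : Vec d => w r ^ 2 * w r' ^ 2 - w r ^ 2 - w r' ^ 2) μ :=
      i3.sub (i2 r')
    rw [integral_add i4 (integrable_const _), integral_sub i3 (i2 r'), integral_sub i1 (i2 r), hμ.integral_sq_eq_one,
      hμ.integral_sq_eq_one]
    simp
  rw [h]
  split_ifs with hr
  · subst hr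
    have : ∫ w : Vec d, w r ^ 2 * w r ^ 2 ∂μ ≤ C := by
      refine le_trans (le_of_eq ?_) (hμ.fourth_le r)
      congr 1; ext w; ring
    linarith
  · rw [hμ.moment_two_two r r' hr, sub_self]

theorem meanLE_sum_coord (hμ : MomentBounds μ C) (s : Fin d) :
    MeanLE (Measure.pi fun _ : Fin n => μ) (fun ζ => (∑ i, ζ i s) ^ 2) n where
  nonneg _ := sq_nonneg _
  integrable := (memLp_finsetSum (f := fun (i : Fin n) (ζ : Fin n → Vec d) => coord s (ζ i)) _
    fun i _ => memLp_eval (hμ.memLp_two s) i).integrable_sq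
  integral_le := by
    have h := integral_sq_sum_eval (n := n) (measurable_coord s) (hμ.memLp_two s) (hμ.mean_zero s)
    have h2 : ∫ w, coord s w ^ 2 ∂μ = 1 := hμ.integral_sq_eq_one s
    rw [h2, mul_one] at h
    exact h.le

theorem meanLE_gram (hμ : MomentBounds μ C) (s t : Fin d) :
    MeanLE (Measure.pi fun _ : Fin n => μ)
      (fun ζ => (∑ i, (ζ i s * ζ i t - if s = t then 1 else 0)) ^ 2) (n * C) := by
  set f : Vec d → ℝ := fun w => coordMul t s w - if s = t then 1 else 0 with hf
  have hfm : Measurable f := (measurable_coordMul t s).sub_const _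
  have hf2 : MemLp f 2 μ := (hμ.memLp_coordMul t s).sub (memLp_const _)
  have hst : ∫ w, coordMul t s w ∂μ = if s = t then 1 else 0 := hμ.cov_eq_one s t
  have hi : Integrable (coordMul t s) μ := (hμ.memLp_coordMul t s).integrable (by norm_num)
  have h0 : ∫ w, f w ∂μ = 0 := by
    rw [hf, integral_sub hi (integrable_const _), hst]; simp
  refine ⟨fun _ => sq_nonneg _, (memLp_finsetSum (f := fun (i : Fin n) (ζ : Fin n → Vec d) =>
    f (ζ i)) _ fun i _ => memLp_eval hf2 i).integrable_sq, ?_⟩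
  have h := integral_sq_sum_eval (n := n) hfm hf2 h0
  refine h.le.trans (mul_le_mul_of_nonneg_left ?_ (Nat.cast_nonneg n))
  have i1 := (hμ.memLp_coordMul t s).integrable_sq
  have e : ∀ w, f w ^ 2 = coordMul t s w ^ 2 - 2 * (if s = t then 1 else 0) * coordMul t s w +
      (if s = t then 1 else 0) ^ 2 := fun w => by simp only [hf]; ring
  have h4 : ∫ w, coordMul t s w ^ 2 ∂μ ≤ C := by
    refine (le_abs_self _).trans (le_trans (le_of_eq ?_) (hμ.abs_moment_le s t s t))
    congr 2; ext w; simp only [coordMul, coord]; ring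
  simp only [e]
  have i2 : Integrable (fun w => coordMul t s w ^ 2 -
      2 * (if s = t then 1 else 0) * coordMul t s w) μ := i1.sub (hi.const_mul _)
  rw [integral_add i2 (integrable_const _), integral_sub i1 (hi.const_mul _), integral_const_mul, hst]
  split_ifs <;> simp <;> linarith

theorem meanLE_fourth (hμ : MomentBounds μ C) (s : Fin d) :
    MeanLE (Measure.pi fun _ : Fin n => μ) (fun ζ => ∑ i, ζ i s ^ 4) (n * C) := by
  have h : ∀ i ∈ (Finset.univ : Finset (Fin n)), MeanLE (Measure.pi fun _ : Fin n => μ)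
      (fun ζ => ζ i s ^ 4) C := fun i _ =>
    { nonneg := fun ζ => by positivity
      integrable := integrable_pow_four (memLp_eval (hμ.memLp_four s) i)
      integral_le :=
        (integral_eval (μ := μ) ((measurable_coord s).pow_const 4) i).le.trans (hμ.fourth_le s) }
  simpa using MeanLE.sum h

theorem memLp_diagDev (hμ : MomentBounds μ C) (a : Fin d → ℝ) : MemLp (diagDev a) 2 μ :=
  memLp_finsetSum _ fun r _ => (((memLp_two_mul_of_four (hμ.memLp_four r)
    (hμ.memLp_four r)).sub (memLp_const 1)).const_mul (a r)).congr_norm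
    ((((measurable_coord r).pow_const 2).sub_const 1).const_mul _).aestronglyMeasurable
    (Eventually.of_forall fun w => by simp [sq])

/-- The squares of distinct coordinates are uncorrelated, so the bound involves `∑ a²` and not `(∑
a)²`. -/
theorem integral_diagDev_sq_le (hμ : MomentBounds μ C) {a : Fin d → ℝ} (ha : ∀ r, 0 ≤ a r) :
    ∫ w, diagDev a w ^ 2 ∂μ ≤ C * ∑ r, a r ^ 2 := by
  have hL : ∀ r, MemLp (fun w : Vec d => w r ^ 2 - 1) 2 μ := fun r =>
    ((memLp_two_mul_of_four (hμ.memLp_four r) (hμ.memLp_four r)).sub (memLp_const 1)).congr_norm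
      ((((measurable_coord r).pow_const 2).sub_const 1)).aestronglyMeasurable
      (Eventually.of_forall fun w => by simp [sq])
  have hI : ∀ r r', Integrable (fun w : Vec d => a r * (w r ^ 2 - 1) * (a r' * (w r' ^ 2 - 1))) μ :=
    fun r r' => ((hL r).const_mul _).integrable_mul ((hL r').const_mul _)
  simp only [diagDev, sq (∑ r, _), Finset.sum_mul_sum]
  rw [integral_finsetSum _ fun r _ => integrable_finsetSum _ fun r' _ => hI r r', Finset.mul_sum]
  refine Finset.sum_le_sum fun r _ => ?_
  rw [integral_finsetSum _ fun r' _ => hI r r']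
  calc _ ≤ ∑ r', if r = r' then a r * a r' * C else 0 := by
        refine Finset.sum_le_sum fun r' _ => ?_
        calc _ = a r * a r' * ∫ w, (w r ^ 2 - 1) * (w r' ^ 2 - 1) ∂μ := by
              rw [← integral_const_mul]; congr 1; ext w; ring
          _ ≤ a r * a r' * if r = r' then C else 0 :=
              mul_le_mul_of_nonneg_left (hμ.integral_sq_sub_mul r r') (mul_nonneg (ha r) (ha r'))
          _ = _ := by split_ifs <;> simp
    _ = _ := by simp; ring

theorem meanLE_diagDev (hμ : MomentBounds μ C) {a : Fin d → ℝ} (ha : ∀ r, 0 ≤ a r) :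
    MeanLE (Measure.pi fun _ : Fin n => μ) (fun ζ => ∑ i, diagDev a (ζ i) ^ 2)
      (n * (C * ∑ r, a r ^ 2)) := by
  have h : ∀ i ∈ (Finset.univ : Finset (Fin n)), MeanLE (Measure.pi fun _ : Fin n => μ)
      (fun ζ => diagDev a (ζ i) ^ 2) (C * ∑ r, a r ^ 2) := fun i _ =>
    { nonneg := fun ζ => sq_nonneg _
      integrable := (memLp_eval (hμ.memLp_diagDev a) i).integrable_sq
      integral_le := (integral_eval (μ := μ) ((measurable_diagDev a).pow_const 2) i).le.trans
        (hμ.integral_diagDev_sq_le ha) }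
  simpa using MeanLE.sum h

theorem meanLE_row_coordMul (hμ : MomentBounds μ C) (a : Fin d → ℝ) {s : Fin d} (hs : a s = 0) :
    MeanLE (Measure.pi fun _ : Fin n => μ) (fun ζ => ∑ i, (∑ k ∈ Finset.univ.erase i,
      pairKernel a coord (coordMul s) ζ i k) ^ 2) (n ^ 2 * ∑ r, a r ^ 2) where
  nonneg _ := Finset.sum_nonneg fun _ _ => sq_nonneg _
  integrable := integrable_finsetSum _ fun i _ => (memLp_finsetSum _ fun k hk =>
    memLp_pairKernel a two_ne_zero (by simp) measurable_coord (measurable_coordMul s)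
      hμ.memLp_two (hμ.memLp_coordMul s) (Finset.ne_of_mem_erase hk).symm).integrable_sq
  integral_le := integral_sum_sq_row_pairKernel a measurable_coord (measurable_coordMul s)
    hμ.memLp_two (hμ.memLp_coordMul s)
    (fun r hr => (hμ.cov_eq_one r s).trans (if_neg fun h : r = s => hr (h ▸ hs)))
    (fun r r' _ _ => hμ.cov_eq_one r r')
    (fun r r' hr hr' => hμ.integral_coordMul_mul (fun h : r = s => hr (h ▸ hs))
      (fun h : r' = s => hr' (h ▸ hs)))

theorem meanLE_row_coord (hμ : MomentBounds μ C) (a : Fin d → ℝ) :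
    MeanLE (Measure.pi fun _ : Fin n => μ) (fun ζ => ∑ i, (∑ k ∈ Finset.univ.erase i,
      pairKernel a coord coord ζ i k) ^ 2) (n ^ 2 * ∑ r, a r ^ 2) where
  nonneg _ := Finset.sum_nonneg fun _ _ => sq_nonneg _
  integrable := integrable_finsetSum _ fun i _ => (memLp_finsetSum _ fun k hk =>
    memLp_pairKernel a two_ne_zero (by simp) measurable_coord measurable_coord
      hμ.memLp_two hμ.memLp_two (Finset.ne_of_mem_erase hk).symm).integrable_sq
  integral_le := integral_sum_sq_row_pairKernel a measurable_coord measurable_coord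
    hμ.memLp_two hμ.memLp_two (fun r _ => hμ.mean_zero r)
    (fun r r' _ _ => hμ.cov_eq_one r r') (fun r r' _ _ => hμ.cov_eq_one r r')

theorem meanLE_quad_coordMul (hμ : MomentBounds μ C) (a : Fin d → ℝ) {s : Fin d} (hs : a s = 0) :
    MeanLE (Measure.pi fun _ : Fin n => μ) (fun ζ => (∑ i, ∑ k ∈ Finset.univ.erase i,
      pairKernel a (coordMul s) (coordMul s) ζ i k) ^ 2) (4 * n ^ 2 * ∑ r, a r ^ 2) where
  nonneg _ := sq_nonneg _
  integrable := (memLp_finsetSum _ fun i _ => memLp_finsetSum _ fun k hk =>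
    memLp_pairKernel a two_ne_zero (by simp) (measurable_coordMul s) (measurable_coordMul s)
      (hμ.memLp_coordMul s) (hμ.memLp_coordMul s) (Finset.ne_of_mem_erase hk).symm).integrable_sq
  integral_le := integral_sq_sum_pairKernel a (measurable_coordMul s) (hμ.memLp_coordMul s)
    (fun r hr => (hμ.cov_eq_one r s).trans (if_neg fun h : r = s => hr (h ▸ hs)))
    (fun r r' hr hr' => hμ.integral_coordMul_mul (fun h : r = s => hr (h ▸ hs))
      (fun h : r' = s => hr' (h ▸ hs)))

theorem meanLE_frobenius (hμ : MomentBounds μ C) {a : Fin d → ℝ} (ha : ∀ r, 0 ≤ a r) :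
    MeanLE (Measure.pi fun _ : Fin n => μ)
      (fun ζ => ∑ i, ∑ k, (∑ l, offKernel a ζ i l * offKernel a ζ l k) ^ 2)
      (n ^ 4 * ∑ r, a r ^ 4 + 6 * C ^ 2 * n ^ 3 * (∑ r, a r ^ 2) ^ 2) where
  nonneg _ := Finset.sum_nonneg fun _ _ => Finset.sum_nonneg fun _ _ => sq_nonneg _
  integrable := integrable_finsetSum _ fun i _ => integrable_finsetSum _ fun k _ =>
    (memLp_finsetSum _ fun l _ => memLp_two_mul_of_four (hμ.memLp_offKernel a i l)
      (hμ.memLp_offKernel a l k)).integrable_sq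
  integral_le := hμ.integral_frobenius_sq_le ha

end MomentBounds
end Statistics

/-! ### One statistic controlling all fluctuations that need a rate. -/

section SpikeStat

variable {d n : ℕ}

/-- The sum of the normalized squared fluctuations that control the principal components. -/
def spikeStat (J : Finset (Fin d)) (a : Fin d → ℝ) (ζ : Fin n → Vec d) : ℝ :=
  ∑ s ∈ J, (∑ i, ζ i s) ^ 2 / n +
  ∑ s ∈ J, ∑ t ∈ J, (∑ i, (ζ i s * ζ i t - if s = t then 1 else 0)) ^ 2 / n +
  ∑ s ∈ J, (∑ i, ζ i s ^ 4) / n +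
  (∑ i, diagDev a (ζ i) ^ 2) / (n * ∑ r, a r ^ 2) +
  ∑ s ∈ J, (∑ i, (∑ k ∈ Finset.univ.erase i, pairKernel a coord (coordMul s) ζ i k) ^ 2) /
    (n ^ 2 * ∑ r, a r ^ 2) +
  (∑ i, (∑ k ∈ Finset.univ.erase i, pairKernel a coord coord ζ i k) ^ 2) /
    (n ^ 2 * ∑ r, a r ^ 2) +
  ∑ s ∈ J, (∑ i, ∑ k ∈ Finset.univ.erase i, pairKernel a (coordMul s) (coordMul s) ζ i k) ^ 2 /
    (n ^ 2 * ∑ r, a r ^ 2)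

/-- A bound on the mean of `spikeStat`. -/
def spikeStatBound (m : ℕ) (C : ℝ) : ℝ :=
  m * 1 + m * (m * C) + m * C + C + m * 1 + 1 + m * 4

theorem MomentBounds.meanLE_spikeStat {μ : Measure (Vec d)} [IsProbabilityMeasure μ] {C : ℝ}
    (hμ : MomentBounds μ C) (J : Finset (Fin d)) {a : Fin d → ℝ} (ha : ∀ r, 0 ≤ a r)
    (haJ : ∀ s ∈ J, a s = 0) (hn : 0 < n) (hT : 0 < ∑ r, a r ^ 2) :
    MeanLE (Measure.pi fun _ : Fin n => μ) (spikeStat J a) (spikeStatBound J.card C) := by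
  have hn' : (0 : ℝ) < n := by exact_mod_cast hn
  have hn2 : (0 : ℝ) < n ^ 2 * ∑ r, a r ^ 2 := by positivity
  refine ((((((MeanLE.sum fun s _ => ?_).add (MeanLE.sum fun s _ => MeanLE.sum fun t _ => ?_)).add
    (MeanLE.sum fun s _ => ?_)).add ?_).add (MeanLE.sum fun s hs => ?_)).add ?_).add
    (MeanLE.sum fun s hs => ?_)
  · exact (hμ.meanLE_sum_coord s).div hn' (by simp)
  · exact (hμ.meanLE_gram s t).div hn' le_rfl
  · exact (hμ.meanLE_fourth s).div hn' le_rfl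
  · exact (hμ.meanLE_diagDev ha).div (by positivity) (by linarith)
  · exact (hμ.meanLE_row_coordMul a (haJ s hs)).div hn2 (by simp)
  · exact (hμ.meanLE_row_coord a).div hn2 (by simp)
  · exact (hμ.meanLE_quad_coordMul a (haJ s hs)).div hn2 (by linarith)

/-- The bounds on the data that hold when `spikeStat` is at most `L ^ 2`. -/
structure SpikeEvent (J : Finset (Fin d)) (a : Fin d → ℝ) (ζ : Fin n → Vec d) (L τ : ℝ) :
    Prop where
  sum_coord : ∀ s ∈ J, |∑ i, ζ i s| ≤ L * √n
  gram : ∀ s ∈ J, ∀ t ∈ J, |∑ i, (ζ i s * ζ i t - if s = t then 1 else 0)| ≤ L * √n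
  fourth : ∀ s ∈ J, ∑ i, ζ i s ^ 4 ≤ L ^ 2 * n
  diag : ∑ i, diagDev a (ζ i) ^ 2 ≤ (L * √n * τ) ^ 2
  row_coordMul : ∀ s ∈ J, ∑ i, (∑ k ∈ Finset.univ.erase i,
    pairKernel a coord (coordMul s) ζ i k) ^ 2 ≤ (L * n * τ) ^ 2
  row_coord : ∑ i, (∑ k ∈ Finset.univ.erase i, pairKernel a coord coord ζ i k) ^ 2 ≤
    (L * n * τ) ^ 2
  quad : ∀ s ∈ J, |∑ i, ∑ k ∈ Finset.univ.erase i,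
    pairKernel a (coordMul s) (coordMul s) ζ i k| ≤ L * n * τ

/-- All summands are nonnegative, so each is at most the total; a single use of Markov's inequality
thus yields all the bounds at once. -/
theorem spikeEvent_of_spikeStat_le {J : Finset (Fin d)} {a : Fin d → ℝ} {ζ : Fin n → Vec d}
    {L τ : ℝ} (hL : 0 ≤ L) (hn : 0 < n) (hτ : 0 < τ) (hT : ∑ r, a r ^ 2 = τ ^ 2)
    (h : spikeStat J a ζ ≤ L ^ 2) : SpikeEvent J a ζ L τ := by
  have hn' : (0 : ℝ) < n := by exact_mod_cast hn
  have hsn : √(n : ℝ) ^ 2 = n := Real.sq_sqrt hn'.le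
  have hT0 : 0 < ∑ r, a r ^ 2 := by rw [hT]; positivity
  have hn2 : (0 : ℝ) < n ^ 2 * ∑ r, a r ^ 2 := by positivity
  unfold spikeStat at h
  set F1 : Fin d → ℝ := fun s => (∑ i, ζ i s) ^ 2 / n with hF1
  set F2 : Fin d → Fin d → ℝ :=
    fun s t => (∑ i, (ζ i s * ζ i t - if s = t then 1 else 0)) ^ 2 / n with hF2
  set F3 : Fin d → ℝ := fun s => (∑ i, ζ i s ^ 4) / n with hF3
  set F4 : ℝ := (∑ i, diagDev a (ζ i) ^ 2) / (n * ∑ r, a r ^ 2) with hF4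
  set F5 : Fin d → ℝ := fun s => (∑ i, (∑ k ∈ Finset.univ.erase i,
    pairKernel a coord (coordMul s) ζ i k) ^ 2) / (n ^ 2 * ∑ r, a r ^ 2) with hF5
  set F6 : ℝ := (∑ i, (∑ k ∈ Finset.univ.erase i, pairKernel a coord coord ζ i k) ^ 2) /
    (n ^ 2 * ∑ r, a r ^ 2) with hF6
  set F7 : Fin d → ℝ := fun s => (∑ i, ∑ k ∈ Finset.univ.erase i,
    pairKernel a (coordMul s) (coordMul s) ζ i k) ^ 2 / (n ^ 2 * ∑ r, a r ^ 2) with hF7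
  have p1 : ∀ s ∈ J, 0 ≤ F1 s := fun s _ => by positivity
  have p2 : ∀ s ∈ J, ∀ t ∈ J, 0 ≤ F2 s t := fun s _ t _ => by positivity
  have p3 : ∀ s ∈ J, 0 ≤ F3 s := fun s _ => by positivity
  have p4 : 0 ≤ F4 := by positivity
  have p5 : ∀ s ∈ J, 0 ≤ F5 s := fun s _ => by positivity
  have p6 : 0 ≤ F6 := by positivity
  have p7 : ∀ s ∈ J, 0 ≤ F7 s := fun s _ => by positivity
  have q1 := Finset.sum_nonneg p1
  have q2 := Finset.sum_nonneg fun s hs => Finset.sum_nonneg (p2 s hs)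
  have q3 := Finset.sum_nonneg p3
  have q5 := Finset.sum_nonneg p5
  have q7 := Finset.sum_nonneg p7
  have s1 : ∀ s ∈ J, F1 s ≤ L ^ 2 := fun s hs => by
    linarith [Finset.single_le_sum p1 hs]
  have s2 : ∀ s ∈ J, ∀ t ∈ J, F2 s t ≤ L ^ 2 := fun s hs t ht => by
    have h1 := Finset.single_le_sum (f := fun s => ∑ t ∈ J, F2 s t)
      (fun s hs => Finset.sum_nonneg (p2 s hs)) hs
    have h2 := Finset.single_le_sum (p2 s hs) ht
    linarith
  have s3 : ∀ s ∈ J, F3 s ≤ L ^ 2 := fun s hs => by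
    linarith [Finset.single_le_sum p3 hs]
  have s4 : F4 ≤ L ^ 2 := by linarith
  have s5 : ∀ s ∈ J, F5 s ≤ L ^ 2 := fun s hs => by
    linarith [Finset.single_le_sum p5 hs]
  have s6 : F6 ≤ L ^ 2 := by linarith
  have s7 : ∀ s ∈ J, F7 s ≤ L ^ 2 := fun s hs => by
    linarith [Finset.single_le_sum p7 hs]
  have e1 : L ^ 2 * n = (L * √n) ^ 2 := by rw [mul_pow, hsn]
  have e2 : L ^ 2 * (n ^ 2 * ∑ r, a r ^ 2) = (L * n * τ) ^ 2 := by rw [hT]; ring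
  have e3 : L ^ 2 * (n * ∑ r, a r ^ 2) = (L * √n * τ) ^ 2 := by
    rw [hT, mul_pow, mul_pow, hsn]; ring
  refine ⟨fun s hs => ?_, fun s hs t ht => ?_, fun s hs => ?_, ?_, fun s hs => ?_, ?_,
    fun s hs => ?_⟩
  · have := (div_le_iff₀ hn').1 (s1 s hs)
    rw [e1] at this
    exact abs_le_of_sq_le_sq this (by positivity)
  · have := (div_le_iff₀ hn').1 (s2 s hs t ht)
    rw [e1] at this
    exact abs_le_of_sq_le_sq this (by positivity)
  · exact (div_le_iff₀ hn').1 (s3 s hs)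
  · rw [← e3]; exact (div_le_iff₀ (by positivity)).1 s4
  · rw [← e2]; exact (div_le_iff₀ hn2).1 (s5 s hs)
  · rw [← e2]; exact (div_le_iff₀ hn2).1 s6
  · have := (div_le_iff₀ hn2).1 (s7 s hs)
    rw [e2] at this
    exact abs_le_of_sq_le_sq this (by positivity)

end SpikeStat

/-! ### The noise deviation on mean-zero vectors as a kernel matrix. -/

section DualNoise

variable {d n : ℕ}

/-- The operator of the off-diagonal kernel matrix. -/
def offOp (a : Fin d → ℝ) (ζ : Fin n → Vec d) : Vec n →ₗ[ℝ] Vec n :=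
  Matrix.toEuclideanLin (Matrix.of (offKernel a ζ))

theorem offOp_apply (a : Fin d → ℝ) (ζ : Fin n → Vec d) (w : Vec n) (i : Fin n) :
    offOp a ζ w i = ∑ k, offKernel a ζ i k * w k := rfl

theorem vec_inner (x y : Vec n) : inner ℝ x y = ∑ i, x i * y i := by
  simp [PiLp.inner_apply, mul_comm]

theorem vec_norm_sq (x : Vec n) : ‖x‖ ^ 2 = ∑ i, x i ^ 2 := EuclideanSpace.real_norm_sq_eq x

theorem offOp_symm (a : Fin d → ℝ) (ζ : Fin n → Vec d) (x y : Vec n) :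
    inner ℝ (offOp a ζ x) y = inner ℝ x (offOp a ζ y) := by
  simp only [vec_inner, offOp_apply, Finset.sum_mul, Finset.mul_sum]
  rw [Finset.sum_comm]
  refine Finset.sum_congr rfl fun i _ => Finset.sum_congr rfl fun k _ => ?_
  rw [offKernel_swap a ζ k i]; ring

/-- By symmetry `‖A w‖² = ⟪w, A² w⟫`, so the operator norm is at most `‖A²‖_F^(1/2)`. The Frobenius
norm of `A` itself would be too crude: its second-moment bound is of the full order `nτ`, with
nothing small to gain. -/
theorem norm_offOp_le {a : Fin d → ℝ} {ζ : Fin n → Vec d} {θ : ℝ} (hθ : 0 ≤ θ)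
    (h : ∑ i, ∑ k, (∑ l, offKernel a ζ i l * offKernel a ζ l k) ^ 2 ≤ θ ^ 4) (w : Vec n) :
    ‖offOp a ζ w‖ ≤ θ * ‖w‖ := by
  have h1 : ‖offOp a ζ (offOp a ζ w)‖ ^ 2 ≤ (θ ^ 2 * ‖w‖) ^ 2 := by
    have h2 : ∀ i, offOp a ζ (offOp a ζ w) i =
        ∑ k, (∑ l, offKernel a ζ i l * offKernel a ζ l k) * w k := by
      intro i
      simp only [offOp_apply, Finset.mul_sum, Finset.sum_mul]
      rw [Finset.sum_comm]
      exact Finset.sum_congr rfl fun k _ => Finset.sum_congr rfl fun l _ => by ring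
    calc ‖offOp a ζ (offOp a ζ w)‖ ^ 2
        = ∑ i, (∑ k, (∑ l, offKernel a ζ i l * offKernel a ζ l k) * w k) ^ 2 := by
          rw [vec_norm_sq]; exact Finset.sum_congr rfl fun i _ => by rw [h2]
      _ ≤ ∑ i, (∑ k, (∑ l, offKernel a ζ i l * offKernel a ζ l k) ^ 2) * ∑ k, w k ^ 2 :=
          Finset.sum_le_sum fun i _ => Finset.sum_mul_sq_le_sq_mul_sq _ _ _
      _ = (∑ i, ∑ k, (∑ l, offKernel a ζ i l * offKernel a ζ l k) ^ 2) * ‖w‖ ^ 2 := by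
          rw [← Finset.sum_mul, vec_norm_sq]
      _ ≤ θ ^ 4 * ‖w‖ ^ 2 := mul_le_mul_of_nonneg_right h (sq_nonneg _)
      _ = _ := by ring
  have h3 : ‖offOp a ζ (offOp a ζ w)‖ ≤ θ ^ 2 * ‖w‖ :=
    abs_le_of_sq_le_sq' h1 (by positivity) |>.2
  have h4 : ‖offOp a ζ w‖ ^ 2 ≤ (θ * ‖w‖) ^ 2 := by
    rw [← real_inner_self_eq_norm_sq, offOp_symm]
    refine (real_inner_le_norm _ _).trans ?_
    nlinarith [mul_le_mul_of_nonneg_left h3 (norm_nonneg w)]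
  exact abs_le_of_sq_le_sq' h4 (by positivity) |>.2

/-- The vector of ones. -/
def ones (n : ℕ) : Vec n := WithLp.toLp 2 fun _ => 1

/-- The vectors whose entries sum to zero. -/
def meanZero (n : ℕ) : Submodule ℝ (Vec n) := LinearMap.ker (innerₗ (Vec n) (ones n))

theorem mem_meanZero {w : Vec n} : w ∈ meanZero n ↔ inner ℝ (ones n) w = 0 := Iff.rfl

theorem inner_ones (w : Vec n) : inner ℝ (ones n) w = ∑ i, w i := by
  simp [vec_inner, ones]

theorem norm_ones : ‖ones n‖ = √n := by
  rw [← Real.sqrt_sq (norm_nonneg (ones n)), vec_norm_sq]; simp [ones]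

/-- The `s`-th row of the sphered data matrix. -/
def dataRow (ζ : Fin n → Vec d) (s : Fin d) : Vec n := WithLp.toLp 2 fun i => ζ i s

/-- The centred and normalized `s`-th row of the sphered data matrix. -/
def dualVec (ζ : Fin n → Vec d) (s : Fin d) : Vec n :=
  (√((n : ℝ) - 1))⁻¹ • (dataRow ζ s - ((∑ i, ζ i s) / n) • ones n)

theorem inner_ones_dataRow (ζ : Fin n → Vec d) (s : Fin d) :
    inner ℝ (ones n) (dataRow ζ s) = ∑ i, ζ i s := inner_ones _

theorem inner_ones_self : inner ℝ (ones n) (ones n) = (n : ℝ) := by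
  rw [inner_ones]; simp [ones]

theorem dualVec_mem (hn : 0 < n) (ζ : Fin n → Vec d) (s : Fin d) : dualVec ζ s ∈ meanZero n := by
  have hn' : (n : ℝ) ≠ 0 := by exact_mod_cast hn.ne'
  rw [mem_meanZero, dualVec, inner_smul_right, inner_sub_right, inner_smul_right,
    inner_ones_dataRow, inner_ones_self, div_mul_cancel₀ _ hn', sub_self, mul_zero]

theorem inner_dualVec {ζ : Fin n → Vec d} {s : Fin d} {w : Vec n} (hw : w ∈ meanZero n) :
    inner ℝ (dualVec ζ s) w = (√((n : ℝ) - 1))⁻¹ * inner ℝ (dataRow ζ s) w := by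
  rw [dualVec, inner_smul_left, inner_sub_left, inner_smul_left, mem_meanZero.1 hw]
  simp

theorem inner_dualVec_dualVec (hn : 2 ≤ n) (ζ : Fin n → Vec d) (s t : Fin d) :
    inner ℝ (dualVec ζ s) (dualVec ζ t) =
      ((n : ℝ) - 1)⁻¹ * (∑ i, ζ i s * ζ i t - (∑ i, ζ i s) * (∑ i, ζ i t) / n) := by
  have hn' : (2 : ℝ) ≤ n := by exact_mod_cast hn
  rw [inner_dualVec (dualVec_mem (by omega) ζ t), dualVec, inner_smul_right, inner_sub_right,
    inner_smul_right, real_inner_comm, real_inner_comm (ones n), inner_ones_dataRow, vec_inner,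
    ← mul_assoc, ← mul_inv, Real.mul_self_sqrt (by linarith)]
  congr 2
  · exact Finset.sum_congr rfl fun i _ => by simp [dataRow, mul_comm]
  · ring

/-- On mean-zero vectors, `noiseDev` is the quadratic form of the uncentred kernel matrix. -/
theorem inner_noiseDev_eq (hn : 2 ≤ n) (m : ℕ) (lam : Fin d → ℝ) {a : Fin d → ℝ}
    (ha : ∀ r, a r = if m ≤ r.val then lam r else 0) {δ : ℝ}
    (hδ : δ = (∑ r with m ≤ r.val, lam r) / ((n : ℝ) - 1)) (ζ : Fin n → Vec d) {x w : Vec n}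
    (hx : x ∈ meanZero n) (hw : w ∈ meanZero n) :
    inner ℝ x (noiseDev m lam (dualVec ζ) δ w) =
      ((n : ℝ) - 1)⁻¹ * (inner ℝ x (offOp a ζ w) + ∑ i, diagDev a (ζ i) * (x i * w i)) := by
  have hn' : (2 : ℝ) ≤ n := by exact_mod_cast hn
  have hsum : ∀ f : Fin d → ℝ, ∑ r with m ≤ r.val, lam r * f r = ∑ r, a r * f r := by
    intro f
    rw [Finset.sum_filter]
    exact Finset.sum_congr rfl fun r _ => by rw [ha]; split_ifs <;> simp
  have hsum1 : ∑ r with m ≤ r.val, lam r = ∑ r, a r := by simpa using hsum fun _ => 1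
  rw [inner_noiseDev, hδ, hsum1]
  simp only [inner_dualVec hx, inner_dualVec hw, mul_assoc]
  rw [hsum]
  have hoff : inner ℝ x (offOp a ζ w) = ∑ r, a r * (inner ℝ (dataRow ζ r) w *
      inner ℝ (dataRow ζ r) x) - ∑ i, (∑ r, a r * ζ i r ^ 2) * (x i * w i) := by
    have h1 : ∀ i k, offKernel a ζ i k = ∑ r, a r * (ζ i r * ζ k r) -
        if i = k then ∑ r, a r * ζ i r ^ 2 else 0 := by
      intro i k
      unfold offKernel pairKernel coord
      split_ifs with hik
      · subst hik; simp [sq]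
      · simp
    rw [vec_inner]
    simp only [offOp_apply, h1, sub_mul, Finset.sum_sub_distrib, mul_sub, ite_mul, zero_mul,
      Finset.sum_ite_eq, Finset.mem_univ, if_true]
    congr 1
    · simp only [vec_inner, dataRow, Finset.mul_sum, Finset.sum_mul]
      rw [Finset.sum_comm]
      calc _ = ∑ k, ∑ r, ∑ i, x i * (a r * (ζ i r * ζ k r) * w k) :=
            Finset.sum_congr rfl fun k _ => Finset.sum_comm
        _ = ∑ r, ∑ k, ∑ i, x i * (a r * (ζ i r * ζ k r) * w k) := Finset.sum_comm
        _ = ∑ r, ∑ i, ∑ k, x i * (a r * (ζ i r * ζ k r) * w k) :=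
            Finset.sum_congr rfl fun r _ => Finset.sum_comm
        _ = _ := Finset.sum_congr rfl fun r _ => Finset.sum_congr rfl fun i _ =>
            Finset.sum_congr rfl fun k _ => by ring
    · exact Finset.sum_congr rfl fun i _ => by ring
  -- The mean `∑ a_r` of the diagonal, divided by `n - 1`, is exactly `δ`; this is why `δ` is the
  -- right shift.
  have hdiag : ∑ i, diagDev a (ζ i) * (x i * w i) =
      ∑ i, (∑ r, a r * ζ i r ^ 2) * (x i * w i) - (∑ r, a r) * inner ℝ w x := by
    rw [vec_inner, Finset.mul_sum, ← Finset.sum_sub_distrib]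
    refine Finset.sum_congr rfl fun i _ => ?_
    simp only [diagDev, mul_sub, mul_one, Finset.sum_sub_distrib]
    ring
  have hs : (√((n : ℝ) - 1))⁻¹ * (√((n : ℝ) - 1))⁻¹ = ((n : ℝ) - 1)⁻¹ := by
    rw [← mul_inv, Real.mul_self_sqrt (by linarith)]
  rw [hoff, hdiag]
  have h2 : ∑ r, a r * ((√((n : ℝ) - 1))⁻¹ * (inner ℝ (dataRow ζ r) w *
      ((√((n : ℝ) - 1))⁻¹ * inner ℝ (dataRow ζ r) x))) =
      ((n : ℝ) - 1)⁻¹ * ∑ r, a r * (inner ℝ (dataRow ζ r) w * inner ℝ (dataRow ζ r) x) := by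
    rw [Finset.mul_sum]
    refine Finset.sum_congr rfl fun r _ => ?_
    rw [← hs]; ring
  rw [h2]
  ring

theorem noiseDev_mem (hn : 0 < n) (m : ℕ) (lam : Fin d → ℝ) (δ : ℝ) (ζ : Fin n → Vec d)
    {w : Vec n} (hw : w ∈ meanZero n) : noiseDev m lam (dualVec ζ) δ w ∈ meanZero n := by
  rw [noiseDev_apply]
  exact Submodule.sub_mem _ (Submodule.sum_mem _ fun s _ =>
    Submodule.smul_mem _ _ (dualVec_mem hn ζ s)) (Submodule.smul_mem _ _ hw)

theorem norm_noiseDev_le (hn : 2 ≤ n) (m : ℕ) (lam : Fin d → ℝ) {a : Fin d → ℝ}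
    (ha : ∀ r, a r = if m ≤ r.val then lam r else 0) {δ : ℝ}
    (hδ : δ = (∑ r with m ≤ r.val, lam r) / ((n : ℝ) - 1)) (ζ : Fin n → Vec d) {w : Vec n}
    (hw : w ∈ meanZero n) {β : ℝ} (hβ : 0 ≤ β) (hD : ∑ i, diagDev a (ζ i) ^ 2 ≤ β ^ 2) :
    ‖noiseDev m lam (dualVec ζ) δ w‖ ≤ ((n : ℝ) - 1)⁻¹ * (‖offOp a ζ w‖ + β * ‖w‖) := by
  have hn' : (2 : ℝ) ≤ n := by exact_mod_cast hn
  set x := noiseDev m lam (dualVec ζ) δ w with hx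
  -- The kernel formula is only available as a form on mean-zero vectors, so the image is tested
  -- against itself, which is legitimate because it is mean-zero too.
  have hxU : x ∈ meanZero n := noiseDev_mem (by omega) m lam δ ζ hw
  have h1 : ‖x‖ ^ 2 = ((n : ℝ) - 1)⁻¹ *
      (inner ℝ x (offOp a ζ w) + ∑ i, diagDev a (ζ i) * (x i * w i)) := by
    rw [← real_inner_self_eq_norm_sq]
    nth_rw 2 [hx]
    exact inner_noiseDev_eq hn m lam ha hδ ζ hxU hw
  have hDi : ∀ i, |diagDev a (ζ i)| ≤ β := fun i =>
    abs_le_of_sq_le_sq ((Finset.single_le_sum (f := fun i => diagDev a (ζ i) ^ 2)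
      (fun _ _ => sq_nonneg _) (Finset.mem_univ i)).trans hD) hβ
  have h2 : ∑ i, diagDev a (ζ i) * (x i * w i) ≤ β * (‖x‖ * ‖w‖) := by
    have h3 : ∑ i, |x i| * |w i| ≤ ‖x‖ * ‖w‖ := by
      have h4 : (∑ i, |x i| * |w i|) ^ 2 ≤ (‖x‖ * ‖w‖) ^ 2 := by
        refine (Finset.sum_mul_sq_le_sq_mul_sq _ _ _).trans ?_
        simp only [sq_abs, mul_pow, vec_norm_sq, le_refl]
      exact abs_le_of_sq_le_sq' h4 (by positivity) |>.2
    refine le_trans ?_ (mul_le_mul_of_nonneg_left h3 hβ)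
    rw [Finset.mul_sum]
    refine Finset.sum_le_sum fun i _ => (le_abs_self _).trans ?_
    rw [abs_mul, abs_mul]
    exact mul_le_mul_of_nonneg_right (hDi i) (by positivity)
  have h5 : ‖x‖ ^ 2 ≤ ‖x‖ * (((n : ℝ) - 1)⁻¹ * (‖offOp a ζ w‖ + β * ‖w‖)) := by
    rw [h1]
    calc _ ≤ ((n : ℝ) - 1)⁻¹ * (‖x‖ * ‖offOp a ζ w‖ + β * (‖x‖ * ‖w‖)) :=
          mul_le_mul_of_nonneg_left (add_le_add (real_inner_le_norm _ _) h2)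
            (inv_nonneg.2 (by linarith))
      _ = _ := by ring
  rcases (norm_nonneg x).eq_or_lt with h | h
  · rw [← h]
    exact mul_nonneg (inv_nonneg.2 (by linarith)) (by positivity)
  · rw [sq] at h5; exact le_of_mul_le_mul_left h5 h

end DualNoise

/-! ### Consequences of the fluctuation bounds for the dual directions. -/

section EventBounds

variable {d n : ℕ} {J : Finset (Fin d)} {a : Fin d → ℝ} {ζ : Fin n → Vec d} {L τ : ℝ}

theorem inv_pred_le (hn : 2 ≤ n) : ((n : ℝ) - 1)⁻¹ ≤ 2 / n := by
  have hn' : (2 : ℝ) ≤ n := by exact_mod_cast hn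
  rw [inv_le_comm₀ (by linarith) (by positivity), inv_div]
  linarith

theorem inv_sqrt_pred_le (hn : 2 ≤ n) : (√((n : ℝ) - 1))⁻¹ ≤ 3 / 2 / √n := by
  have hn' : (2 : ℝ) ≤ n := by exact_mod_cast hn
  have h1 : (√((n : ℝ) - 1))⁻¹ ^ 2 ≤ (3 / 2 / √n) ^ 2 := by
    rw [inv_pow, Real.sq_sqrt (by linarith), div_pow, Real.sq_sqrt (by linarith)]
    refine (inv_pred_le hn).trans ?_
    gcongr; norm_num
  exact abs_le_of_sq_le_sq' h1 (by positivity) |>.2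

namespace SpikeEvent

theorem gram_le (h : SpikeEvent J a ζ L τ) (hn : 2 ≤ n) (hL : 1 ≤ L) {s t : Fin d}
    (hs : s ∈ J) (ht : t ∈ J) :
    |inner ℝ (dualVec ζ s) (dualVec ζ t) - (if s = t then 1 else 0)| ≤ 6 * L ^ 2 / √n := by
  have hn' : (2 : ℝ) ≤ n := by exact_mod_cast hn
  set y := √(n : ℝ) with hy
  have hy2 : y ^ 2 = n := Real.sq_sqrt (by linarith)
  have hy1 : 1 ≤ y := by rw [hy, Real.one_le_sqrt]; linarith
  have hg := h.gram s hs t ht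
  have h1 : |(∑ i, ζ i s) * (∑ i, ζ i t) / n| ≤ L ^ 2 := by
    rw [abs_div, abs_mul, abs_of_pos (by linarith : (0 : ℝ) < n), div_le_iff₀ (by linarith)]
    calc _ ≤ (L * y) * (L * y) :=
          mul_le_mul (h.sum_coord s hs) (h.sum_coord t ht) (abs_nonneg _) (by positivity)
      _ = _ := by rw [← hy2]; ring
  set c : ℝ := if s = t then 1 else 0 with hc
  have hc1 : |c| ≤ 1 := by rw [hc]; split_ifs <;> simp
  rw [Finset.sum_sub_distrib, Finset.sum_const, Finset.card_univ, Fintype.card_fin,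
    nsmul_eq_mul] at hg
  have h2 : inner ℝ (dualVec ζ s) (dualVec ζ t) - c = ((n : ℝ) - 1)⁻¹ *
      (c + (∑ i, ζ i s * ζ i t - n * c) - (∑ i, ζ i s) * (∑ i, ζ i t) / n) := by
    rw [inner_dualVec_dualVec hn]
    have : (n : ℝ) - 1 ≠ 0 := by linarith
    field_simp
    ring
  rw [h2, abs_mul, abs_of_pos (inv_pos.2 (by linarith))]
  calc _ ≤ 2 / n * (1 + L * y + L ^ 2) := by
        refine mul_le_mul (inv_pred_le hn) ((abs_sub _ _).trans (add_le_add
          ((abs_add_le _ _).trans (add_le_add hc1 hg)) h1)) (abs_nonneg _) (by positivity)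
    _ ≤ 6 * L ^ 2 / y := by
        rw [← hy2, div_mul_eq_mul_div, div_le_div_iff₀ (by positivity) (by positivity)]
        have h3 : 1 + L * y + L ^ 2 ≤ 3 * L ^ 2 * y := by
          nlinarith [mul_nonneg (sub_nonneg.2 hL) (sub_nonneg.2 hy1),
            mul_nonneg (sq_nonneg L) (sub_nonneg.2 hy1)]
        nlinarith [mul_le_mul_of_nonneg_right h3 (by positivity : 0 ≤ y)]

theorem norm_offOp_dataRow (h : SpikeEvent J a ζ L τ) (hL : 0 ≤ L) (hτ : 0 ≤ τ) {s : Fin d}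
    (hs : s ∈ J) : ‖offOp a ζ (dataRow ζ s)‖ ≤ L * n * τ := by
  refine abs_le_of_sq_le_sq' (le_trans (le_of_eq ?_) (h.row_coordMul s hs))
    (by positivity) |>.2
  rw [vec_norm_sq]
  refine Finset.sum_congr rfl fun i _ => ?_
  rw [offOp_apply, ← Finset.sum_erase (a := i) _ (by simp [offKernel])]
  congr 1
  refine Finset.sum_congr rfl fun k hk => ?_
  rw [offKernel, if_neg (Finset.ne_of_mem_erase hk).symm, pairKernel, pairKernel, Finset.sum_mul]
  exact Finset.sum_congr rfl fun r _ => by simp only [dataRow, coordMul, coord]; ring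

theorem norm_offOp_ones (h : SpikeEvent J a ζ L τ) (hL : 0 ≤ L) (hτ : 0 ≤ τ) :
    ‖offOp a ζ (ones n)‖ ≤ L * n * τ := by
  refine abs_le_of_sq_le_sq' (le_trans (le_of_eq ?_) h.row_coord) (by positivity) |>.2
  rw [vec_norm_sq]
  refine Finset.sum_congr rfl fun i _ => ?_
  rw [offOp_apply, ← Finset.sum_erase (a := i) _ (by simp [offKernel])]
  congr 1
  refine Finset.sum_congr rfl fun k hk => ?_
  rw [offKernel, if_neg (Finset.ne_of_mem_erase hk).symm]
  simp [ones]

theorem abs_inner_offOp_dataRow (h : SpikeEvent J a ζ L τ) {s : Fin d} (hs : s ∈ J) :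
    |inner ℝ (dataRow ζ s) (offOp a ζ (dataRow ζ s))| ≤ L * n * τ := by
  refine le_trans (le_of_eq ?_) (h.quad s hs)
  rw [vec_inner]
  congr 1
  refine Finset.sum_congr rfl fun i _ => ?_
  rw [offOp_apply, ← Finset.sum_erase (a := i) _ (by simp [offKernel]), Finset.mul_sum]
  refine Finset.sum_congr rfl fun k hk => ?_
  rw [offKernel, if_neg (Finset.ne_of_mem_erase hk).symm, pairKernel, pairKernel, Finset.sum_mul,
    Finset.mul_sum]
  exact Finset.sum_congr rfl fun r _ => by simp only [dataRow, coordMul, coord]; ring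

theorem abs_mean_le (h : SpikeEvent J a ζ L τ) (hn : 0 < n) {s : Fin d} (hs : s ∈ J) :
    |(∑ i, ζ i s) / n| ≤ L / √n := by
  have hn' : (0 : ℝ) < n := by exact_mod_cast hn
  rw [abs_div, abs_of_pos hn', div_le_div_iff₀ hn' (by positivity)]
  calc _ ≤ L * √n * √n := mul_le_mul_of_nonneg_right (h.sum_coord s hs) (by positivity)
    _ = _ := by rw [mul_assoc, Real.mul_self_sqrt hn'.le]

variable {m : ℕ} {lam : Fin d → ℝ} {δ : ℝ}

theorem norm_noiseDev_le_of_frobenius (h : SpikeEvent J a ζ L τ) (hn : 2 ≤ n) (hL : 1 ≤ L)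
    (hτ : 0 < τ) (ha : ∀ r, a r = if m ≤ r.val then lam r else 0)
    (hδ : δ = (∑ r with m ≤ r.val, lam r) / ((n : ℝ) - 1)) {η : ℝ} (hη : 0 ≤ η)
    (hF : ∑ i, ∑ k, (∑ l, offKernel a ζ i l * offKernel a ζ l k) ^ 2 ≤ (η * n * τ) ^ 4)
    {w : Vec n} (hw : w ∈ meanZero n) :
    ‖noiseDev m lam (dualVec ζ) δ w‖ ≤ 2 * (η + L / √n) * τ * ‖w‖ := by
  have hn' : (2 : ℝ) ≤ n := by exact_mod_cast hn
  set y := √(n : ℝ) with hy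
  have hy2 : y ^ 2 = n := Real.sq_sqrt (by linarith)
  have hy0 : 0 < y := by rw [hy]; positivity
  refine (norm_noiseDev_le hn m lam ha hδ ζ hw (by positivity) h.diag).trans ?_
  calc _ ≤ 2 / n * (η * n * τ * ‖w‖ + L * y * τ * ‖w‖) :=
        mul_le_mul (inv_pred_le hn) (add_le_add_left (norm_offOp_le (by positivity) hF w) _)
          (by positivity) (by positivity)
    _ = _ := by rw [← hy2]; field_simp

/-- The row estimates gain `n^(-1/2)` over the generic operator bound. The sample mean enters only
through `|mean| ≤ L`, since `A 1` is no larger than `A z_s`. -/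
theorem norm_noiseDev_dualVec_le (h : SpikeEvent J a ζ L τ) (hn : 2 ≤ n) (hL : 1 ≤ L)
    (hτ : 0 < τ) (ha : ∀ r, a r = if m ≤ r.val then lam r else 0)
    (hδ : δ = (∑ r with m ≤ r.val, lam r) / ((n : ℝ) - 1)) {s : Fin d} (hs : s ∈ J)
    (hv : ‖dualVec ζ s‖ ≤ 2) :
    ‖noiseDev m lam (dualVec ζ) δ (dualVec ζ s)‖ ≤ 10 * L ^ 2 * τ / √n := by
  have hn' : (2 : ℝ) ≤ n := by exact_mod_cast hn
  set y := √(n : ℝ) with hy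
  have hy2 : y ^ 2 = n := Real.sq_sqrt (by linarith)
  have hy1 : 1 ≤ y := by rw [hy, Real.one_le_sqrt]; linarith
  have hy0 : 0 < y := by linarith
  have hmean : |(∑ i, ζ i s) / n| ≤ L :=
    (h.abs_mean_le (by omega) hs).trans (div_le_self (by linarith) hy1)
  have h1 : ‖offOp a ζ (dualVec ζ s)‖ ≤ 3 / 2 / y * (L * n * τ + L * (L * n * τ)) := by
    rw [dualVec, map_smul, map_sub, map_smul, norm_smul, Real.norm_eq_abs,
      abs_of_nonneg (by positivity)]
    refine mul_le_mul (inv_sqrt_pred_le hn) ((norm_sub_le _ _).trans (add_le_add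
      (h.norm_offOp_dataRow (by linarith) hτ.le hs) ?_)) (norm_nonneg _) (by positivity)
    rw [norm_smul, Real.norm_eq_abs]
    exact mul_le_mul hmean (h.norm_offOp_ones (by linarith) hτ.le) (norm_nonneg _) (by linarith)
  refine (norm_noiseDev_le hn m lam ha hδ ζ (dualVec_mem (by omega) ζ s) (by positivity)
    h.diag).trans ?_
  calc _ ≤ 2 / n * (3 / 2 / y * (L * n * τ + L * (L * n * τ)) + L * y * τ * 2) := by
        refine mul_le_mul (inv_pred_le hn) (add_le_add h1
          (mul_le_mul_of_nonneg_left hv (by positivity))) (by positivity) (by positivity)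
    _ = (7 * L + 3 * L ^ 2) * τ / y := by rw [← hy2]; field_simp; ring
    _ ≤ _ := by gcongr; nlinarith

/-- Order `1/n` cannot come from Cauchy–Schwarz and the norm bound; it needs the degenerate double
sum for `z_sᵀ A z_s` and fourth powers for the diagonal. -/
theorem abs_inner_noiseDev_dualVec_le (h : SpikeEvent J a ζ L τ) (hn : 2 ≤ n) (hL : 1 ≤ L)
    (hτ : 0 < τ) (ha : ∀ r, a r = if m ≤ r.val then lam r else 0)
    (hδ : δ = (∑ r with m ≤ r.val, lam r) / ((n : ℝ) - 1)) {s : Fin d} (hs : s ∈ J) :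
    |inner ℝ (dualVec ζ s) (noiseDev m lam (dualVec ζ) δ (dualVec ζ s))| ≤
      32 * L ^ 3 * τ / n := by
  have hn' : (2 : ℝ) ≤ n := by exact_mod_cast hn
  set y := √(n : ℝ) with hy
  have hy2 : y ^ 2 = n := Real.sq_sqrt (by linarith)
  have hy1 : 1 ≤ y := by rw [hy, Real.one_le_sqrt]; linarith
  have hy0 : 0 < y := by linarith
  have hmem := dualVec_mem (by omega) ζ s
  set b : ℝ := (∑ i, ζ i s) / n with hb
  have hmean : |b| ≤ L / y := h.abs_mean_le (by omega) hs
  set q := dataRow ζ s with hq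
  have hs2 : (√((n : ℝ) - 1))⁻¹ * (√((n : ℝ) - 1))⁻¹ = ((n : ℝ) - 1)⁻¹ := by
    rw [← mul_inv, Real.mul_self_sqrt (by linarith)]
  have hL0 : 0 ≤ L := by linarith
  have hinv := inv_pred_le hn
  have hinv0 : 0 ≤ ((n : ℝ) - 1)⁻¹ := inv_nonneg.2 (by linarith)
  have hsq : ((n : ℝ) - 1)⁻¹ * ((n : ℝ) - 1)⁻¹ ≤ 2 / n * (2 / n) :=
    mul_le_mul hinv hinv hinv0 (by positivity)
  have hoff : inner ℝ (dualVec ζ s) (offOp a ζ (dualVec ζ s)) = ((n : ℝ) - 1)⁻¹ *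
      (inner ℝ q (offOp a ζ q) - 2 * b * inner ℝ (ones n) (offOp a ζ q) +
        b ^ 2 * inner ℝ (ones n) (offOp a ζ (ones n))) := by
    have h1 : inner ℝ q (offOp a ζ (ones n)) = inner ℝ (ones n) (offOp a ζ q) := by
      rw [← offOp_symm, real_inner_comm]
    rw [dualVec, map_smul, map_sub, map_smul, inner_smul_left, inner_smul_right, ← mul_assoc,
      conj_trivial, hs2]
    simp only [inner_sub_left, inner_sub_right, inner_smul_left, inner_smul_right, conj_trivial,
      ← hq, ← hb, h1]
    ring
  -- In the centring terms `|b| ≤ L / √n` compensates `‖ones n‖ = √n`.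
  have hA : |inner ℝ q (offOp a ζ q) - 2 * b * inner ℝ (ones n) (offOp a ζ q) +
        b ^ 2 * inner ℝ (ones n) (offOp a ζ (ones n))| ≤ 4 * L ^ 3 * (n * τ) := by
    have h1 := h.abs_inner_offOp_dataRow hs
    have h2 : |inner ℝ (ones n) (offOp a ζ q)| ≤ y * (L * n * τ) := by
      refine (abs_real_inner_le_norm _ _).trans ?_
      rw [norm_ones]
      exact mul_le_mul_of_nonneg_left (h.norm_offOp_dataRow hL0 hτ.le hs) hy0.le
    have h3 : |inner ℝ (ones n) (offOp a ζ (ones n))| ≤ y * (L * n * τ) := by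
      refine (abs_real_inner_le_norm _ _).trans ?_
      rw [norm_ones]
      exact mul_le_mul_of_nonneg_left (h.norm_offOp_ones hL0 hτ.le) hy0.le
    have h4 : |2 * b * inner ℝ (ones n) (offOp a ζ q)| ≤ 2 * (L / y) * (y * (L * n * τ)) := by
      rw [abs_mul, abs_mul, abs_two]
      exact mul_le_mul (by linarith) h2 (abs_nonneg _) (by positivity)
    have h5 : |b ^ 2 * inner ℝ (ones n) (offOp a ζ (ones n))| ≤
        (L / y) ^ 2 * (y * (L * n * τ)) := by
      rw [abs_mul, abs_pow]
      exact mul_le_mul (pow_le_pow_left₀ (abs_nonneg _) hmean 2) h3 (abs_nonneg _) (by positivity)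
    have e4 : 2 * (L / y) * (y * (L * n * τ)) = 2 * L ^ 2 * (n * τ) := by field_simp
    have e5 : (L / y) ^ 2 * (y * (L * n * τ)) ≤ L ^ 3 * (n * τ) := by
      have : (L / y) ^ 2 * (y * (L * n * τ)) = L ^ 3 * (n * τ) / y := by field_simp
      rw [this]; exact div_le_self (by positivity) hy1
    have e6 : L * n * τ ≤ L ^ 3 * (n * τ) := by
      rw [mul_assoc]; exact mul_le_mul_of_nonneg_right (le_self_pow₀ hL (by norm_num))
        (by positivity)
    have e7 : L ^ 2 * (n * τ) ≤ L ^ 3 * (n * τ) :=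
      mul_le_mul_of_nonneg_right (pow_le_pow_right₀ hL (by norm_num)) (by positivity)
    refine (abs_add_le _ _).trans ((add_le_add (abs_sub _ _) le_rfl).trans ?_)
    linarith
  have hdiag : ∑ i, diagDev a (ζ i) * (dualVec ζ s i * dualVec ζ s i) =
      ((n : ℝ) - 1)⁻¹ * ∑ i, diagDev a (ζ i) * (ζ i s - b) ^ 2 := by
    rw [Finset.mul_sum, ← hs2]
    refine Finset.sum_congr rfl fun i _ => ?_
    simp [dualVec, dataRow, ones, ← hb]; ring
  -- Cauchy–Schwarz between the diagonal, of norm `O(√n τ)`, and the squared entries, of norm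
  -- `O(√n)`.
  have hD : |∑ i, diagDev a (ζ i) * (ζ i s - b) ^ 2| ≤ 4 * L ^ 3 * (n * τ) := by
    have h1 : ∑ i, ((ζ i s - b) ^ 2) ^ 2 ≤ 16 * L ^ 4 * n := by
      have h2 : ∀ x : ℝ, ((x - b) ^ 2) ^ 2 ≤ 8 * x ^ 4 + 8 * b ^ 4 := by
        intro x
        have h3 : (x - b) ^ 2 ≤ 2 * x ^ 2 + 2 * b ^ 2 := by nlinarith [sq_nonneg (x + b)]
        have h4 := pow_le_pow_left₀ (sq_nonneg _) h3 2
        nlinarith [sq_nonneg (x ^ 2 - b ^ 2)]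
      have h3 : b ^ 4 ≤ L ^ 4 := by
        have : |b| ≤ L := hmean.trans (div_le_self hL0 hy1)
        calc b ^ 4 = |b| ^ 4 := by rw [← abs_pow, abs_of_nonneg (by positivity)]
          _ ≤ _ := pow_le_pow_left₀ (abs_nonneg _) this 4
      have h4 : L ^ 2 ≤ L ^ 4 := pow_le_pow_right₀ hL (by norm_num)
      calc _ ≤ ∑ i, (8 * ζ i s ^ 4 + 8 * b ^ 4) := Finset.sum_le_sum fun i _ => h2 _
        _ = 8 * ∑ i, ζ i s ^ 4 + n * (8 * b ^ 4) := by
            rw [Finset.sum_add_distrib, ← Finset.mul_sum]; simp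
        _ ≤ 8 * (L ^ 4 * n) + n * (8 * L ^ 4) := by
            have := (h.fourth s hs).trans (mul_le_mul_of_nonneg_right h4 (by linarith))
            gcongr
        _ = _ := by ring
    refine abs_le_of_sq_le_sq ((Finset.sum_mul_sq_le_sq_mul_sq _ _ _).trans ?_) (by positivity)
    calc _ ≤ (L * y * τ) ^ 2 * (16 * L ^ 4 * n) :=
          mul_le_mul h.diag h1 (Finset.sum_nonneg fun _ _ => by positivity) (by positivity)
      _ = _ := by rw [← hy2]; ring
  rw [inner_noiseDev_eq hn m lam ha hδ ζ hmem hmem, hoff, hdiag, ← mul_add, ← mul_assoc, abs_mul,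
    abs_of_nonneg (mul_nonneg hinv0 hinv0)]
  calc _ ≤ 2 / n * (2 / n) * (4 * L ^ 3 * (n * τ) + 4 * L ^ 3 * (n * τ)) :=
        mul_le_mul hsq ((abs_add_le _ _).trans (add_le_add hA hD)) (abs_nonneg _) (by positivity)
    _ = _ := by field_simp; ring

end SpikeEvent
end EventBounds

/-! ### The data matrix as an operator, and its dual directions. -/

section DataMap

variable {d n : ℕ}

/-- The map `y ↦ ((n - 1)^{-1/2} ⟪x_i - x̄, y⟫)_i`, whose Gram operator is the sample covariance. -/
def dataMap (x : Fin n → Vec d) : Vec d →ₗ[ℝ] Vec n :=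
  (WithLp.linearEquiv 2 ℝ (Fin n → ℝ)).symm.toLinearMap ∘ₗ LinearMap.pi fun i =>
    (√((n : ℝ) - 1))⁻¹ • innerₗ (Vec d) (x i - sampleMean x)

theorem dataMap_apply (x : Fin n → Vec d) (y : Vec d) (i : Fin n) :
    dataMap x y i = (√((n : ℝ) - 1))⁻¹ * inner ℝ (x i - sampleMean x) y := rfl

theorem inner_dataMap (hn : 0 < n) (x : Fin n → Vec d) (y y' : Vec d) :
    inner ℝ (dataMap x y) (dataMap x y') =
      inner ℝ (WithLp.toLp 2 ((sampleCov x).mulVec y.ofLp) : Vec d) y' := by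
  have hn' : (1 : ℝ) ≤ n := by exact_mod_cast hn
  have h1 : (WithLp.toLp 2 ((sampleCov x).mulVec y.ofLp) : Vec d) = ((n : ℝ) - 1)⁻¹ •
      ∑ i, (inner ℝ (x i - sampleMean x) y : ℝ) • (x i - sampleMean x) := by
    ext b
    simp only [sampleCov, Matrix.smul_mulVec, Matrix.sum_mulVec, Matrix.vecMulVec_mulVec,
      PiLp.smul_apply, smul_eq_mul, Pi.smul_apply, Finset.sum_apply, WithLp.ofLp_sum, vec_inner,
      dotProduct, MulOpposite.smul_eq_mul_unop, MulOpposite.unop_op]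
    congr 1
    exact Finset.sum_congr rfl fun i _ => mul_comm _ _
  have hs2 : (√((n : ℝ) - 1))⁻¹ * (√((n : ℝ) - 1))⁻¹ = ((n : ℝ) - 1)⁻¹ := by
    rw [← mul_inv, Real.mul_self_sqrt (by linarith)]
  rw [h1, inner_smul_left, sum_inner, vec_inner, conj_trivial, Finset.mul_sum]
  refine Finset.sum_congr rfl fun i _ => ?_
  rw [dataMap_apply, dataMap_apply, inner_smul_left, conj_trivial, ← hs2]
  ring

theorem inner_dataMap_eigen (hn : 0 < n) (x : Fin n → Vec d) {l : Fin d → ℝ}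
    {v : OrthonormalBasis (Fin d) ℝ (Vec d)} (hv : IsEigenDecomp (sampleCov x) l v)
    (k k' : Fin d) :
    inner ℝ (dataMap x (v k)) (dataMap x (v k')) = if k = k' then l k else 0 := by
  rw [inner_dataMap hn, hv.2 k, WithLp.toLp_smul, WithLp.toLp_ofLp, inner_smul_left,
    orthonormal_iff_ite.1 v.orthonormal]
  split_ifs <;> simp

theorem range_dataMap_le (hn : 0 < n) (x : Fin n → Vec d) :
    LinearMap.range (dataMap x) ≤ meanZero n := by
  have hn' : (n : ℝ) ≠ 0 := by exact_mod_cast hn.ne'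
  rintro _ ⟨y, rfl⟩
  rw [mem_meanZero, inner_ones]
  simp only [dataMap_apply]
  rw [← Finset.mul_sum, ← sum_inner, Finset.sum_sub_distrib, Finset.sum_const, Finset.card_univ,
    Fintype.card_fin, sampleMean, ← Nat.cast_smul_eq_nsmul ℝ, smul_smul, mul_inv_cancel₀ hn',
    one_smul, sub_self, inner_zero_left, mul_zero]

theorem dataMap_datum (hn : 0 < n) (p : Population d) (ζ : Fin n → Vec d) (s : Fin d) :
    dataMap (fun i => p.datum (ζ i)) (p.h s) = √(p.lam s) • dualVec ζ s := by
  have hn' : (n : ℝ) ≠ 0 := by exact_mod_cast hn.ne'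
  have h1 : ∀ w, inner ℝ (p.datum w) (p.h s) = inner ℝ p.mu (p.h s) + √(p.lam s) * w s := by
    intro w
    rw [Population.datum, inner_add_left, sum_inner]
    simp [inner_smul_left, orthonormal_iff_ite.1 p.h.orthonormal]
  have h2 : inner ℝ (sampleMean fun i => p.datum (ζ i)) (p.h s) =
      inner ℝ p.mu (p.h s) + √(p.lam s) * ((∑ i, ζ i s) / n) := by
    rw [sampleMean, inner_smul_left, sum_inner]
    simp only [h1, Finset.sum_add_distrib, ← Finset.mul_sum]
    simp
    field_simp
  ext i
  rw [dataMap_apply, inner_sub_left, h1, h2]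
  simp [dualVec, dataRow, ones]
  ring

end DataMap

/-! ### The bound for one population and one sample. -/

section SinglePopulation

variable {d n : ℕ}

/-- The noise eigenvalues, with the leading `m` ones replaced by zero. -/
def Population.noiseWeight (p : Population d) (m : ℕ) (r : Fin d) : ℝ :=
  if m ≤ r.val then p.lam r else 0

theorem Population.noiseWeight_nonneg (p : Population d) (m : ℕ) (r : Fin d) :
    0 ≤ p.noiseWeight m r := by
  unfold noiseWeight; split_ifs
  · exact p.lam_nonneg r
  · exact le_rfl

theorem Population.eig_of_lt (p : Population d) {j : ℕ} (hj : j < d) :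
    p.eig j = p.lam ⟨j, hj⟩ := dif_pos hj

theorem Population.trace_Sigma2_sq (p : Population d) (m : ℕ) :
    Matrix.trace (p.Sigma2 m ^ 2) = ∑ r, p.noiseWeight m r ^ 2 := by
  have hdot : ∀ s t, (p.h s).ofLp ⬝ᵥ (p.h t).ofLp = if s = t then 1 else 0 := by
    intro s t
    rw [← orthonormal_iff_ite.1 p.h.orthonormal s t, vec_inner]
    rfl
  have hS : p.Sigma2 m =
      ∑ r, p.noiseWeight m r • Matrix.vecMulVec (p.h r).ofLp (p.h r).ofLp := by
    rw [Sigma2, Finset.sum_filter]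
    refine Finset.sum_congr rfl fun r _ => ?_
    unfold noiseWeight; split_ifs <;> simp
  rw [sq, hS, Finset.sum_mul_sum, Matrix.trace_sum]
  refine Finset.sum_congr rfl fun s _ => ?_
  rw [Matrix.trace_sum]
  simp only [Matrix.smul_mul, Matrix.mul_smul, Matrix.trace_smul, Matrix.vecMulVec_mul_vecMulVec,
    Matrix.trace_vecMulVec, hdot, smul_eq_mul, dotProduct_smul]
  simp [sq]

theorem Population.sum_noiseWeight_pow_four_le (p : Population d) (m : ℕ) :
    ∑ r, p.noiseWeight m r ^ 4 ≤ p.eig m ^ 2 * ∑ r, p.noiseWeight m r ^ 2 := by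
  rw [Finset.mul_sum]
  refine Finset.sum_le_sum fun r _ => ?_
  by_cases h : m ≤ r.val
  · have hm : m < d := lt_of_le_of_lt h r.isLt
    have h1 : p.noiseWeight m r ≤ p.eig m := by
      rw [p.eig_of_lt hm, noiseWeight, if_pos h]
      exact p.lam_antitone h
    have h2 := pow_le_pow_left₀ (p.noiseWeight_nonneg m r) h1 2
    calc _ = p.noiseWeight m r ^ 2 * p.noiseWeight m r ^ 2 := by ring
      _ ≤ _ := mul_le_mul_of_nonneg_right h2 (sq_nonneg _)
  · simp [noiseWeight, h]

/-- The quantitative form of the spike condition for one population. -/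
structure Population.IsSpiked (p : Population d) (m : ℕ) (c κ : ℝ) : Prop where
  lt : m < d
  gap : ∀ s t : Fin d, s < t → t.val < m → (1 + c) * p.lam t ≤ p.lam s
  pos : ∀ s : Fin d, s.val < m → 0 < p.lam s
  noise_pos : 0 < ∑ r, p.noiseWeight m r ^ 2
  noise_le : ∀ s : Fin d, s.val < m → √(∑ r, p.noiseWeight m r ^ 2) ≤ κ * p.lam s

/-- The ratio of the error bound `ε` of the dual directions to `n ^ (-1/2)`. -/
def dualConst (L κ : ℝ) : ℝ := 1 + 6 * L ^ 2 + 32 * L ^ 3 * κ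

/-- Apply `spiked_pca_bound` with `ε = dualConst L κ / √n`; `τ ≤ κ λ_j` converts noise bounds in `τ`
to bounds relative to `λ_j`. The parameter `η` enters only the smallness condition and not the rate.
-/
theorem betaHat_bound (p : Population d) {m : ℕ} {c κ L η : ℝ} (hp : p.IsSpiked m c κ)
    (hc : 0 < c) (hc1 : c ≤ 1) (hκ : 0 < κ) (hL : 1 ≤ L) (hη : 0 ≤ η) (hn : 2 ≤ n)
    (hn1 : m * (dualConst L κ / √n) ≤ c / 16) (hn2 : 2 * (η + L / √n) * κ ≤ c / 16)
    (ζ : Fin n → Vec d)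
    (hE : spikeStat (Finset.univ.filter fun s : Fin d => s.val < m) (p.noiseWeight m) ζ ≤ L ^ 2)
    (hF : ∑ i, ∑ k, (∑ l, offKernel (p.noiseWeight m) ζ i l *
      offKernel (p.noiseWeight m) ζ l k) ^ 2 ≤ (η * n * √(∑ r, p.noiseWeight m r ^ 2)) ^ 4)
    {l : Fin d → ℝ} {v : OrthonormalBasis (Fin d) ℝ (Vec d)}
    (hv : IsEigenDecomp (sampleCov fun i => p.datum (ζ i)) l v)
    (hsign : ∀ j, 0 ≤ inner ℝ (p.h j) (v j)) {j : ℕ} (hj : j < m) :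
    |‖betaHat l v j - p.beta j‖ ^ 2 / p.eig j - p.delta m n / p.eig j| ≤
      spikeConst m (c / 4) * dualConst L κ ^ 2 / n := by
  have hn' : (2 : ℝ) ≤ n := by exact_mod_cast hn
  have hn0 : 0 < n := by omega
  have hjd : j < d := hj.trans hp.lt
  set y := √(n : ℝ) with hy
  have hy2 : y ^ 2 = n := Real.sq_sqrt (by linarith)
  have hy0 : 0 < y := by rw [hy]; positivity
  set τ := √(∑ r, p.noiseWeight m r ^ 2) with hτ
  have hτ0 : 0 < τ := Real.sqrt_pos.2 hp.noise_pos
  have hT : ∑ r, p.noiseWeight m r ^ 2 = τ ^ 2 := (Real.sq_sqrt hp.noise_pos.le).symm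
  set J := Finset.univ.filter fun s : Fin d => s.val < m with hJ
  have hmem : ∀ s : Fin d, s.val < m → s ∈ J := fun s hs => by simpa [hJ] using hs
  have ev := spikeEvent_of_spikeStat_le (by linarith) hn0 hτ0 hT hE
  set K := dualConst L κ with hK
  have hK1 : 6 * L ^ 2 ≤ K := by
    have : 0 ≤ 32 * L ^ 3 * κ := by positivity
    rw [hK, dualConst]; linarith
  have hK2 : 32 * L ^ 3 * κ ≤ K := by rw [hK, dualConst]; nlinarith
  have hK3 : 1 ≤ K := by
    have : 0 ≤ 32 * L ^ 3 * κ := by positivity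
    rw [hK, dualConst]; nlinarith
  set ε := K / y with hε
  have hε0 : 0 ≤ ε := by positivity
  have hm1 : (1 : ℝ) ≤ m := by exact_mod_cast (Nat.zero_lt_of_lt hj)
  have hε1 : ε ≤ 1 := by nlinarith
  have hgram : ∀ s t : Fin d, s.val < m → t.val < m →
      |inner ℝ (dualVec ζ s) (dualVec ζ t) - (if s = t then 1 else 0)| ≤ ε := fun s t hs ht =>
    (ev.gram_le hn hL (hmem s hs) (hmem t ht)).trans (div_le_div_of_nonneg_right hK1 hy0.le)
  have hvn : ∀ s : Fin d, s.val < m → ‖dualVec ζ s‖ ≤ 2 := by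
    intro s hs
    have h1 := (abs_le.1 (hgram s s hs hs)).2
    rw [if_pos rfl, real_inner_self_eq_norm_sq] at h1
    nlinarith [norm_nonneg (dualVec ζ s)]
  set jj : Fin d := ⟨j, hjd⟩ with hjj
  have hlj := hp.pos jj hj
  have hτj := hp.noise_le jj hj
  have ha : ∀ r, p.noiseWeight m r = if m ≤ r.val then p.lam r else 0 := fun _ => rfl
  have hδ : p.delta m n = (∑ r with m ≤ r.val, p.lam r) / ((n : ℝ) - 1) := rfl
  have hδ0 : 0 ≤ p.delta m n := by
    rw [hδ]
    exact div_nonneg (Finset.sum_nonneg fun r _ => p.lam_nonneg r) (by linarith)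
  have main := spiked_pca_bound (dataMap fun i => p.datum (ζ i)) p.h v p.lam l (dualVec ζ)
    p.lam_nonneg p.lam_antitone (dataMap_datum hn0 p ζ) hv.1 (inner_dataMap_eigen hn0 _ hv) m
    hp.lt.le jj hj hp.pos hc hc1 hp.gap (meanZero n) (range_dataMap_le hn0 _)
    (fun s _ => dualVec_mem hn0 ζ s) hδ0 hε0 hn1 hgram
    (fun s hs => (ev.norm_noiseDev_dualVec_le hn hL hτ0 ha hδ (hmem s hs) (hvn s hs)).trans (by
      rw [hε, div_mul_eq_mul_div]
      refine div_le_div_of_nonneg_right ?_ hy0.le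
      have h1 : 10 * L ^ 2 ≤ 32 * L ^ 3 := by
        have := mul_le_mul_of_nonneg_left hL (sq_nonneg L)
        nlinarith [sq_nonneg L]
      calc 10 * L ^ 2 * τ ≤ 32 * L ^ 3 * (κ * p.lam jj) :=
            mul_le_mul h1 hτj hτ0.le (by positivity)
        _ = 32 * L ^ 3 * κ * p.lam jj := by ring
        _ ≤ _ := mul_le_mul_of_nonneg_right hK2 hlj.le))
    (fun w hw => (ev.norm_noiseDev_le_of_frobenius hn hL hτ0 ha hδ hη hF hw).trans (by
      refine mul_le_mul_of_nonneg_right ?_ (norm_nonneg _)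
      calc 2 * (η + L / y) * τ ≤ 2 * (η + L / y) * (κ * p.lam jj) :=
            mul_le_mul_of_nonneg_left hτj (by positivity)
        _ = 2 * (η + L / y) * κ * p.lam jj := by ring
        _ ≤ _ := mul_le_mul_of_nonneg_right hn2 hlj.le))
    ((ev.abs_inner_noiseDev_dualVec_le hn hL hτ0 ha hδ (hmem jj hj)).trans (by
      rw [hε, div_pow, hy2, div_mul_eq_mul_div]
      refine div_le_div_of_nonneg_right ?_ (by linarith)
      calc 32 * L ^ 3 * τ ≤ 32 * L ^ 3 * (κ * p.lam jj) :=
            mul_le_mul_of_nonneg_left hτj (by positivity)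
        _ = 32 * L ^ 3 * κ * p.lam jj := by ring
        _ ≤ K ^ 2 * p.lam jj := mul_le_mul_of_nonneg_right (by nlinarith) hlj.le))
    (hsign jj)
  have e1 : betaHat l v j = √(l jj) • v jj := by
    rw [betaHat, entry, entry, dif_pos hjd, dif_pos hjd]
  have e2 : p.beta j = √(p.lam jj) • p.h jj := by
    rw [Population.beta, p.eig_of_lt hjd, entry, dif_pos hjd]
  rw [e1, e2, p.eig_of_lt hjd]
  refine main.trans (le_of_eq ?_)
  rw [hε, div_pow, hy2]; ring

end SinglePopulation

/-! ### Uniform constants along the sequence of populations. -/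

section Sequence

/-- There are finitely many pairs below `m`, so one constant and one threshold serve them all. -/
theorem SpikeCondition.exists_gap {m : ℕ} {pop : ∀ d, Population d} (hC : SpikeCondition m pop) :
    ∃ c > 0, c ≤ 1 ∧ ∀ᶠ d in atTop, ∀ j j' : ℕ, j < j' → j' < m →
      c ≤ (pop d).eig j / (pop d).eig j' - 1 := by
  have key : ∀ S : Finset (ℕ × ℕ), ∃ c > (0 : ℝ), c ≤ 1 ∧ ∀ᶠ d in atTop, ∀ x ∈ S,
      x.1 < x.2 → x.2 < m → c ≤ (pop d).eig x.1 / (pop d).eig x.2 - 1 := by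
    intro S
    induction S using Finset.induction_on with
    | empty => exact ⟨1, one_pos, le_rfl, by simp⟩
    | insert x S _ ih =>
      obtain ⟨c, hc, hc1, h⟩ := ih
      by_cases hx : x.1 < x.2 ∧ x.2 < m
      · obtain ⟨c', hc', h'⟩ := hC.distinct x.1 x.2 hx.1 hx.2
        refine ⟨min c c', lt_min hc hc', (min_le_left _ _).trans hc1, ?_⟩
        filter_upwards [h, h'] with d hd hd' y hy hy1 hy2
        rcases Finset.mem_insert.1 hy with rfl | hy
        · exact (min_le_right _ _).trans hd'
        · exact (min_le_left _ _).trans (hd y hy hy1 hy2)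
      · refine ⟨c, hc, hc1, ?_⟩
        filter_upwards [h] with d hd y hy hy1 hy2
        rcases Finset.mem_insert.1 hy with rfl | hy
        · exact absurd ⟨hy1, hy2⟩ hx
        · exact hd y hy hy1 hy2
  obtain ⟨c, hc, hc1, h⟩ := key (Finset.range m ×ˢ Finset.range m)
  refine ⟨c, hc, hc1, h.mono fun d hd j j' hjj' hj' => hd (j, j') ?_ hjj' hj'⟩
  simp [hj', hjj'.trans hj']

theorem SpikeCondition.exists_isSpiked {m : ℕ} (hm : 0 < m) {pop : ∀ d, Population d}
    (hC : SpikeCondition m pop) :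
    ∃ c κ : ℝ, 0 < c ∧ c ≤ 1 ∧ 0 < κ ∧ ∀ᶠ d in atTop, (pop d).IsSpiked m c κ := by
  obtain ⟨c, hc, hc1, hgap⟩ := hC.exists_gap
  obtain ⟨c', hc', hspike⟩ := hC.spike
  refine ⟨c, (√c')⁻¹, hc, hc1, by positivity, ?_⟩
  filter_upwards [hgap, hspike, eventually_gt_atTop m] with d hgap hspike hmd
  set p := pop d with hp
  rw [p.trace_Sigma2_sq] at hspike
  set T := ∑ r, p.noiseWeight m r ^ 2 with hT
  have hT0 : 0 ≤ T := Finset.sum_nonneg fun _ _ => sq_nonneg _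
  have hm1 : m - 1 < d := by omega
  -- If `T` were zero the spike ratio would be zero by the convention for division, contradicting
  -- its positive lower bound.
  have hTpos : 0 < T := by
    refine hT0.lt_of_ne fun h => ?_
    rw [← h, div_zero] at hspike
    linarith
  rw [le_div_iff₀ hTpos, p.eig_of_lt hm1] at hspike
  have hlast : 0 < p.lam ⟨m - 1, hm1⟩ := by
    refine (p.lam_nonneg _).lt_of_ne fun h => ?_
    rw [← h] at hspike
    have := mul_pos hc' hTpos
    linarith
  have hle : ∀ s : Fin d, s.val < m → p.lam ⟨m - 1, hm1⟩ ≤ p.lam s := fun s hs =>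
    p.lam_antitone (by rw [Fin.le_def]; simp only; omega)
  have hpos : ∀ s : Fin d, s.val < m → 0 < p.lam s := fun s hs => hlast.trans_le (hle s hs)
  refine ⟨hmd, fun s t hst ht => ?_, hpos, hTpos, fun s hs => ?_⟩
  · have h1 := hgap s t hst ht
    rw [p.eig_of_lt s.isLt, p.eig_of_lt t.isLt, le_sub_iff_add_le, le_div_iff₀ (hpos t ht)] at h1
    linarith
  · refine le_trans ?_ (mul_le_mul_of_nonneg_left (hle s hs) (by positivity))
    rw [inv_mul_eq_div, le_div_iff₀ (by positivity), mul_comm, ← Real.sqrt_mul hc'.le]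
    exact Real.sqrt_le_iff.2 ⟨hlast.le, hspike⟩

/-- As `E z_j² = 1`, the fourth moment is `M_j + 1`. -/
theorem MomentCondition.exists_momentBounds {pop : ∀ d, Population d} (hA : MomentCondition pop) :
    ∃ C : ℝ, ∀ᶠ d in atTop, MomentBounds (pop d).zlaw C := by
  obtain ⟨C, hC⟩ := hA.bounded_M
  refine ⟨max C 0 + 1, hC.mono fun d hd => ?_⟩
  have := (pop d).isProbabilityMeasure
  refine ⟨by linarith [le_max_right C 0], hA.memLp_four d, (pop d).mean_zero, (pop d).cov_eq_one,
    hA.moment_two_two d, hA.moment_four d, fun j => ?_⟩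
  have h1 := hd j
  have h2 : MemLp (fun w : Vec d => w j ^ 2) 2 (pop d).zlaw := by
    simpa only [sq] using memLp_two_mul_of_four (hA.memLp_four d j) (hA.memLp_four d j)
  have h3 : ∫ w : Vec d, w j ^ 2 ∂(pop d).zlaw = 1 := by
    have := (pop d).cov_eq_one j j
    simpa only [← sq, if_true] using this
  rw [Population.M, variance_eq_sub h2, h3] at h1
  have h4 : ∫ w : Vec d, w j ^ 4 ∂(pop d).zlaw = ∫ w, ((fun w : Vec d => w j ^ 2) ^ 2) w
      ∂(pop d).zlaw := by
    congr 1; ext w; simp only [Pi.pow_apply]; ring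
  rw [h4]
  linarith [le_max_left C 0]

theorem MeanLE.comp_hasLaw {Ω X : Type*} [MeasurableSpace Ω] [MeasurableSpace X] {P : Measure Ω}
    {ν : Measure X} {g : Ω → X} (hg : HasLaw g ν P) {f : X → ℝ} {c : ℝ} (hf : MeanLE ν f c) :
    MeanLE P (fun ω => f (g ω)) c where
  nonneg ω := hf.nonneg _
  integrable := by
    have h := hf.integrable
    rw [← hg.map_eq] at h
    exact h.comp_aemeasurable hg.aemeasurable
  integral_le := (hg.integral_comp hf.integrable.aestronglyMeasurable).le.trans hf.integral_le

end Sequence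

/-! ### Calculus of stochastic order symbols. -/

section InProbability

variable {ι : Type*} {Ω : ι → Type*} [∀ i, MeasurableSpace (Ω i)] {P : ∀ i, Measure (Ω i)}
  {F : Filter ι} {Y Z : ∀ i, Ω i → ℝ} {r q : ι → ℝ}

theorem IsBigOP.isLittleOPOne (h : IsBigOP P F Y r) (hr : Tendsto r F (𝓝 0)) :
    IsLittleOPOne P F Y := by
  intro ε hε
  rw [ENNReal.tendsto_nhds_zero]
  intro e he
  obtain ⟨e', he', hee'⟩ : ∃ e' : ℝ, 0 < e' ∧ ENNReal.ofReal e' ≤ e := by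
    rcases eq_or_ne e ⊤ with rfl | htop
    · exact ⟨1, one_pos, le_top⟩
    · exact ⟨e.toReal, ENNReal.toReal_pos he.ne' htop, ENNReal.ofReal_toReal_le⟩
  obtain ⟨K, hK⟩ := h e' he'
  have h0 : Tendsto (fun i => K * |r i|) F (𝓝 0) := by simpa using hr.abs.const_mul K
  filter_upwards [hK, h0.eventually (eventually_lt_nhds hε)] with i hi hi'
  exact (measure_mono fun ω hω => hi'.trans hω).trans (hi.trans hee')

/-- Only monotonicity and subadditivity of outer measure enter, so no measurability is needed. -/
theorem IsLittleOPOne.add (hY : IsLittleOPOne P F Y) (hZ : IsLittleOPOne P F Z) :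
    IsLittleOPOne P F fun i ω => Y i ω + Z i ω := by
  intro ε hε
  have h := (hY (ε / 2) (by positivity)).add (hZ (ε / 2) (by positivity))
  rw [add_zero] at h
  refine tendsto_of_tendsto_of_tendsto_of_le_of_le tendsto_const_nhds h (fun _ => zero_le)
    fun i => (measure_mono fun ω hω => ?_).trans (measure_union_le _ _)
  by_contra hcon
  simp only [Set.mem_union, Set.mem_ofPred, not_or, not_lt] at hcon hω
  linarith [abs_add_le (Y i ω) (Z i ω)]

theorem IsLittleOPOne.neg (hY : IsLittleOPOne P F Y) : IsLittleOPOne P F fun i ω => -Y i ω := by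
  intro ε hε
  simpa only [abs_neg] using hY ε hε

theorem isLittleOPOne_const_iff [∀ i, IsProbabilityMeasure (P i)] :
    IsLittleOPOne P F (fun i _ => q i) ↔ Tendsto q F (𝓝 0) := by
  constructor
  · intro h
    rw [Metric.tendsto_nhds]
    intro ε hε
    filter_upwards [(h (ε / 2) (by positivity)).eventually (eventually_lt_nhds one_pos)] with i hi
    rw [Real.dist_eq, sub_zero]
    by_contra hcon
    have : {ω : Ω i | ε / 2 < |q i|} = Set.univ :=
      Set.eq_univ_of_forall fun _ => by
        simp only [Set.mem_ofPred]; linarith [not_lt.1 hcon]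
    rw [this, measure_univ] at hi
    exact lt_irrefl _ hi
  · intro h ε hε
    refine tendsto_const_nhds.congr' ?_
    have h0 : Tendsto (fun i => |q i|) F (𝓝 0) := by simpa using h.abs
    filter_upwards [h0.eventually (eventually_lt_nhds hε)] with i hi
    have : {ω : Ω i | ε < |q i|} = ∅ :=
      Set.eq_empty_of_forall_notMem fun _ hω => lt_asymm hi hω
    rw [this, measure_empty]

end InProbability

end HDPCA

end

/-! ### The theorem. -/

open HDPCA in
theorem propositionA1 (m : ℕ) (hm : 0 < m)
    -- the population of dimension d, for every d
    (pop : ∀ d, Population d) (hA : MomentCondition pop) (hC : SpikeCondition m pop)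
    -- for every (d, n), an i.i.d. sample of size n
    {Ω : ℕ × ℕ → Type*} [∀ dn, MeasurableSpace (Ω dn)]
    (P : ∀ dn, Measure (Ω dn)) [∀ dn, IsProbabilityMeasure (P dn)]
    (z : ∀ dn : ℕ × ℕ, Fin dn.2 → Ω dn → Vec dn.1)
    (hz_law : ∀ dn i, HasLaw (z dn i) (pop dn.1).zlaw (P dn))
    (hz_indep : ∀ dn, iIndepFun (z dn) (P dn))
    -- sample eigenvalues and eigenvectors
    (lamHat : ∀ dn : ℕ × ℕ, Ω dn → Fin dn.1 → ℝ)
    (hHat : ∀ dn : ℕ × ℕ, Ω dn → OrthonormalBasis (Fin dn.1) ℝ (Vec dn.1))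
    (h_decomp : ∀ dn ω, IsEigenDecomp (sampleCov fun i => (pop dn.1).datum (z dn i ω))
      (lamHat dn ω) (hHat dn ω))
    (h_sign : ∀ dn ω j, 0 ≤ inner ℝ ((pop dn.1).h j) (hHat dn ω j))
    -- any regime in which d → ∞ and n → ∞
    (F : Filter (ℕ × ℕ)) (hF : F ≤ atTop ×ˢ atTop)
    (j : ℕ) (hj : j < m) :
    IsBigOP P F
      (fun dn ω => ‖betaHat (lamHat dn ω) (hHat dn ω) j - (pop dn.1).beta j‖ ^ 2
          / (pop dn.1).eig j - (pop dn.1).delta m dn.2 / (pop dn.1).eig j)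
      (fun dn => (dn.2 : ℝ)⁻¹) ∧
    (IsLittleOPOne P F
        (fun dn ω => ‖betaHat (lamHat dn ω) (hHat dn ω) j - (pop dn.1).beta j‖ ^ 2
          / (pop dn.1).eig j) ↔
      Tendsto (fun dn : ℕ × ℕ => (pop dn.1).delta m dn.2 / (pop dn.1).eig j) F (𝓝 0)) := by
  have hd : Tendsto (fun dn : ℕ × ℕ => dn.1) F atTop := tendsto_fst.mono_left hF
  have hn : Tendsto (fun dn : ℕ × ℕ => dn.2) F atTop := tendsto_snd.mono_left hF
  have hnR : Tendsto (fun dn : ℕ × ℕ => (dn.2 : ℝ)) F atTop :=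
    tendsto_natCast_atTop_atTop.comp hn
  have hbig : IsBigOP P F
      (fun dn ω => ‖betaHat (lamHat dn ω) (hHat dn ω) j - (pop dn.1).beta j‖ ^ 2
          / (pop dn.1).eig j - (pop dn.1).delta m dn.2 / (pop dn.1).eig j)
      (fun dn => (dn.2 : ℝ)⁻¹) := by
    obtain ⟨c, κ, hc, hc1, hκ, hspk⟩ := hC.exists_isSpiked hm
    obtain ⟨C, hmom⟩ := hA.exists_momentBounds
    intro e he
    set b := |spikeStatBound m C| with hb
    -- Chosen so that `(e / 2) * L = e / 2 + b`; Markov's inequality at level `L ^ 2` then costs at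
    -- most `e / 2`.
    set L := 1 + 2 * b / e with hL
    have hL1 : 1 ≤ L := by
      have : 0 ≤ 2 * b / e := by positivity
      linarith
    have hbL : spikeStatBound m C / L ^ 2 ≤ e / 2 := by
      rw [div_le_iff₀ (by positivity)]
      have h1 : e / 2 * L = e / 2 + b := by rw [hL]; field_simp
      have h2 : e / 2 * L ≤ e / 2 * L ^ 2 :=
        mul_le_mul_of_nonneg_left (le_self_pow₀ hL1 two_ne_zero) (by positivity)
      have h3 := le_abs_self (spikeStatBound m C)
      linarith
    -- Once `L / √n ≤ η`, the operator bound `2 * (η + L / √n) * κ` is at most `4 * η * κ = c / 16`.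
    set η := c / (64 * κ) with hη
    have hη0 : 0 < η := by positivity
    set K := dualConst L κ with hK
    refine ⟨spikeConst m (c / 4) * K ^ 2, ?_⟩
    have hsqrt : Tendsto (fun dn : ℕ × ℕ => (√(dn.2 : ℝ))⁻¹) F (𝓝 0) :=
      tendsto_inv_atTop_zero.comp (Real.tendsto_sqrt_atTop.comp hnR)
    have hlim1 : Tendsto (fun dn : ℕ × ℕ => m * (K / √(dn.2 : ℝ))) F (𝓝 0) := by
      simpa [div_eq_mul_inv] using (hsqrt.const_mul K).const_mul (m : ℝ)
    have hlim2 : Tendsto (fun dn : ℕ × ℕ => L / √(dn.2 : ℝ)) F (𝓝 0) := by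
      simpa [div_eq_mul_inv] using hsqrt.const_mul L
    -- This is the Markov bound for `‖A²‖_F²` at level `(η n τ)⁴`; here the condition that no noise
    -- eigenvalue dominates is used.
    have hlim3 : Tendsto (fun dn : ℕ × ℕ => ((pop dn.1).eig m ^ 2 /
        Matrix.trace ((pop dn.1).Sigma2 m ^ 2) + 6 * C ^ 2 * (dn.2 : ℝ)⁻¹) / η ^ 4) F (𝓝 0) := by
      simpa using ((hC.noise.comp hd).add
        ((tendsto_inv_atTop_zero.comp hnR).const_mul (6 * C ^ 2))).div_const (η ^ 4)
    filter_upwards [hd.eventually hspk, hd.eventually hmom, hn.eventually_ge_atTop 2,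
      hlim1.eventually (eventually_le_nhds (by positivity : (0 : ℝ) < c / 16)),
      hlim2.eventually (eventually_le_nhds hη0),
      hlim3.eventually (eventually_le_nhds (by positivity : (0 : ℝ) < e / 2))]
      with dn hspk hmom hn2 h1 h2 h3
    obtain ⟨d, n⟩ := dn
    simp only at hspk hmom hn2 h1 h2 h3
    have := (pop d).isProbabilityMeasure
    have hn' : (2 : ℝ) ≤ n := by exact_mod_cast hn2
    have hlaw : HasLaw (fun ω i => z (d, n) i ω) (Measure.pi fun _ : Fin n => (pop d).zlaw)
        (P (d, n)) := (hz_indep (d, n)).hasLaw_pi fun i => hz_law (d, n) i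
    set p := pop d with hp
    set T := ∑ r, p.noiseWeight m r ^ 2 with hT
    have hTpos : 0 < T := hspk.noise_pos
    have hsqT : √T ^ 4 = T ^ 2 := by
      rw [show 4 = 2 * 2 by norm_num, pow_mul, Real.sq_sqrt hTpos.le]
    have hcard : (Finset.univ.filter fun s : Fin d => s.val < m).card = m := by
      rw [Fin.card_filter_val_lt, min_eq_right hspk.lt.le]
    have hstat := ((hmom.meanLE_spikeStat (n := n)
      (Finset.univ.filter fun s : Fin d => s.val < m) (p.noiseWeight_nonneg m)
      (fun s hs => by
        have : s.val < m := by simpa using hs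
        simp [Population.noiseWeight, this])
      (by omega) hTpos).comp_hasLaw hlaw).measure_lt_le
      (by positivity : 0 < L ^ 2)
    have hfrob := ((hmom.meanLE_frobenius (n := n) (p.noiseWeight_nonneg m)).comp_hasLaw
      hlaw).measure_lt_le (L := (η * n * √T) ^ 4) (by positivity)
    have hfrob' : (n ^ 4 * ∑ r, p.noiseWeight m r ^ 4 + 6 * C ^ 2 * n ^ 3 * T ^ 2) /
        (η * n * √T) ^ 4 ≤ e / 2 := by
      refine le_trans ?_ h3
      rw [p.trace_Sigma2_sq, ← hT, mul_pow, mul_pow, hsqT]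
      have h4 := p.sum_noiseWeight_pow_four_le m
      calc _ ≤ (n ^ 4 * (p.eig m ^ 2 * T) + 6 * C ^ 2 * n ^ 3 * T ^ 2) /
            (η ^ 4 * n ^ 4 * T ^ 2) := by gcongr
        _ = _ := by
            have : (n : ℝ) ≠ 0 := by linarith
            field_simp
    calc _ ≤ P (d, n) ({ω | L ^ 2 < spikeStat (Finset.univ.filter fun s : Fin d => s.val < m)
            (p.noiseWeight m) fun i => z (d, n) i ω} ∪ {ω | (η * n * √T) ^ 4 <
            ∑ i, ∑ k, (∑ l, offKernel (p.noiseWeight m) (fun i => z (d, n) i ω) i l *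
              offKernel (p.noiseWeight m) (fun i => z (d, n) i ω) l k) ^ 2}) := by
          -- Outside the two bad events the deterministic bound applies, so only an inclusion of
          -- sets is needed and the sample eigenvectors need not be measurable in `ω`.
          refine measure_mono fun ω hω => ?_
          by_contra hcon
          simp only [Set.mem_union, Set.mem_ofPred, not_or, not_lt] at hcon hω
          have hbd := betaHat_bound p hspk hc hc1 hκ hL1 hη0.le hn2 h1 (by
              calc 2 * (η + L / √n) * κ ≤ 2 * (η + η) * κ := by gcongr
                _ = c / 16 := by rw [hη]; field_simp; norm_num)
            (fun i => z (d, n) i ω) hcon.1 hcon.2 (h_decomp (d, n) ω) (h_sign (d, n) ω) hj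
          rw [abs_of_nonneg (by positivity : (0 : ℝ) ≤ (n : ℝ)⁻¹), ← div_eq_mul_inv] at hω
          exact absurd hω (not_lt.2 hbd)
      _ ≤ ENNReal.ofReal (e / 2) + ENNReal.ofReal (e / 2) := by
          refine (measure_union_le _ _).trans (add_le_add (hstat.trans ?_) (hfrob.trans ?_))
          · rw [hcard]; exact ENNReal.ofReal_le_ofReal hbL
          · exact ENNReal.ofReal_le_ofReal hfrob'
      _ = ENNReal.ofReal e := by
          rw [← ENNReal.ofReal_add (by positivity) (by positivity), add_halves]
  refine ⟨hbig, ?_⟩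
  have hlittle := hbig.isLittleOPOne (tendsto_inv_atTop_zero.comp hnR)
  rw [← isLittleOPOne_const_iff (P := P)]
  constructor
  · intro h
    simpa using h.add hlittle.neg
  · intro h
    simpa using h.add hlittle
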